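/- Let $X$ be a locally compact Hausdorff space that is countable at infinity ($\sigma$-compact). Let $\Phi=C_c(X;\mathbb C)$ carry its usual locally convex inductive limit topology, and let $\Phi'$ be its dual, identified with the space of complex-valued Radon measures on $X$. Let $\Phi^{\hat\odot k}$ be the subspace of symmetric functions in $C_c(X^k;\mathbb C)$ ($\Phi^{\hat\odot0}=\mathbb C$, $\Phi^{\hat\odot1}=\Phi$), and let $\mathcal P(\Phi')$ be the space of polynomials $p(\omega)=\sum_{k=0}^K\langle\omega^{\otimes k},f^{(k)}\rangle$, $f^{(k)}\in\Phi^{\hat\odot k}$, $\omega\in\Phi'$, with the topology of the locally convex direct sum of the spaces $\Phi^{\hat\odot k}$. For locally convex spaces $V,W$, $\mathcal L(V,W)$ denotes the continuous linear operators, and $\mathcal L(V)=\mathcal L(V,V)$. An operator $P\in\mathcal L(\mathcal P(\Phi'))$ is called a Sheffer operator if (a) there are $P_{ik}\in\mathcal L(\Phi^{\hat\odot k},\Phi^{\hat\odot i})$, $0\le i<k$, with $P\langle\cdot^{\otimes k},f\rangle=\langle\cdot^{\otimes k},f\rangle+\sum_{i<k}\langle\cdot^{\otimes i},P_{ik}f\rangle$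 for all $k\ge0$ and $f\in\Phi^{\hat\odot k}$; and (b) there are $A_k\in\mathcal L(\Phi^{\hat\odot k},\mathbb C)$ ($k\ge1$) and $B_k\in\mathcal L(\Phi^{\hat\odot k},\Phi)$ ($k\ge2$) such that, with $A(\xi)=1+\sum_{k\ge1}A_k\xi^{\otimes k}$ and $B(\xi)=\xi+\sum_{k\ge2}B_k\xi^{\otimes k}$, $$\sum_{k=0}^\infty\frac1{k!}\,\big(P\langle\cdot^{\otimes k},\xi^{\otimes k}\rangle\big)(\omega)=\exp\big[\langle\omega,B(\xi)\rangle\big]A(\xi)$$ for every $\omega\in\Phi'$, as an equality of formal tensor power series in $\xi\in\Phi$. Let $\mathfrak s(\Phi)$ be the set of all logarithms $\log P=\sum_{n\ge1}\frac{(-1)^{n+1}}n(P-\mathbf 1)^n$ of Sheffer operators $P$ (on each polynomial the series has only finitely many non-zero terms); this is the Lie algebra of the Sheffer group. Then an operator $Q\in\mathcal L(\mathcal P(\Phi'))$ belongs to $\mathfrak s(\Phi)$ if and only if there exist symmetric complex-valued Radon measures $\alpha_k$ on $X^k$ ($k\ge1$) and families $\beta_k(x,\cdot)$, $x\in X$,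 of symmetric complex-valued Radon measures on $X^k$ ($k\ge2$), for which $f\mapsto\big(x\mapsto\int_{X^k}f\,d\beta_k(x,\cdot)\big)$ is a continuous linear operator from $\Phi^{\hat\odot k}$ to $\Phi$, such that for all $p\in\mathcal P(\Phi')$ and $\omega\in\Phi'$ $$(Qp)(\omega)=\sum_{k=1}^\infty\int_{X^k}(D_{x_1}\cdots D_{x_k}p)(\omega)\,\alpha_k(dx_1\cdots dx_k)+\sum_{k=2}^\infty\int_X\int_{X^k}(D_{x_1}\cdots D_{x_k}p)(\omega)\,\beta_k(x,dx_1\cdots dx_k)\,\omega(dx),$$ where $D_x$ is the Gâteaux derivative in the direction of the Dirac measure $\delta_x$, and both series have only finitely many non-zero terms. -/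

import Mathlib

open scoped BoundedContinuousFunction CompactlySupported

noncomputable section

namespace ShefferLie

/-! ### The finest locally convex topology making a family of maps continuous -/

section Final

/-- The finest locally convex vector space topology on the complex vector space `F` for which
all the maps `T i : E i → F` are continuous (locally convex inductive limit / direct sum topology).
In the order on topologies used here, the finest one is the infimum. -/
@[reducible] def lcFinal {ι : Type*} {E : ι → Type*} [∀ i, TopologicalSpace (E i)] {F : Type*}
    [AddCommGroup F] [Module ℂ F] [Module ℝ F] (T : ∀ i, E i → F) : TopologicalSpace F :=
  sInf {t : TopologicalSpace F | @IsTopologicalAddGroup F t _ ∧ @ContinuousSMul ℂ F _ _ t ∧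
    @LocallyConvexSpace ℝ F _ _ _ _ t ∧ ∀ i, @Continuous _ _ _ t (T i)}

variable {ι : Type*} {E : ι → Type*} [∀ i, TopologicalSpace (E i)] {F : Type*}
  [AddCommGroup F] [Module ℂ F] [Module ℝ F] (T : ∀ i, E i → F)

theorem lcFinal_isTopologicalAddGroup : @IsTopologicalAddGroup F (lcFinal T) _ :=
  topologicalAddGroup_sInf fun _ ht => ht.1

theorem lcFinal_continuousSMul : @ContinuousSMul ℂ F _ _ (lcFinal T) :=
  continuousSMul_sInf fun _ ht => ht.2.1

theorem lcFinal_locallyConvexSpace : @LocallyConvexSpace ℝ F _ _ _ _ (lcFinal T) :=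
  LocallyConvexSpace.sInf fun _ ht => ht.2.2.1

theorem continuous_lcFinal (i : ι) : @Continuous _ _ _ (lcFinal T) (T i) :=
  continuous_sInf_rng.2 fun _ ht => ht.2.2.2 i

theorem continuous_of_lcFinal {G : Type*} [AddCommGroup G] [Module ℂ G] [Module ℝ G]
    [TopologicalSpace G] [IsTopologicalAddGroup G] [ContinuousSMul ℂ G] [LocallyConvexSpace ℝ G]
    [IsScalarTower ℝ ℂ F] [IsScalarTower ℝ ℂ G]
    (L : F →ₗ[ℂ] G) (hL : ∀ i, Continuous fun e => L (T i e)) :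
    @Continuous _ _ (lcFinal T) _ L := by
  rw [continuous_iff_le_induced]
  refine sInf_le ⟨topologicalAddGroup_induced L, continuousSMul_induced L,
    LocallyConvexSpace.induced (L.restrictScalars ℝ), fun i => continuous_induced_rng.2 (hL i)⟩

end Final

/-! ### The (LB)-space `C_c(Y; ℂ)` -/

section Cc

variable {Y : Type*} [TopologicalSpace Y]

/-- The Banach space of continuous functions on `Y` vanishing outside the set `K`, with the
supremum norm. -/
def suppIn (K : Set Y) : Submodule ℂ (Y →ᵇ ℂ) where
  carrier := {f | ∀ y, y ∉ K → f y = 0}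
  add_mem' hf hg y hy := by simp [hf y hy, hg y hy]
  zero_mem' y _ := rfl
  smul_mem' c f hf y hy := by simp [hf y hy]

variable [T2Space Y]

/-- The inclusion of the functions vanishing outside the compact set `K` into `C_c(Y; ℂ)`. -/
def suppInToCc (K : TopologicalSpace.Compacts Y) : suppIn (K : Set Y) →ₗ[ℂ] C_c(Y, ℂ) where
  toFun f := ⟨f.1.toContinuousMap, HasCompactSupport.intro K.isCompact fun y hy => f.2 y hy⟩
  map_add' _ _ := rfl
  map_smul' _ _ := rfl

@[simp] theorem suppInToCc_apply (K : TopologicalSpace.Compacts Y) (f : suppIn (K : Set Y))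
    (y : Y) : suppInToCc K f y = f.1 y := rfl

/-- `C_c(Y; ℂ)` is the locally convex inductive limit of the Banach spaces of continuous functions
vanishing outside `K`, for `K` compact. -/
instance instTopologicalSpaceCc : TopologicalSpace C_c(Y, ℂ) :=
  lcFinal fun K : TopologicalSpace.Compacts Y => suppInToCc K

instance : IsTopologicalAddGroup C_c(Y, ℂ) := lcFinal_isTopologicalAddGroup _

instance : ContinuousSMul ℂ C_c(Y, ℂ) :=
  lcFinal_continuousSMul fun K : TopologicalSpace.Compacts Y => suppInToCc K

instance : LocallyConvexSpace ℝ C_c(Y, ℂ) := lcFinal_locallyConvexSpace _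

theorem continuous_suppInToCc (K : TopologicalSpace.Compacts Y) : Continuous (suppInToCc K) :=
  continuous_lcFinal (fun K : TopologicalSpace.Compacts Y => suppInToCc K) K

theorem continuous_of_suppIn {G : Type*} [AddCommGroup G] [Module ℂ G] [Module ℝ G]
    [TopologicalSpace G] [IsTopologicalAddGroup G] [ContinuousSMul ℂ G] [LocallyConvexSpace ℝ G]
    [IsScalarTower ℝ ℂ G] (L : C_c(Y, ℂ) →ₗ[ℂ] G)
    (hL : ∀ K : TopologicalSpace.Compacts Y, Continuous fun e => L (suppInToCc K e)) :
    Continuous L :=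
  continuous_of_lcFinal _ L hL

/-- The Dirac measure at `y`, as the functional `f ↦ f y` on `C_c(Y; ℂ)`. -/
def dirac (y : Y) : C_c(Y, ℂ) →L[ℂ] ℂ where
  toFun f := f y
  map_add' _ _ := rfl
  map_smul' _ _ := rfl
  cont := continuous_of_suppIn (Y := Y) (G := ℂ)
    { toFun := fun f => f y, map_add' := fun _ _ => rfl, map_smul' := fun _ _ => rfl }
    fun _ => (BoundedContinuousFunction.evalCLM ℂ y).continuous.comp continuous_subtype_val

end Cc

/-! ### Tensor powers of elements of the dual space -/

section Tensor

variable {X : Type*} [TopologicalSpace X]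

/-- If `f` vanishes outside `K`, all its slices vanish outside the image of `K` in `X ^ k`. -/
def tailCompacts {k : ℕ} (K : TopologicalSpace.Compacts (Fin (k + 1) → X)) :
    TopologicalSpace.Compacts (Fin k → X) :=
  K.map (fun z => Fin.tail z) (by unfold Fin.tail; fun_prop)

/-- The image of `K ⊆ X ^ (k+1)` in the first factor `X`. -/
def headCompacts {k : ℕ} (K : TopologicalSpace.Compacts (Fin (k + 1) → X)) :
    TopologicalSpace.Compacts X :=
  K.map (fun z => z 0) (by fun_prop)

/-- The slices of a function vanishing outside `K`, as elements of a Banach space. -/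
def sliceIn {k : ℕ} (K : TopologicalSpace.Compacts (Fin (k + 1) → X))
    (f : suppIn (K : Set (Fin (k + 1) → X))) (x : X) :
    suppIn (tailCompacts K : Set (Fin k → X)) :=
  ⟨f.1.compContinuous ⟨fun y => Fin.cons x y, by fun_prop⟩, fun y hy => f.2 _ fun h =>
    hy ⟨Fin.cons x y, h, Fin.tail_cons _ _⟩⟩

theorem continuous_sliceIn {k : ℕ} (K : TopologicalSpace.Compacts (Fin (k + 1) → X))
    (f : suppIn (K : Set (Fin (k + 1) → X))) : Continuous (sliceIn K f) := by
  rw [continuous_induced_rng, continuous_iff_continuousAt]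
  intro x₀
  have hF : Continuous (Function.uncurry fun (x : X) (y : Fin k → X) =>
      f.1 (Fin.cons (α := fun _ => X) x y)) := f.1.continuous.comp (by fun_prop)
  have hc : Continuous (ContinuousMap.curry ⟨_, hF⟩) := ContinuousMap.continuous _
  have h := (ContinuousMap.tendsto_iff_forall_isCompact_tendstoUniformlyOn.1
    (hc.tendsto x₀)) _ (tailCompacts K).isCompact
  rw [ContinuousAt, Metric.tendsto_nhds]
  intro ε hε
  filter_upwards [Metric.tendstoUniformlyOn_iff.1 h (ε / 2) (half_pos hε)] with x hx
  refine lt_of_le_of_lt ((BoundedContinuousFunction.dist_le (half_pos hε).le).2 fun y => ?_)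
    (half_lt_self hε)
  by_cases hy : y ∈ (tailCompacts K : Set (Fin k → X))
  · have := hx y hy
    rw [dist_comm] at this
    exact this.le
  · have h1 := (sliceIn K f x).2 y hy
    have h2 := (sliceIn K f x₀).2 y hy
    simp only [Function.comp_apply, h1, h2, dist_self]
    exact (half_pos hε).le

variable [T2Space X]

/-- The function `y ↦ f (x, y)` on `X ^ k`, for `f ∈ C_c(X ^ (k+1); ℂ)` and `x ∈ X`. -/
def slice {k : ℕ} (f : C_c(Fin (k + 1) → X, ℂ)) (x : X) : C_c(Fin k → X, ℂ) where
  toFun y := f (Fin.cons x y)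
  continuous_toFun := f.continuous.comp (by fun_prop)
  hasCompactSupport' := by
    refine HasCompactSupport.intro
      (f.hasCompactSupport.isCompact.image (f := fun z : Fin (k + 1) → X => Fin.tail z)
        (by unfold Fin.tail; fun_prop)) fun y hy => ?_
    by_contra h
    exact hy ⟨Fin.cons x y, subset_tsupport _ h, Fin.tail_cons _ _⟩

@[simp] theorem slice_apply {k : ℕ} (f : C_c(Fin (k + 1) → X, ℂ)) (x : X) (y : Fin k → X) :
    slice f x y = f (Fin.cons x y) := rfl

theorem suppInToCc_sliceIn {k : ℕ} (K : TopologicalSpace.Compacts (Fin (k + 1) → X))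
    (f : suppIn (K : Set (Fin (k + 1) → X))) (x : X) :
    suppInToCc _ (sliceIn K f x) = slice (suppInToCc K f) x := rfl

theorem exists_suppInToCc {Y : Type*} [TopologicalSpace Y] [T2Space Y] (f : C_c(Y, ℂ)) :
    ∃ (K : TopologicalSpace.Compacts Y) (g : suppIn (K : Set Y)), suppInToCc K g = f := by
  obtain ⟨C, hC⟩ := f.continuous.bounded_above_of_compact_support f.hasCompactSupport
  exact ⟨⟨tsupport f, f.hasCompactSupport⟩,
    ⟨BoundedContinuousFunction.ofNormedAddCommGroup f f.continuous C hC,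
      fun y hy => image_eq_zero_of_notMem_tsupport hy⟩, rfl⟩

theorem continuous_apply_slice {k : ℕ} (L : C_c(Fin k → X, ℂ) →L[ℂ] ℂ)
    (f : C_c(Fin (k + 1) → X, ℂ)) : Continuous fun x => L (slice f x) := by
  obtain ⟨K, g, rfl⟩ := exists_suppInToCc f
  exact L.continuous.comp ((continuous_suppInToCc _).comp (continuous_sliceIn K g))

/-- Integration of `f` with respect to the last `k` variables: the linear map sending
`f ∈ C_c(X ^ (k+1); ℂ)` to the function `x ↦ ⟨L, f (x, ·)⟩`. -/
def partialPairingAux {k : ℕ} (L : C_c(Fin k → X, ℂ) →L[ℂ] ℂ) :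
    C_c(Fin (k + 1) → X, ℂ) →ₗ[ℂ] C_c(X, ℂ) where
  toFun f :=
    { toFun := fun x => L (slice f x)
      continuous_toFun := continuous_apply_slice L f
      hasCompactSupport' := by
        refine HasCompactSupport.intro (f.hasCompactSupport.isCompact.image
          (f := fun z : Fin (k + 1) → X => z 0) (by fun_prop)) fun x hx => ?_
        have : slice f x = 0 := by
          ext y
          by_contra h
          exact hx ⟨Fin.cons x y, subset_tsupport _ h, Fin.cons_zero _ _⟩
        simp [this] }
  map_add' f g := by
    ext x
    exact L.map_add (slice f x) (slice g x)
  map_smul' c f := by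
    ext x
    exact L.map_smul c (slice f x)

/-- `partialPairingAux` as a continuous linear map. -/
def partialPairing {k : ℕ} (L : C_c(Fin k → X, ℂ) →L[ℂ] ℂ) :
    C_c(Fin (k + 1) → X, ℂ) →L[ℂ] C_c(X, ℂ) where
  toLinearMap := partialPairingAux L
  cont := by
    refine continuous_of_suppIn _ fun K => ?_
    let L' : suppIn (tailCompacts K : Set (Fin k → X)) →L[ℂ] ℂ :=
      ⟨L.toLinearMap ∘ₗ suppInToCc _, L.continuous.comp (continuous_suppInToCc _)⟩
    have hb : ∀ (f : suppIn (K : Set (Fin (k + 1) → X))) (x : X),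
        ‖L' (sliceIn K f x)‖ ≤ ‖L'‖ * ‖f‖ := fun f x =>
      (L'.le_opNorm _).trans (mul_le_mul_of_nonneg_left
        ((BoundedContinuousFunction.norm_le (norm_nonneg _)).2 fun y =>
          f.1.norm_coe_le_norm (Fin.cons x y)) (norm_nonneg _))
    let R : suppIn (K : Set (Fin (k + 1) → X)) →ₗ[ℂ] suppIn (headCompacts K : Set X) :=
      { toFun := fun f => ⟨BoundedContinuousFunction.ofNormedAddCommGroup
          (fun x => L' (sliceIn K f x)) (L'.continuous.comp (continuous_sliceIn K f)) _ (hb f),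
          fun x hx => by
            have : sliceIn K f x = 0 := by
              ext y
              by_contra h
              refine hx ⟨Fin.cons x y, ?_, Fin.cons_zero _ _⟩
              by_contra h'
              exact h (f.2 _ h')
            exact (congrArg L' this).trans L'.map_zero⟩
        map_add' := fun f g => by
          ext x
          exact L'.map_add (sliceIn K f x) (sliceIn K g x)
        map_smul' := fun c f => by
          ext x
          exact L'.map_smul c (sliceIn K f x) }
    have hR : Continuous R := (R.mkContinuous ‖L'‖ fun f =>
      (BoundedContinuousFunction.norm_le (by positivity)).2 fun x => hb f x).continuous
    exact (continuous_suppInToCc _).comp hR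

/-- For `ω` in the dual of `C_c(X; ℂ)`, i.e. a complex Radon measure on `X`, this is
`ω ^ ⊗k`, a continuous linear functional on `C_c(X ^ k; ℂ)`:
`⟨ω ^ ⊗k, f⟩ = ∫ ω(dx₁) ∫ ω(dx₂) ⋯ ∫ ω(dx_k) f (x₁, …, x_k)`. -/
def tensorPow (ω : C_c(X, ℂ) →L[ℂ] ℂ) : ∀ k : ℕ, C_c(Fin k → X, ℂ) →L[ℂ] ℂ
  | 0 => dirac Fin.elim0
  | k + 1 => ω.comp (partialPairing (tensorPow ω k))

end Tensor

/-! ### Complex Radon measures -/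

section Radon

variable {Y : Type*} [TopologicalSpace Y]

/-- A complex Radon measure `(μ₁ - μ₂) + i (μ₃ - μ₄)` on `Y`, presented by four positive Radon
measures on the Borel `σ`-algebra of `Y`. Different presentations of the same complex measure are
not identified; only the values on relatively compact Borel sets and the integrals are used. -/
structure ComplexRadonMeasure (Y : Type*) [TopologicalSpace Y] where
  /-- positive part of the real part -/
  rePos : @MeasureTheory.Measure Y (borel Y)
  /-- negative part of the real part -/
  reNeg : @MeasureTheory.Measure Y (borel Y)
  /-- positive part of the imaginary part -/
  imPos : @MeasureTheory.Measure Y (borel Y)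
  /-- negative part of the imaginary part -/
  imNeg : @MeasureTheory.Measure Y (borel Y)
  regular_rePos : @MeasureTheory.Measure.Regular Y (borel Y) _ rePos
  regular_reNeg : @MeasureTheory.Measure.Regular Y (borel Y) _ reNeg
  regular_imPos : @MeasureTheory.Measure.Regular Y (borel Y) _ imPos
  regular_imNeg : @MeasureTheory.Measure.Regular Y (borel Y) _ imNeg

namespace ComplexRadonMeasure

/-- The value of a complex Radon measure on a relatively compact Borel set. -/
def value (m : ComplexRadonMeasure Y) (A : Set Y) : ℂ :=
  (((m.rePos A).toReal - (m.reNeg A).toReal : ℝ) : ℂ) +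
    Complex.I * (((m.imPos A).toReal - (m.imNeg A).toReal : ℝ) : ℂ)

/-- The integral of a function with respect to a complex Radon measure. -/
def integral (m : ComplexRadonMeasure Y) (f : Y → ℂ) : ℂ :=
  letI : MeasurableSpace Y := borel Y
  ((∫ y, f y ∂m.rePos) - ∫ y, f y ∂m.reNeg) +
    Complex.I * ((∫ y, f y ∂m.imPos) - ∫ y, f y ∂m.imNeg)

/-- A complex Radon measure on `X ^ k` is symmetric if it is invariant under the action of the
symmetric group by permutation of the coordinates. -/
def IsSymm {X : Type*} [TopologicalSpace X] {k : ℕ} (m : ComplexRadonMeasure (Fin k → X)) : Prop :=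
  ∀ (σ : Equiv.Perm (Fin k)) (A : Set (Fin k → X)), @MeasurableSet _ (borel (Fin k → X)) A →
    IsCompact (closure A) → m.value ((fun x => x ∘ σ) ⁻¹' A) = m.value A

end ComplexRadonMeasure

variable [T2Space Y]

open MeasureTheory in
/-- The continuous linear functional `f ↦ ∫ f dμ` on `C_c(Y; ℂ)`, for a positive measure `μ`. -/
def integralCLM [MeasurableSpace Y] [BorelSpace Y] (μ : Measure Y)
    [IsFiniteMeasureOnCompacts μ] : C_c(Y, ℂ) →L[ℂ] ℂ :=
  have hint : ∀ f : C_c(Y, ℂ), Integrable f μ := fun f =>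
    f.continuous.integrable_of_hasCompactSupport f.hasCompactSupport
  let L : C_c(Y, ℂ) →ₗ[ℂ] ℂ :=
    { toFun := fun f => ∫ y, f y ∂μ
      map_add' := fun f g => integral_add (hint f) (hint g)
      map_smul' := fun c f => integral_smul c f }
  { L with
    cont := by
      refine continuous_of_suppIn L fun K => ?_
      refine ((L ∘ₗ suppInToCc K).mkContinuous (μ.real K) fun f => ?_).continuous
      have h : ∫ y, f.1 y ∂μ = ∫ y in (K : Set Y), f.1 y ∂μ :=
        (setIntegral_eq_integral_of_forall_compl_eq_zero fun y hy => f.2 y hy).symm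
      have h2 : ‖∫ y in (K : Set Y), f.1 y ∂μ‖ ≤ ‖f‖ * μ.real K :=
        norm_setIntegral_le_of_norm_le_const K.isCompact.measure_lt_top
          fun y _ => f.1.norm_coe_le_norm y
      rw [mul_comm]
      exact (congrArg norm h).trans_le h2 }

namespace ComplexRadonMeasure

/-- The element `f ↦ ∫ f dm` of the dual space of `C_c(Y; ℂ)` defined by a complex Radon measure:
the identification of complex Radon measures with continuous linear functionals. -/
def toDual (m : ComplexRadonMeasure Y) : C_c(Y, ℂ) →L[ℂ] ℂ :=
  letI : MeasurableSpace Y := borel Y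
  haveI : BorelSpace Y := ⟨rfl⟩
  haveI := m.regular_rePos
  haveI := m.regular_reNeg
  haveI := m.regular_imPos
  haveI := m.regular_imNeg
  (integralCLM m.rePos - integralCLM m.reNeg) +
    Complex.I • (integralCLM m.imPos - integralCLM m.imNeg)

theorem toDual_apply (m : ComplexRadonMeasure Y) (f : C_c(Y, ℂ)) : m.toDual f = m.integral f := rfl

end ComplexRadonMeasure

end Radon

/-! ### Polynomials on the dual space -/

section Poly

variable (X : Type*) [TopologicalSpace X] [T2Space X]

/-- The symmetric functions in `C_c(X ^ k; ℂ)`, the `k`-th symmetric tensor power of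
`C_c(X; ℂ)`, with the subspace topology. -/
def SymCc (k : ℕ) : Submodule ℂ C_c(Fin k → X, ℂ) where
  carrier := {f | ∀ (σ : Equiv.Perm (Fin k)) (x : Fin k → X), f (x ∘ σ) = f x}
  add_mem' hf hg σ x := by simp [hf σ x, hg σ x]
  zero_mem' _ _ := rfl
  smul_mem' c f hf σ x := by simp [hf σ x]

/-- The dual space of `C_c(X; ℂ)`. -/
abbrev Dual : Type _ := C_c(X, ℂ) →L[ℂ] ℂ

variable {X}

/-- The tensor power `ξ ^ ⊗k`, i.e. the function `(x₁, …, x_k) ↦ ξ(x₁) ⋯ ξ(x_k)`. -/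
def powTensor (ξ : C_c(X, ℂ)) (k : ℕ) : SymCc X k :=
  ⟨{ toFun := fun x => ∏ i, ξ (x i)
     continuous_toFun := continuous_finsetProd _ fun i _ => ξ.continuous.comp (continuous_apply i)
     hasCompactSupport' := by
      refine HasCompactSupport.intro
        (isCompact_univ_pi fun _ : Fin k => ξ.hasCompactSupport.isCompact) fun x hx => ?_
      simp only [Set.mem_pi, Set.mem_univ, forall_true_left, not_forall] at hx
      obtain ⟨i, hi⟩ := hx
      exact Finset.prod_eq_zero (Finset.mem_univ i) (image_eq_zero_of_notMem_tsupport hi) },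
    fun σ x => Equiv.prod_comp σ fun i => ξ (x i)⟩

/-- The monomial `ω ↦ ⟨ω ^ ⊗k, f⟩` as a function on the dual space. -/
def monoFun (k : ℕ) : SymCc X k →ₗ[ℂ] (Dual X → ℂ) where
  toFun f ω := tensorPow ω k f
  map_add' f g := by
    ext ω
    exact (tensorPow ω k).map_add (f : C_c(Fin k → X, ℂ)) g
  map_smul' c f := by
    ext ω
    exact (tensorPow ω k).map_smul c (f : C_c(Fin k → X, ℂ))

variable (X)

/-- The polynomials on the dual space: finite sums of monomials, as functions. -/
def polySubmodule : Submodule ℂ (Dual X → ℂ) := ⨆ k : ℕ, LinearMap.range (monoFun (X := X) k)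

/-- The space of polynomials on the dual space of `C_c(X; ℂ)`. This is a type synonym, since it
does not carry the topology of pointwise convergence. -/
def Poly : Type _ := polySubmodule X

instance : AddCommGroup (Poly X) := inferInstanceAs (AddCommGroup (polySubmodule X))
instance : Module ℂ (Poly X) := inferInstanceAs (Module ℂ (polySubmodule X))
instance : Module ℝ (Poly X) := inferInstanceAs (Module ℝ (polySubmodule X))
instance : IsScalarTower ℝ ℂ (Poly X) := inferInstanceAs (IsScalarTower ℝ ℂ (polySubmodule X))

instance : CoeFun (Poly X) (fun _ => Dual X → ℂ) := ⟨fun p => p.1⟩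

variable {X}

/-- The monomial `ω ↦ ⟨ω ^ ⊗k, f⟩` as a polynomial. -/
def mono (k : ℕ) : SymCc X k →ₗ[ℂ] Poly X :=
  (monoFun k).codRestrict (polySubmodule X) fun f =>
    Submodule.mem_iSup_of_mem (p := fun k : ℕ => LinearMap.range (monoFun (X := X) k)) k ⟨f, rfl⟩

theorem mono_apply (k : ℕ) (f : SymCc X k) (ω : Dual X) : mono k f ω = tensorPow ω k f := rfl

/-- The topology of the locally convex direct sum of the spaces of symmetric functions in
`C_c(X ^ k; ℂ)`, transported to polynomials. -/
instance : TopologicalSpace (Poly X) := lcFinal fun k : ℕ => mono (X := X) k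

instance : IsTopologicalAddGroup (Poly X) := lcFinal_isTopologicalAddGroup _
instance : ContinuousSMul ℂ (Poly X) := lcFinal_continuousSMul fun k : ℕ => mono (X := X) k
instance : LocallyConvexSpace ℝ (Poly X) := lcFinal_locallyConvexSpace _

end Poly

/-! ### Sheffer operators and their Lie algebra -/

section Sheffer

variable {X : Type*} [TopologicalSpace X] [T2Space X]

/-- `P` is given by an upper unitriangular block matrix of continuous linear operators:
`P ⟨·^⊗k, f⟩ = ⟨·^⊗k, f⟩ + ∑_{i<k} ⟨·^⊗i, P_{ik} f⟩`, i.e. `P` defines a monic polynomial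
sequence. -/
def IsMonic (P : Poly X →L[ℂ] Poly X) : Prop :=
  ∃ M : ∀ i k : ℕ, SymCc X k →L[ℂ] SymCc X i, ∀ (k : ℕ) (f : SymCc X k),
    P (mono k f) = mono k f + ∑ i ∈ Finset.range k, mono i (M i k f)

/-- The exponential generating function `∑ (1/k!) (P ⟨·^⊗k, ξ^⊗k⟩)(ω)` of `P`. A formal tensor
power series `∑ C_k ξ^⊗k` is recorded, for every `ξ`, as the formal power series in one variable
`s` obtained by replacing `ξ` by `s ξ`; products of formal tensor power series and
composition with scalar power series become those of formal power series in `s`, and the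
values `C_k ξ^⊗k` for all `ξ` determine `C_k`. -/
def genFun (P : Poly X →L[ℂ] Poly X) (ω : Dual X) (ξ : C_c(X, ℂ)) : PowerSeries ℂ :=
  PowerSeries.mk fun k => (k.factorial : ℂ)⁻¹ * P (mono k (powTensor ξ k)) ω

/-- `P` is a Sheffer operator: it is monic and its generating function has the form
`exp(⟨ω, B(ξ)⟩) A(ξ)` with formal tensor power series `A(ξ) = 1 + ∑_{k≥1} A_k ξ^⊗k` and
`B(ξ) = ξ + ∑_{k≥2} B_k ξ^⊗k` with values in `ℂ` and in `C_c(X; ℂ)`. -/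
def IsSheffer (P : Poly X →L[ℂ] Poly X) : Prop :=
  IsMonic P ∧ ∃ (A : ∀ k : ℕ, SymCc X k →L[ℂ] ℂ) (B : ∀ k : ℕ, SymCc X k →L[ℂ] C_c(X, ℂ)),
    (∀ ξ, A 0 (powTensor ξ 0) = 1) ∧ (∀ ξ, B 0 (powTensor ξ 0) = 0) ∧
    (∀ ξ, B 1 (powTensor ξ 1) = ξ) ∧
    ∀ (ω : Dual X) (ξ : C_c(X, ℂ)),
      genFun P ω ξ =
        (PowerSeries.exp ℂ).subst (PowerSeries.mk fun k => ω (B k (powTensor ξ k))) *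
          PowerSeries.mk fun k => A k (powTensor ξ k)

/-- `Q = log P = ∑_{n≥1} ((-1)^(n+1)/n) (P - 1)^n`. When `P` is monic, `P - 1` lowers degrees, so
on each polynomial only finitely many terms of the series are non-zero. -/
def IsLog (P Q : Poly X →L[ℂ] Poly X) : Prop :=
  ∀ p : Poly X, ∀ᶠ N : ℕ in Filter.atTop,
    Q p = ∑ n ∈ Finset.Icc 1 N, ((-1 : ℂ) ^ (n + 1) / (n : ℂ)) • ((P - 1) ^ n) p

variable (X) in
/-- The Sheffer Lie algebra: the set of the logarithms of all Sheffer operators. -/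
def shefferLieAlgebra : Set (Poly X →L[ℂ] Poly X) :=
  {Q | ∃ P : Poly X →L[ℂ] Poly X, IsSheffer P ∧ IsLog P Q}

/-- `D_{x₁} ⋯ D_{x_k} p`, where `D_x` is the Gâteaux derivative in the direction of the Dirac
measure at `x`. -/
def diracDeriv {k : ℕ} (x : Fin k → X) (p : Dual X → ℂ) : Dual X → ℂ :=
  (List.ofFn x).foldr (fun y q ω => lineDeriv ℂ q ω (dirac y)) p

/-- A family `β(x, ·)`, `x ∈ X`, of symmetric complex Radon measures on `X ^ k` is the kernel of a
continuous linear operator from the symmetric functions in `C_c(X ^ k; ℂ)` to `C_c(X; ℂ)`, given by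
`f ↦ (x ↦ ∫ f(x₁, …, x_k) β(x, dx₁ ⋯ dx_k))`. -/
def IsKernel {k : ℕ} (β : X → ComplexRadonMeasure (Fin k → X)) : Prop :=
  (∀ x, (β x).IsSymm) ∧
    ∃ T : SymCc X k →L[ℂ] C_c(X, ℂ), ∀ (f : SymCc X k) (x : X),
      T f x = (β x).integral (f : C_c(Fin k → X, ℂ))

end Sheffer

end ShefferLie

end

/-! The proof characterises both sides through the translations `E ν`, with `E ν = exp (D ν)`. An
operator commuting with all translations multiplies the formal exponential `exp ⟨·, ξ⟩` by a scalar
power series (`ShiftInvariant.apply_expTerm`), so such operators commute with each other. Identities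
between continuous operators need only be tested on the powers `⟨·, ξ⟩ ^ n`, because tensor powers
span a dense subspace of the symmetric functions (`symCc_ext`: Stone–Weierstrass and polarization).
All operator series are finite on each polynomial, since `Q` and `P - 1` lower the degree.

The intermediate form is `IsRep`: `(Q p)(ω) = l (E ω p) + ω (b (E ω p))`, where `l` kills constants
and `b` kills polynomials of degree at most one. `mem_shefferLieAlgebra_iff` shows that the
logarithms of Sheffer operators are exactly these operators.

Let `P` be Sheffer and `Q = log P`. Translating by `ν` multiplies the generating function by `exp
⟨ν, B(ξ)⟩`, so conjugation by `P`, and by each `P ^ n`, preserves shift invariance. Applied to a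
fixed polynomial, `P ^ n T P ^ (-n)` is polynomial in `n` with linear coefficient `[Q, T]`; hence
`[Q, T]` is shift invariant whenever `T` is (`IsSheffer.commutator_log`). In particular `R = [D ω,
Q]` commutes with `D ω`, so `E ω Q = Q E ω + E ω R`. Evaluation at `0` gives the required form, `R`
being linear in `ω` (`exists_isRep`).

Conversely, if `Q` has this form, commutators with `Q` preserve shift invariance, hence so does `T ↦
exp(-Q) T exp(Q)` (`IsRep.conj_exp`). For `T = D ν` the resulting scalar series is `⟨ν, B(ξ)⟩`;
therefore `D ν` multiplies `exp(Q) exp ⟨·, ξ⟩` by it, and exponentiating `D ν` yields the Sheffer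
generating function (`IsRep.isSheffer_exp`).

Finally, `k`-fold Dirac derivatives of `p` at `ω` are `k!` times the degree `k` coefficient of `E ω
p` (`diracDeriv_eq_coeff`), and functionals on symmetric functions are symmetric complex Radon
measures by the Riesz theorem. Thus `l` and `b`, degree by degree, are the families `α` and `β`. -/

open scoped BoundedContinuousFunction CompactlySupported

noncomputable section

namespace ShefferLie

/-! ### Continuous maps between spaces of compactly supported functions -/

section CcMaps

variable {Y Z : Type*} [TopologicalSpace Y] [T2Space Y] [TopologicalSpace Z] [T2Space Z]

/-- A linear map between spaces of compactly supported functions is continuous if it is bounded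
from the functions supported in a compact set to those supported in some other compact set. -/
theorem continuous_of_bound (L : C_c(Y, ℂ) →ₗ[ℂ] C_c(Z, ℂ))
    (hL : ∀ K : TopologicalSpace.Compacts Y, ∃ (K' : TopologicalSpace.Compacts Z) (C : ℝ),
      ∀ f : suppIn (K : Set Y), (∀ z, z ∉ K' → L (suppInToCc K f) z = 0) ∧
        ∀ z, ‖L (suppInToCc K f) z‖ ≤ C * ‖f‖) : Continuous L := by
  refine continuous_of_suppIn L fun K => ?_
  obtain ⟨K', C, h⟩ := hL K
  let R : suppIn (K : Set Y) →ₗ[ℂ] suppIn (K' : Set Z) :=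
    { toFun := fun f => ⟨BoundedContinuousFunction.ofNormedAddCommGroup
        (L (suppInToCc K f)) (L (suppInToCc K f)).continuous _ (h f).2, (h f).1⟩
      map_add' := fun f g => by
        ext z
        change L (suppInToCc K (f + g)) z = L (suppInToCc K f) z + L (suppInToCc K g) z
        rw [map_add, map_add]; rfl
      map_smul' := fun c f => by
        ext z
        change L (suppInToCc K (c • f)) z = c • L (suppInToCc K f) z
        rw [map_smul, map_smul]; rfl }
  have hR : Continuous R := (R.mkContinuous (max C 0) fun f =>
    (BoundedContinuousFunction.norm_le (by positivity)).2 fun z => ((h f).2 z).trans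
      (mul_le_mul_of_nonneg_right (le_max_left _ _) (norm_nonneg f))).continuous
  exact (continuous_suppInToCc _).comp hR

/-- Composition with a homeomorphism. -/
def compHomeo (e : Z ≃ₜ Y) : C_c(Y, ℂ) →L[ℂ] C_c(Z, ℂ) :=
  let L : C_c(Y, ℂ) →ₗ[ℂ] C_c(Z, ℂ) :=
    { toFun := fun f => ⟨f.toContinuousMap.comp ⟨e, e.continuous⟩,
        f.hasCompactSupport.comp_homeomorph e⟩
      map_add' := fun _ _ => rfl
      map_smul' := fun _ _ => rfl }
  { L with
    cont := continuous_of_bound L fun K => ⟨K.map e.symm e.symm.continuous, 1, fun f =>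
      ⟨fun z hz => f.2 _ fun h => hz ⟨e z, h, e.symm_apply_apply z⟩, fun z => by
        rw [one_mul]; exact f.1.norm_coe_le_norm (e z)⟩⟩ }

@[simp] theorem compHomeo_apply (e : Z ≃ₜ Y) (f : C_c(Y, ℂ)) (z : Z) :
    compHomeo e f z = f (e z) := rfl

end CcMaps

/-! ### Symmetrization and polarization -/

section Sym

variable {X : Type*} [TopologicalSpace X] [T2Space X]

/-- Permutation of the coordinates of `X ^ k`. -/
def permHomeo {k : ℕ} (σ : Equiv.Perm (Fin k)) : (Fin k → X) ≃ₜ (Fin k → X) where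
  toFun x := x ∘ σ
  invFun x := x ∘ σ.symm
  left_inv x := by ext; simp
  right_inv x := by ext; simp
  continuous_toFun := by unfold Function.comp; fun_prop
  continuous_invFun := by unfold Function.comp; fun_prop

omit [T2Space X] in
@[simp] theorem permHomeo_apply {k : ℕ} (σ : Equiv.Perm (Fin k)) (x : Fin k → X) :
    permHomeo σ x = x ∘ σ := rfl

/-- The average over all permutations of the coordinates. -/
def avgCLM (k : ℕ) : C_c(Fin k → X, ℂ) →L[ℂ] C_c(Fin k → X, ℂ) :=
  (k.factorial : ℂ)⁻¹ • ∑ σ : Equiv.Perm (Fin k), compHomeo (permHomeo σ)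

theorem avgCLM_apply {k : ℕ} (f : C_c(Fin k → X, ℂ)) (x : Fin k → X) :
    avgCLM k f x = (k.factorial : ℂ)⁻¹ * ∑ σ : Equiv.Perm (Fin k), f (x ∘ σ) := by
  simp [avgCLM]

/-- The symmetrization as a projection onto the symmetric functions. -/
def symCLM (k : ℕ) : C_c(Fin k → X, ℂ) →L[ℂ] SymCc X k :=
  (avgCLM k).codRestrict (SymCc X k) fun f σ x => by
    rw [avgCLM_apply, avgCLM_apply]
    congr 1
    exact Fintype.sum_equiv (Equiv.mulLeft σ) _ _ fun τ => rfl

theorem coe_symCLM {k : ℕ} (f : C_c(Fin k → X, ℂ)) : (symCLM k f : C_c(Fin k → X, ℂ)) =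
    avgCLM k f := rfl

@[simp] theorem symCLM_coe {k : ℕ} (f : SymCc X k) : symCLM k (f : C_c(Fin k → X, ℂ)) = f := by
  ext x
  rw [coe_symCLM, avgCLM_apply, Finset.sum_congr rfl fun σ _ => f.2 σ x]
  simp [Fintype.card_perm, Nat.factorial_ne_zero]

@[simp] theorem powTensor_apply (ξ : C_c(X, ℂ)) (k : ℕ) (x : Fin k → X) :
    (powTensor ξ k : C_c(Fin k → X, ℂ)) x = ∏ i, ξ (x i) := rfl

/-- The tensor product of compactly supported functions. -/
def prodTensor {k : ℕ} (ξ : Fin k → C_c(X, ℂ)) : C_c(Fin k → X, ℂ) where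
  toFun x := ∏ i, ξ i (x i)
  continuous_toFun := continuous_finsetProd _ fun i _ => (ξ i).continuous.comp (continuous_apply i)
  hasCompactSupport' := by
    refine HasCompactSupport.intro
      (isCompact_univ_pi fun i : Fin k => (ξ i).hasCompactSupport.isCompact) fun x hx => ?_
    simp only [Set.mem_pi, Set.mem_univ, forall_true_left, not_forall] at hx
    obtain ⟨i, hi⟩ := hx
    exact Finset.prod_eq_zero (Finset.mem_univ i) (image_eq_zero_of_notMem_tsupport hi)

@[simp] theorem prodTensor_apply {k : ℕ} (ξ : Fin k → C_c(X, ℂ)) (x : Fin k → X) :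
    prodTensor ξ x = ∏ i, ξ i (x i) := rfl

/-- Ryser's formula for the permanent. -/
theorem sum_perm_eq_ryser {R : Type*} [CommRing R] {n : ℕ} (a : Fin n → Fin n → R) :
    ∑ σ : Equiv.Perm (Fin n), ∏ j, a j (σ j) =
      ∑ T : Finset (Fin n), (-1) ^ T.card * ∏ j, ∑ i ∈ Tᶜ, a i j := by
  classical
  have h1 : ∀ T : Finset (Fin n), ∏ j, ∑ i ∈ Tᶜ, a i j =
      ∑ φ : Fin n → Fin n, if T ⊆ (Finset.univ.image φ)ᶜ then ∏ j, a (φ j) j else 0 := by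
    intro T
    rw [Finset.prod_univ_sum, ← Finset.sum_filter]
    refine Finset.sum_congr ?_ fun _ _ => rfl
    ext φ
    simp only [Fintype.mem_piFinset, Finset.mem_compl, Finset.mem_filter, Finset.mem_univ,
      true_and, Finset.subset_iff, Finset.mem_image, not_exists]
    exact ⟨fun h x hx j hj => h j (hj ▸ hx), fun h j hj => h hj j rfl⟩
  simp_rw [h1, Finset.mul_sum]
  rw [Finset.sum_comm]
  -- Inclusion–exclusion: the signs over all `T` avoiding the image of `φ` cancel unless only `T =
  -- ∅` is possible, that is, unless `φ` is onto.
  have h2 : ∀ φ : Fin n → Fin n, (∑ T : Finset (Fin n), (-1 : R) ^ T.card *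
      if T ⊆ (Finset.univ.image φ)ᶜ then ∏ j, a (φ j) j else 0) =
      if Function.Bijective φ then ∏ j, a (φ j) j else 0 := by
    intro φ
    simp_rw [mul_ite, mul_zero]
    rw [← Finset.sum_filter, ← Finset.sum_mul]
    have h3 : (Finset.univ.filter fun T : Finset (Fin n) => T ⊆ (Finset.univ.image φ)ᶜ) =
        (Finset.univ.image φ)ᶜ.powerset := by ext; simp
    have h4 := congrArg (Int.cast (R := R))
      (Finset.sum_powerset_neg_one_pow_card (x := (Finset.univ.image φ)ᶜ))
    push_cast at h4
    rw [h3, h4]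
    have h5 : (Finset.univ.image φ)ᶜ = ∅ ↔ Function.Bijective φ := by
      rw [Finset.compl_eq_empty_iff, ← Finite.surjective_iff_bijective, Finset.eq_univ_iff_forall]
      simp [Function.Surjective]
    simp only [h5, ite_mul, one_mul, zero_mul]
  simp_rw [h2]
  rw [← Finset.sum_filter]
  -- The index being permuted is the second one on the left and the first one on the right, so
  -- permutations are matched with their inverses.
  refine Finset.sum_bij' (fun σ _ => (σ.symm : Fin n → Fin n))
    (fun φ h => (Equiv.ofBijective φ (Finset.mem_filter.1 h).2).symm) ?_ ?_ ?_ ?_ ?_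
  · intro σ _
    exact Finset.mem_filter.2 ⟨Finset.mem_univ _, σ.symm.bijective⟩
  · simp
  · intro σ _
    ext x
    exact congrArg Fin.val ((Equiv.symm_apply_eq _).2 (by simp))
  · intro φ h
    rfl
  · intro σ _
    rw [← Equiv.prod_comp σ fun j => a (σ.symm j) j]
    simp

/-- Polarization. At each point the symmetrized product is a permanent, and Ryser's formula
expresses a permanent through products of sums, which here are values of tensor powers. -/
theorem symCLM_prodTensor {k : ℕ} (ξ : Fin k → C_c(X, ℂ)) :
    symCLM k (prodTensor ξ) = (k.factorial : ℂ)⁻¹ • ∑ T : Finset (Fin k),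
      (-1 : ℂ) ^ T.card • powTensor (∑ i ∈ Tᶜ, ξ i) k := by
  ext x
  rw [coe_symCLM, avgCLM_apply]
  have h := sum_perm_eq_ryser fun i j => ξ i (x j)
  simp only [prodTensor_apply, Function.comp_apply, Submodule.coe_smul, Submodule.coe_sum,
    CompactlySupportedContinuousMap.coe_smul, Pi.smul_apply, smul_eq_mul, powTensor_apply,
    CompactlySupportedContinuousMap.sum_apply] at h ⊢
  rw [h]

end Sym

/-! ### Density of product tensors and of tensor powers -/

section Density

variable {X : Type*} [TopologicalSpace X] [T2Space X] [LocallyCompactSpace X]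

/-- The span of the tensor products is dense in `C_c(X ^ k; ℂ)`. -/
theorem eq_zero_of_prodTensor {k : ℕ} (F : C_c(Fin k → X, ℂ) →L[ℂ] ℂ)
    (hF : ∀ ξ : Fin k → C_c(X, ℂ), F (prodTensor ξ) = 0) : F = 0 := by
  ext f
  obtain ⟨K, f, rfl⟩ := exists_suppInToCc f
  have hK1 : IsCompact (⋃ i : Fin k, (fun z : Fin k → X => z i) '' (K : Set (Fin k → X))) :=
    isCompact_iUnion fun i => K.isCompact.image (continuous_apply i)
  -- A cutoff equal to 1 on all coordinate projections of `K`. Its tensor power `X3` leaves `f`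
  -- unchanged and vanishes outside the compact box `K3`, so multiplying by it turns approximations
  -- on `K3` into compactly supported functions.
  obtain ⟨χ, hχ1, -, hχc, hχ01⟩ := exists_continuous_one_zero_of_isCompact hK1
    isClosed_empty (Set.disjoint_empty _)
  have hK2c : IsCompact (tsupport χ) := hχc
  let K3 : TopologicalSpace.Compacts (Fin k → X) :=
    ⟨Set.univ.pi fun _ => tsupport χ, isCompact_univ_pi fun _ => hK2c⟩
  let X3 : (Fin k → X) → ℂ := fun z => ∏ i, (χ (z i) : ℂ)
  have hX3 : ∀ z, ‖X3 z‖ ≤ 1 := by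
    intro z
    rw [norm_prod]
    refine Finset.prod_le_one (fun _ _ => norm_nonneg _) fun i _ => ?_
    rw [Complex.norm_real, Real.norm_of_nonneg (hχ01 _).1]
    exact (hχ01 _).2
  have hX3f : ∀ z, X3 z * f.1 z = f.1 z := by
    intro z
    by_cases hz : z ∈ K
    · have : X3 z = 1 := Finset.prod_eq_one fun i _ => by
        have := hχ1 (Set.mem_iUnion.2 ⟨i, z, hz, rfl⟩)
        simp only [Pi.one_apply] at this
        rw [this]; simp
      rw [this, one_mul]
    · rw [f.2 z hz, mul_zero]
  have hX30 : ∀ z, z ∉ K3 → X3 z = 0 := by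
    intro z hz
    have : ∃ i, z i ∉ tsupport χ := by
      by_contra h
      push Not at h
      exact hz fun i _ => h i
    obtain ⟨i, hi⟩ := this
    refine Finset.prod_eq_zero (Finset.mem_univ i) ?_
    rw [image_eq_zero_of_notMem_tsupport hi]; simp
  -- Products of one-variable functions are closed under multiplication, so the algebra they
  -- generate, to which Stone–Weierstrass applies, is just their linear span.
  let S : Submonoid C(K3, ℂ) :=
    { carrier := {u | ∃ g : Fin k → C(X, ℂ), ∀ z : K3, u z = ∏ i, g i (z.1 i)}
      one_mem' := ⟨fun _ => 1, by simp⟩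
      mul_mem' := by
        rintro u v ⟨g, hg⟩ ⟨h, hh⟩
        exact ⟨fun i => g i * h i, fun z => by simp [hg, hh, Finset.prod_mul_distrib]⟩ }
  let A : StarSubalgebra ℂ C(K3, ℂ) :=
    { Algebra.adjoin ℂ (S : Set C(K3, ℂ)) with
      star_mem' := by
        intro u hu
        simp only [Subsemiring.coe_carrier_toSubmonoid, Subalgebra.coe_toSubsemiring,
          SetLike.mem_coe] at hu ⊢
        induction hu using Algebra.adjoin_induction with
        | mem u hu =>
          obtain ⟨g, hg⟩ := hu
          refine Algebra.subset_adjoin ⟨fun i => star (g i), fun z => ?_⟩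
          simp [hg]
        | algebraMap r =>
          rw [← algebraMap_star_comm]
          exact Subalgebra.algebraMap_mem _ _
        | add u v _ _ hu hv => rw [star_add]; exact Subalgebra.add_mem _ hu hv
        | mul u v _ _ hu hv => rw [star_mul]; exact Subalgebra.mul_mem _ hv hu }
  have hA : A.SeparatesPoints := by
    intro z w hzw
    have : ∃ i, z.1 i ≠ w.1 i := by
      by_contra h
      push Not at h
      exact hzw (Subtype.ext (funext h))
    obtain ⟨i, hi⟩ := this
    obtain ⟨g, hg0, hg1, -⟩ := exists_continuous_zero_one_of_isCompact
      (isCompact_singleton (x := z.1 i)) (isClosed_singleton (x := w.1 i))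
      (Set.disjoint_singleton.2 hi)
    let G : C(X, ℂ) := ⟨fun x => (g x : ℂ), by fun_prop⟩
    let u : C(K3, ℂ) := ⟨fun z => G (z.1 i),
      G.continuous.comp ((continuous_apply i).comp continuous_subtype_val)⟩
    have hu : u ∈ A := by
      refine Algebra.subset_adjoin ⟨fun j => if j = i then G else 1, fun z => ?_⟩
      rw [Finset.prod_eq_single i]
      · simp [u]
      · intro j _ hj; simp [hj]
      · simp
    refine ⟨u, ⟨u, hu, rfl⟩, ?_⟩
    have h0 : g (z.1 i) = 0 := hg0 rfl
    have h1 : g (w.1 i) = 1 := hg1 rfl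
    simp [u, G, h0, h1]
  have hdense := ContinuousMap.starSubalgebra_topologicalClosure_eq_top_of_separatesPoints A hA
  -- The cutoff is distributed over the factors: `X3` times an element of the span is a combination
  -- of product tensors, so `F` kills it.
  have hspan : ∀ u ∈ Submodule.span ℂ (S : Set C(K3, ℂ)), ∃ h : C_c(Fin k → X, ℂ), F h = 0 ∧ (∀ z : K3, h z = X3 z * u z) ∧
      ∀ z, z ∉ K3 → h z = 0 := by
    intro u hu
    induction hu using Submodule.span_induction with
    | mem u hu =>
      obtain ⟨g, hg⟩ := hu
      let ξ : Fin k → C_c(X, ℂ) := fun i =>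
        { toFun := fun x => (χ x : ℂ) * g i x
          continuous_toFun := by fun_prop
          hasCompactSupport' := HasCompactSupport.intro hK2c fun x hx => by
            rw [image_eq_zero_of_notMem_tsupport hx]; simp }
      have hξ : ∀ z, prodTensor ξ z = X3 z * ∏ i, g i (z i) := fun z => by
        simp only [prodTensor_apply, X3, ← Finset.prod_mul_distrib]; rfl
      exact ⟨prodTensor ξ, hF ξ, fun z => by rw [hξ, hg], fun z hz => by
        rw [hξ, hX30 z hz, zero_mul]⟩
    | zero => exact ⟨0, map_zero F, by simp, by simp⟩
    | add u v hu hv ihu ihv =>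
      obtain ⟨h, h1, h2, h3⟩ := ihu
      obtain ⟨h', h1', h2', h3'⟩ := ihv
      exact ⟨h + h', by rw [map_add, h1, h1', add_zero], fun z => by simp [h2, h2', mul_add],
        fun z hz => by simp [h3 z hz, h3' z hz]⟩
    | smul c u hu ihu =>
      obtain ⟨h, h1, h2, h3⟩ := ihu
      exact ⟨c • h, by rw [map_smul, h1, smul_zero], fun z => by simp [h2]; ring,
        fun z hz => by simp [h3 z hz]⟩
  let F3 : suppIn (K3 : Set (Fin k → X)) →L[ℂ] ℂ :=
    ⟨F.toLinearMap ∘ₗ suppInToCc K3, F.continuous.comp (continuous_suppInToCc K3)⟩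
  have hbound : ∀ ε > 0, ‖F (suppInToCc K f)‖ ≤ ‖F3‖ * ε := by
    intro ε hε
    let fr : C(K3, ℂ) := ⟨fun z => f.1 z.1, by fun_prop⟩
    have hfr : fr ∈ A.topologicalClosure := by rw [hdense]; trivial
    obtain ⟨u, hu, hfu⟩ := Metric.mem_closure_iff.1 hfr ε hε
    obtain ⟨h, h1, h2, h3⟩ := hspan u (by
      have hu' : u ∈ Subalgebra.toSubmodule (Algebra.adjoin ℂ (S : Set C(K3, ℂ))) := hu
      rwa [Algebra.adjoin_eq_span, Submonoid.closure_eq] at hu')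
    have hd : ∀ z, ‖suppInToCc K f z - h z‖ ≤ ε := by
      intro z
      by_cases hz : z ∈ K3
      · rw [h2 ⟨z, hz⟩, suppInToCc_apply, ← hX3f z, ← mul_sub, norm_mul]
        have : ‖fr ⟨z, hz⟩ - u ⟨z, hz⟩‖ ≤ ε :=
          ((fr - u).norm_coe_le_norm ⟨z, hz⟩).trans (by rw [← dist_eq_norm]; exact hfu.le)
        exact (mul_le_mul (hX3 z) this (norm_nonneg _) zero_le_one).trans (one_mul ε).le
      · rw [h3 z hz, suppInToCc_apply, ← hX3f z, hX30 z hz]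
        simpa using hε.le
    let d : suppIn (K3 : Set (Fin k → X)) := ⟨BoundedContinuousFunction.ofNormedAddCommGroup
      (suppInToCc K f - h) (suppInToCc K f - h).continuous ε hd, fun z hz => by
        change suppInToCc K f z - h z = 0
        rw [h3 z hz, suppInToCc_apply, ← hX3f z, hX30 z hz]; simp⟩
    have hFd : F (suppInToCc K f) = F3 d := by
      have : suppInToCc K3 d = suppInToCc K f - h := rfl
      change _ = F (suppInToCc K3 d)
      rw [this, map_sub, h1, sub_zero]
    rw [hFd]
    refine (F3.le_opNorm d).trans (mul_le_mul_of_nonneg_left ?_ (norm_nonneg _))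
    exact (BoundedContinuousFunction.norm_le hε.le).2 hd
  have h0 : ‖F (suppInToCc K f)‖ ≤ 0 := by
    refine le_of_forall_pos_le_add fun δ hδ => ?_
    refine (hbound (δ / (‖F3‖ + 1)) (by positivity)).trans ?_
    rw [zero_add, mul_div_assoc']
    refine (div_le_iff₀ (by positivity)).2 ?_
    nlinarith [norm_nonneg F3]
  simpa using h0

/-- The span of the tensor powers `ξ ^ ⊗k` is dense in the symmetric functions. -/
theorem symCc_ext {k : ℕ} {F G : SymCc X k →L[ℂ] ℂ}
    (h : ∀ ξ, F (powTensor ξ k) = G (powTensor ξ k)) : F = G := by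
  -- By polarization `F ∘ symCLM k` and `G ∘ symCLM k` agree on product tensors; the symmetrization
  -- is the identity on symmetric functions.
  have h0 : F.comp (symCLM k) - G.comp (symCLM k) = 0 := eq_zero_of_prodTensor _ fun ξ => by
    simp [symCLM_prodTensor, h, map_sum]
  ext f
  have := congrArg (fun T : C_c(Fin k → X, ℂ) →L[ℂ] ℂ => T f) h0
  simpa [sub_eq_zero] using this

end Density

/-! ### Contractions, tensor powers of functionals and their directional derivatives -/

section Contraction

variable {X : Type*} [TopologicalSpace X]

/-- The functions `x ↦ f (x, y)`, for a function `f` vanishing outside `K`, as elements of a Banach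
space. -/
def headSliceIn {k : ℕ} (K : TopologicalSpace.Compacts (Fin (k + 1) → X))
    (f : suppIn (K : Set (Fin (k + 1) → X))) (y : Fin k → X) :
    suppIn (headCompacts K : Set X) :=
  ⟨f.1.compContinuous ⟨fun x => Fin.cons x y, by fun_prop⟩, fun x hx => f.2 _ fun h =>
    hx ⟨Fin.cons x y, h, Fin.cons_zero _ _⟩⟩

theorem continuous_headSliceIn {k : ℕ} (K : TopologicalSpace.Compacts (Fin (k + 1) → X))
    (f : suppIn (K : Set (Fin (k + 1) → X))) : Continuous (headSliceIn K f) := by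
  rw [continuous_induced_rng, continuous_iff_continuousAt]
  intro y₀
  have hF : Continuous (Function.uncurry fun (y : Fin k → X) (x : X) =>
      f.1 (Fin.cons (α := fun _ => X) x y)) := f.1.continuous.comp (by fun_prop)
  have hc : Continuous (ContinuousMap.curry ⟨_, hF⟩) := ContinuousMap.continuous _
  have h := (ContinuousMap.tendsto_iff_forall_isCompact_tendstoUniformlyOn.1
    (hc.tendsto y₀)) _ (headCompacts K).isCompact
  rw [ContinuousAt, Metric.tendsto_nhds]
  intro ε hε
  filter_upwards [Metric.tendstoUniformlyOn_iff.1 h (ε / 2) (half_pos hε)] with y hy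
  refine lt_of_le_of_lt ((BoundedContinuousFunction.dist_le (half_pos hε).le).2 fun x => ?_)
    (half_lt_self hε)
  by_cases hx : x ∈ (headCompacts K : Set X)
  · have := hy x hx
    rw [dist_comm] at this
    exact this.le
  · have h1 := (headSliceIn K f y).2 x hx
    have h2 := (headSliceIn K f y₀).2 x hx
    simp only [Function.comp_apply, h1, h2, dist_self]
    exact (half_pos hε).le

variable [T2Space X]

/-- The function `x ↦ f (x, y)` on `X`, for `f ∈ C_c(X ^ (k+1); ℂ)` and `y ∈ X ^ k`. -/
def headSlice {k : ℕ} (f : C_c(Fin (k + 1) → X, ℂ)) (y : Fin k → X) : C_c(X, ℂ) where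
  toFun x := f (Fin.cons x y)
  continuous_toFun := f.continuous.comp (by fun_prop)
  hasCompactSupport' := by
    refine HasCompactSupport.intro
      (f.hasCompactSupport.isCompact.image (f := fun z : Fin (k + 1) → X => z 0)
        (by fun_prop)) fun y hy => ?_
    by_contra h
    exact hy ⟨Fin.cons _ _, subset_tsupport _ h, Fin.cons_zero _ _⟩

@[simp] theorem headSlice_apply {k : ℕ} (f : C_c(Fin (k + 1) → X, ℂ)) (y : Fin k → X) (x : X) :
    headSlice f y x = f (Fin.cons x y) := rfl

theorem headSlice_eq_zero {k : ℕ} (K : TopologicalSpace.Compacts (Fin (k + 1) → X))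
    (f : suppIn (K : Set (Fin (k + 1) → X))) {y : Fin k → X} (hy : y ∉ tailCompacts K) :
    headSlice (suppInToCc K f) y = 0 := by
  ext x
  by_contra h
  refine hy ⟨Fin.cons x y, ?_, Fin.tail_cons _ _⟩
  by_contra h'
  exact h (f.2 _ h')

/-- Integration of `f ∈ C_c(X ^ (k+1); ℂ)` with respect to the first variable, as a linear map. -/
def contrAux (k : ℕ) (ν : Dual X) : C_c(Fin (k + 1) → X, ℂ) →ₗ[ℂ] C_c(Fin k → X, ℂ) where
  toFun f :=
    { toFun := fun y => ν (headSlice f y)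
      continuous_toFun := by
        obtain ⟨K, g, rfl⟩ := exists_suppInToCc f
        exact ν.continuous.comp ((continuous_suppInToCc _).comp (continuous_headSliceIn K g))
      hasCompactSupport' := by
        obtain ⟨K, g, rfl⟩ := exists_suppInToCc f
        refine HasCompactSupport.intro (tailCompacts K).isCompact fun y hy => ?_
        rw [headSlice_eq_zero K g hy, map_zero] }
  map_add' f g := by
    ext y
    exact ν.map_add (headSlice f y) (headSlice g y)
  map_smul' c f := by
    ext y
    exact ν.map_smul c (headSlice f y)

/-- Integration of `f ∈ C_c(X ^ (k+1); ℂ)` with respect to the first variable. -/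
def contrCc (k : ℕ) (ν : Dual X) : C_c(Fin (k + 1) → X, ℂ) →L[ℂ] C_c(Fin k → X, ℂ) where
  toLinearMap := contrAux k ν
  cont := by
    refine continuous_of_bound _ fun K => ?_
    let ν' : suppIn (headCompacts K : Set X) →L[ℂ] ℂ :=
      ⟨ν.toLinearMap ∘ₗ suppInToCc _, ν.continuous.comp (continuous_suppInToCc _)⟩
    refine ⟨tailCompacts K, ‖ν'‖, fun f => ⟨fun y hy => ?_, fun y => ?_⟩⟩
    · change ν (headSlice (suppInToCc K f) y) = 0
      rw [headSlice_eq_zero K f hy, map_zero]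
    · change ‖ν' (headSliceIn K f y)‖ ≤ _
      exact (ν'.le_opNorm _).trans (mul_le_mul_of_nonneg_left
        ((BoundedContinuousFunction.norm_le (norm_nonneg _)).2 fun x =>
          f.1.norm_coe_le_norm (Fin.cons x y)) (norm_nonneg _))

/-- Integration of a symmetric function with respect to one variable. -/
def contr (k : ℕ) (ν : Dual X) : SymCc X (k + 1) →L[ℂ] SymCc X k :=
  ((contrCc k ν).comp (SymCc X (k + 1)).subtypeL).codRestrict (SymCc X k) fun f σ y => by
    change ν (headSlice f (y ∘ σ)) = ν (headSlice f y)
    congr 1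
    ext x
    -- This permutation fixes the first coordinate and acts as `σ` on the others.
    have h := f.2 (Equiv.Perm.decomposeFin.symm (0, σ)) (Fin.cons x y)
    rw [headSlice_apply, headSlice_apply, ← h]
    congr 1
    ext i
    refine Fin.cases ?_ (fun j => ?_) i <;> simp

theorem contr_apply {k : ℕ} (ν : Dual X) (f : SymCc X (k + 1)) (y : Fin k → X) :
    (contr k ν f : C_c(Fin k → X, ℂ)) y = ν (headSlice f y) := rfl

theorem contr_dirac_apply {k : ℕ} (x : X) (f : SymCc X (k + 1)) (y : Fin k → X) :
    (contr k (dirac x) f : C_c(Fin k → X, ℂ)) y = (f : C_c(Fin (k + 1) → X, ℂ)) (Fin.cons x y) :=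
  rfl

theorem contr_powTensor (k : ℕ) (ν : Dual X) (ξ : C_c(X, ℂ)) :
    contr k ν (powTensor ξ (k + 1)) = ν ξ • powTensor ξ k := by
  ext y
  rw [contr_apply]
  have : headSlice (powTensor ξ (k + 1) : C_c(Fin (k + 1) → X, ℂ)) y = (∏ i, ξ (y i)) • ξ := by
    ext x
    simp [Fin.prod_univ_succ, mul_comm]
  rw [this, map_smul]
  simp [mul_comm]

theorem partialPairing_powTensor {k : ℕ} (L : C_c(Fin k → X, ℂ) →L[ℂ] ℂ) (ξ : C_c(X, ℂ)) :
    partialPairing L (powTensor ξ (k + 1)) = L (powTensor ξ k) • ξ := by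
  ext x
  change L (slice _ x) = _
  have : slice (powTensor ξ (k + 1) : C_c(Fin (k + 1) → X, ℂ)) x = ξ x • powTensor ξ k := by
    ext y
    simp [Fin.prod_univ_succ]
  rw [this, map_smul]
  simp [mul_comm]

/-- The tensor product `ν₁ ⊗ ⋯ ⊗ ν_k` of elements of the dual space. -/
def tensorProd : ∀ k : ℕ, (Fin k → Dual X) → C_c(Fin k → X, ℂ) →L[ℂ] ℂ
  | 0, _ => dirac Fin.elim0
  | k + 1, ν => (ν 0).comp (partialPairing (tensorProd k (Fin.tail ν)))

theorem tensorProd_powTensor (k : ℕ) (ν : Fin k → Dual X) (ξ : C_c(X, ℂ)) :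
    tensorProd k ν (powTensor ξ k) = ∏ i, ν i ξ := by
  induction k with
  | zero => simp [tensorProd, dirac]
  | succ k ih =>
    rw [tensorProd, ContinuousLinearMap.comp_apply, partialPairing_powTensor, map_smul, ih,
      Fin.prod_univ_succ, smul_eq_mul, mul_comm]
    rfl

theorem tensorPow_powTensor (k : ℕ) (ω : Dual X) (ξ : C_c(X, ℂ)) :
    tensorPow ω k (powTensor ξ k) = ω ξ ^ k := by
  induction k with
  | zero => simp [tensorPow, dirac]
  | succ k ih =>
    rw [tensorPow, ContinuousLinearMap.comp_apply, partialPairing_powTensor, map_smul, ih,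
      pow_succ, smul_eq_mul]

theorem tensorPow_zero_apply (ω : Dual X) (f : C_c(Fin 0 → X, ℂ)) :
    tensorPow ω 0 f = f Fin.elim0 := rfl

variable [LocallyCompactSpace X]

/-- A Fubini exchange: both sides integrate one variable against `ν` and the others against `ω`, in
different orders. By density it suffices to compare tensor powers, where both are scalar products.
-/
theorem tensorPow_contr {k : ℕ} (ω ν : Dual X) (f : SymCc X (k + 1)) :
    tensorPow ω k (contr k ν f) = ν (partialPairing (tensorPow ω k) f) := by
  have : ((tensorPow ω k).comp (SymCc X k).subtypeL).comp (contr k ν) =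
      (ν.comp (partialPairing (tensorPow ω k))).comp (SymCc X (k + 1)).subtypeL :=
    symCc_ext fun ξ => by
      simp [contr_powTensor, partialPairing_powTensor, tensorPow_powTensor, mul_comm]
  exact congrArg (fun T : SymCc X (k + 1) →L[ℂ] ℂ => T f) this

theorem tensorPow_smul {k : ℕ} (t : ℂ) (ω : Dual X) (f : SymCc X k) :
    tensorPow (t • ω) k f = t ^ k * tensorPow ω k f := by
  have : (tensorPow (t • ω) k).comp (SymCc X k).subtypeL =
      t ^ k • (tensorPow ω k).comp (SymCc X k).subtypeL :=
    symCc_ext fun ξ => by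
      simp [tensorPow_powTensor, mul_pow]
  exact congrArg (fun T : SymCc X k →L[ℂ] ℂ => T f) this

/-- The binomial expansion of `⟨(ω + t ν) ^ ⊗k, f⟩`. -/
theorem tensorPow_add_smul {k : ℕ} (t : ℂ) (ω ν : Dual X) (f : SymCc X k) :
    tensorPow (ω + t • ν) k f = ∑ j ∈ Finset.range (k + 1), t ^ j * (k.choose j *
      tensorProd k (fun i => if (i : ℕ) < j then ν else ω) f) := by
  have : (tensorPow (ω + t • ν) k).comp (SymCc X k).subtypeL =
      ∑ j ∈ Finset.range (k + 1), (t ^ j * k.choose j) •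
        (tensorProd k (fun i => if (i : ℕ) < j then ν else ω)).comp (SymCc X k).subtypeL := by
    refine symCc_ext fun ξ => ?_
    simp only [ContinuousLinearMap.comp_apply, Submodule.subtypeL_apply, tensorPow_powTensor,
      sum_apply, smul_apply, tensorProd_powTensor,
      add_apply, smul_eq_mul]
    rw [add_comm, add_pow]
    refine Finset.sum_congr rfl fun j hj => ?_
    have hj' : j ≤ k := Nat.lt_succ_iff.1 (Finset.mem_range.1 hj)
    have : ∏ i : Fin k, (if (i : ℕ) < j then ν else ω) ξ = ν ξ ^ j * ω ξ ^ (k - j) := by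
      simp only [apply_ite (fun μ : Dual X => μ ξ)]
      rw [Fin.prod_univ_eq_prod_range (fun i => if i < j then ν ξ else ω ξ) k,
        ← Finset.prod_range_mul_prod_Ico _ hj',
        Finset.prod_congr rfl fun i hi => if_pos (Finset.mem_range.1 hi),
        Finset.prod_congr rfl fun i hi => if_neg (not_lt.2 (Finset.mem_Ico.1 hi).1)]
      simp
    rw [this, mul_pow]
    ring
  have h := congrArg (fun T : SymCc X k →L[ℂ] ℂ => T f) this
  simp only [ContinuousLinearMap.comp_apply, Submodule.subtypeL_apply, sum_apply,
      smul_apply, smul_eq_mul] at h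
  rw [h]
  exact Finset.sum_congr rfl fun j _ => by ring

/-- In the binomial expansion of `⟨(ω + t ν) ^ ⊗(k+1), f⟩` only the term linear in `t` contributes
to the derivative at `t = 0`; its coefficient pairs `ν` with one variable and `ω` with all the
others. -/
theorem hasLineDerivAt_tensorPow_succ {k : ℕ} (ω ν : Dual X) (f : SymCc X (k + 1)) :
    HasLineDerivAt ℂ (fun ω : Dual X => tensorPow ω (k + 1) f)
      ((k + 1 : ℂ) * tensorPow ω k (contr k ν f)) ω ν := by
  rw [HasLineDerivAt]
  simp_rw [tensorPow_add_smul]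
  have h : ∀ j ∈ Finset.range (k + 1 + 1), HasDerivAt (fun t : ℂ => t ^ j * ((k + 1).choose j *
      tensorProd (k + 1) (fun i => if (i : ℕ) < j then ν else ω) f))
      ((if j = 1 then 1 else 0) * ((k + 1).choose j *
      tensorProd (k + 1) (fun i => if (i : ℕ) < j then ν else ω) f)) 0 := by
    intro j _
    refine HasDerivAt.mul_const ?_ _
    have h0 : (if j = 1 then 1 else 0 : ℂ) = j * 0 ^ (j - 1) := by
      rcases j with _ | _ | j <;> simp
    rw [h0]
    exact hasDerivAt_pow j 0
  convert HasDerivAt.fun_sum h using 1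
  rw [Finset.sum_eq_single_of_mem 1 (by simp) (fun j _ hj => by simp [hj]), if_pos rfl, one_mul,
    tensorPow_contr]
  have h2 : ∀ (n : ℕ), tensorProd n (fun _ => ω) = tensorPow ω n := by
    intro n
    induction n with
    | zero => rfl
    | succ n ih => rw [tensorProd, tensorPow, ← ih]; rfl
  rw [tensorProd]
  have h3 : Fin.tail (fun i : Fin (k + 1) => if (i : ℕ) < 1 then ν else ω) = fun _ => ω := by
    ext i; simp [Fin.tail]
  rw [h3, h2]
  simp

omit [LocallyCompactSpace X] in
theorem hasLineDerivAt_tensorPow_zero (ω ν : Dual X) (f : SymCc X 0) :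
    HasLineDerivAt ℂ (fun ω : Dual X => tensorPow ω 0 f) 0 ω ν := by
  simp_rw [tensorPow_zero_apply]
  exact hasDerivAt_const _ _

end Contraction

/-! ### Derivatives, homogeneous components and the degree filtration of polynomials -/

section PolyOperators

variable {X : Type*} [TopologicalSpace X] [T2Space X]

namespace Poly

theorem ext {p q : Poly X} (h : ∀ ω, p ω = q ω) : p = q := Subtype.ext (funext h)

@[simp] theorem add_apply (p q : Poly X) (ω : Dual X) : (p + q) ω = p ω + q ω := rfl
@[simp] theorem sub_apply (p q : Poly X) (ω : Dual X) : (p - q) ω = p ω - q ω := rfl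
@[simp] theorem smul_apply (c : ℂ) (p : Poly X) (ω : Dual X) : (c • p) ω = c * p ω := rfl
@[simp] theorem zero_apply (ω : Dual X) : (0 : Poly X) ω = 0 := rfl

theorem continuous_mono (k : ℕ) : Continuous (mono (X := X) k) :=
  continuous_lcFinal (fun k : ℕ => mono (X := X) k) k

/-- The monomials of degree `k` as a continuous linear map. -/
def monoCLM (k : ℕ) : SymCc X k →L[ℂ] Poly X := ⟨mono k, continuous_mono k⟩

@[simp] theorem monoCLM_apply (k : ℕ) (f : SymCc X k) : monoCLM k f = mono k f := rfl

theorem continuous_of_mono {G : Type*} [AddCommGroup G] [Module ℂ G] [Module ℝ G]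
    [TopologicalSpace G] [IsTopologicalAddGroup G] [ContinuousSMul ℂ G] [LocallyConvexSpace ℝ G]
    [IsScalarTower ℝ ℂ G] (L : Poly X →ₗ[ℂ] G) (hL : ∀ k, Continuous fun f => L (mono k f)) :
    Continuous L :=
  continuous_of_lcFinal _ L hL

theorem induction_mono {M : Poly X → Prop} (h : ∀ k f, M (mono k f)) (h0 : M 0)
    (hadd : ∀ p q, M p → M q → M (p + q)) (p : Poly X) : M p := by
  obtain ⟨p, hp⟩ := p
  refine Submodule.iSup_induction' (fun k : ℕ => LinearMap.range (monoFun (X := X) k))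
    (motive := fun p hp => M (⟨p, hp⟩ : polySubmodule X)) ?_ h0 (fun p q hp hq => hadd _ _) hp
  rintro k _ ⟨f, rfl⟩
  exact h k f

/-- Linear maps agreeing on all monomials agree. -/
theorem hom_ext {G : Type*} [AddCommGroup G] [Module ℂ G] [TopologicalSpace G]
    {T S : Poly X →L[ℂ] G} (h : ∀ k f, T (mono k f) = S (mono k f)) : T = S := by
  ext p
  induction p using induction_mono with
  | h k f => exact h k f
  | h0 => simp
  | hadd p q hp hq => rw [map_add, map_add, hp, hq]

/-- Evaluation at `ω`. -/
def eval (ω : Dual X) : Poly X →L[ℂ] ℂ :=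
  let L : Poly X →ₗ[ℂ] ℂ :=
    { toFun := fun p => p ω
      map_add' := fun _ _ => rfl
      map_smul' := fun _ _ => rfl }
  { L with
    cont := continuous_of_mono L fun k =>
      ((tensorPow ω k).comp (SymCc X k).subtypeL).continuous }

@[simp] theorem eval_apply (ω : Dual X) (p : Poly X) : eval ω p = p ω := rfl

/-- The polynomial `⟨·^⊗k, ξ^⊗k⟩`. -/
def pow (k : ℕ) (ξ : C_c(X, ℂ)) : Poly X := mono k (powTensor ξ k)

theorem pow_apply (k : ℕ) (ξ : C_c(X, ℂ)) (ω : Dual X) : pow k ξ ω = ω ξ ^ k :=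
  tensorPow_powTensor k ω ξ

variable [LocallyCompactSpace X]

theorem functional_ext {T S : Poly X →L[ℂ] ℂ} (h : ∀ k ξ, T (pow k ξ) = S (pow k ξ)) : T = S :=
  hom_ext fun k f => by
    have : T.comp (monoCLM k) = S.comp (monoCLM k) := symCc_ext (h k)
    exact congrArg (fun T : SymCc X k →L[ℂ] ℂ => T f) this

/-- Evaluations separate polynomials, so the density statement for scalar functionals carries over
to operators. -/
theorem operator_ext {T S : Poly X →L[ℂ] Poly X} (h : ∀ k ξ, T (pow k ξ) = S (pow k ξ)) :
    T = S := by
  ext p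
  refine ext fun ω => ?_
  have : (eval ω).comp T = (eval ω).comp S := functional_ext fun k ξ => by simp [h]
  exact congrArg (fun T : Poly X →L[ℂ] ℂ => T p) this

theorem hasLineDerivAt_mono_succ {k : ℕ} (ω ν : Dual X) (f : SymCc X (k + 1)) :
    HasLineDerivAt ℂ (mono (k + 1) f : Dual X → ℂ) (((k + 1 : ℂ) • mono k (contr k ν f)) ω) ω ν :=
  hasLineDerivAt_tensorPow_succ ω ν f

omit [LocallyCompactSpace X] in
theorem hasLineDerivAt_mono_zero (ω ν : Dual X) (f : SymCc X 0) :
    HasLineDerivAt ℂ (mono 0 f : Dual X → ℂ) ((0 : Poly X) ω) ω ν :=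
  hasLineDerivAt_tensorPow_zero ω ν f

theorem exists_deriv (ν : Dual X) (p : Poly X) :
    ∃ q : Poly X, ∀ ω, HasLineDerivAt ℂ (p : Dual X → ℂ) (q ω) ω ν := by
  induction p using induction_mono with
  | h k f =>
    rcases k with _ | k
    · exact ⟨0, fun ω => hasLineDerivAt_mono_zero ω ν f⟩
    · exact ⟨_, fun ω => hasLineDerivAt_mono_succ ω ν f⟩
  | h0 => exact ⟨0, fun ω => hasDerivAt_const _ _⟩
  | hadd p q hp hq =>
    obtain ⟨p', hp⟩ := hp
    obtain ⟨q', hq⟩ := hq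
    exact ⟨p' + q', fun ω => HasDerivAt.add (hp ω) (hq ω)⟩

/-- The derivative of a polynomial in the direction `ν`, as a polynomial. -/
def derivAux (ν : Dual X) (p : Poly X) : Poly X := (exists_deriv ν p).choose

theorem hasLineDerivAt_derivAux (ν : Dual X) (p : Poly X) (ω : Dual X) :
    HasLineDerivAt ℂ (p : Dual X → ℂ) (derivAux ν p ω) ω ν := (exists_deriv ν p).choose_spec ω

theorem eq_derivAux {ν : Dual X} {p q : Poly X}
    (h : ∀ ω, HasLineDerivAt ℂ (p : Dual X → ℂ) (q ω) ω ν) : derivAux ν p = q :=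
  ext fun ω => (hasLineDerivAt_derivAux ν p ω).unique (h ω)

/-- The derivative in the direction `ν` as a continuous linear operator on polynomials. -/
def D (ν : Dual X) : Poly X →L[ℂ] Poly X :=
  let L : Poly X →ₗ[ℂ] Poly X :=
    { toFun := derivAux ν
      map_add' := fun p q => eq_derivAux fun ω =>
        HasDerivAt.add (hasLineDerivAt_derivAux ν p ω) (hasLineDerivAt_derivAux ν q ω)
      map_smul' := fun c p => eq_derivAux fun ω =>
        HasDerivAt.const_mul c (hasLineDerivAt_derivAux ν p ω) }
  { L with
    cont := continuous_of_mono L fun k => by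
      rcases k with _ | k
      · have : (fun f : SymCc X 0 => L (mono 0 f)) = fun _ => 0 :=
          funext fun f => eq_derivAux fun ω => hasLineDerivAt_mono_zero ω ν f
        rw [this]
        exact continuous_const
      · have : (fun f : SymCc X (k + 1) => L (mono (k + 1) f)) =
            ((k + 1 : ℂ) • (monoCLM k).comp (contr k ν) : SymCc X (k + 1) →L[ℂ] Poly X) :=
          funext fun f => eq_derivAux fun ω => hasLineDerivAt_mono_succ ω ν f
        rw [this]
        exact ContinuousLinearMap.continuous _ }

theorem hasLineDerivAt_D (ν : Dual X) (p : Poly X) (ω : Dual X) :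
    HasLineDerivAt ℂ (p : Dual X → ℂ) (D ν p ω) ω ν := hasLineDerivAt_derivAux ν p ω

theorem lineDeriv_eq_D (ν : Dual X) (p : Poly X) :
    (fun ω => lineDeriv ℂ (p : Dual X → ℂ) ω ν) = D ν p :=
  funext fun ω => (hasLineDerivAt_D ν p ω).lineDeriv

@[simp] theorem D_mono_zero (ν : Dual X) (f : SymCc X 0) : D ν (mono 0 f) = 0 :=
  eq_derivAux fun ω => hasLineDerivAt_mono_zero ω ν f

theorem D_mono_succ {k : ℕ} (ν : Dual X) (f : SymCc X (k + 1)) :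
    D ν (mono (k + 1) f) = (k + 1 : ℂ) • mono k (contr k ν f) :=
  eq_derivAux fun ω => hasLineDerivAt_mono_succ ω ν f

theorem D_pow_zero (ν : Dual X) (ξ : C_c(X, ℂ)) : D ν (pow 0 ξ) = 0 := D_mono_zero _ _

theorem D_pow_succ (k : ℕ) (ν : Dual X) (ξ : C_c(X, ℂ)) :
    D ν (pow (k + 1) ξ) = ((k + 1 : ℂ) * ν ξ) • pow k ξ := by
  rw [pow, D_mono_succ, contr_powTensor, map_smul, smul_smul, pow]

theorem D_comm (μ ν : Dual X) : D μ * D ν = D ν * D μ := operator_ext fun k ξ => by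
  rcases k with _ | _ | k
  · simp [D_pow_zero]
  · simp [D_pow_succ, D_pow_zero]
  · simp only [mul_apply_eq_comp, D_pow_succ, map_smul, smul_smul]
    congr 1
    ring

/-- `D_{ν₁} ⋯ D_{ν_k}`. -/
def iterD {k : ℕ} (ν : Fin k → Dual X) : Poly X →L[ℂ] Poly X := (List.ofFn fun i => D (ν i)).prod

theorem iterD_zero (ν : Fin 0 → Dual X) : iterD ν = 1 := by simp [iterD]

theorem iterD_succ {k : ℕ} (ν : Fin (k + 1) → Dual X) :
    iterD ν = D (ν 0) * iterD (Fin.tail ν) := by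
  simp only [iterD, List.ofFn_succ, List.prod_cons]; rfl

theorem D_mul_iterD {k : ℕ} (μ : Dual X) (ν : Fin k → Dual X) : D μ * iterD ν = iterD ν * D μ := by
  induction k with
  | zero => simp [iterD_zero]
  | succ k ih =>
    rw [iterD_succ, ← mul_assoc, D_comm, mul_assoc, ih, mul_assoc]

theorem iterD_succ' {k : ℕ} (ν : Fin (k + 1) → Dual X) :
    iterD ν = iterD (Fin.tail ν) * D (ν 0) := by rw [iterD_succ, D_mul_iterD]

/-- Replaces iterated line derivatives of functions by products of commuting operators on
polynomials. -/
theorem diracDeriv_eq {k : ℕ} (x : Fin k → X) (p : Poly X) :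
    diracDeriv x p = iterD (fun i => dirac (x i)) p := by
  induction k with
  | zero => simp [diracDeriv, iterD_zero]
  | succ k ih =>
    have h := ih (Fin.tail x)
    rw [diracDeriv] at h ⊢
    rw [List.ofFn_succ, List.foldr_cons]
    change (fun ω => lineDeriv ℂ (List.foldr _ _ (List.ofFn (Fin.tail x))) ω _) = _
    rw [h, iterD_succ]
    exact lineDeriv_eq_D _ _

omit [LocallyCompactSpace X] in
theorem mono_zero_apply (f : SymCc X 0) (ω : Dual X) :
    mono 0 f ω = (f : C_c(Fin 0 → X, ℂ)) Fin.elim0 := rfl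

omit [LocallyCompactSpace X] in
theorem mono_succ_apply_zero (k : ℕ) (f : SymCc X (k + 1)) : mono (k + 1) f 0 = 0 := rfl

theorem iterD_mono_self {k : ℕ} (x : Fin k → X) (f : SymCc X k) :
    iterD (fun i => dirac (x i)) (mono k f) 0 = k.factorial * (f : C_c(Fin k → X, ℂ)) x := by
  induction k with
  | zero => simp [iterD_zero, mono_zero_apply, Subsingleton.elim x Fin.elim0]
  | succ k ih =>
    rw [iterD_succ', mul_apply_eq_comp, D_mono_succ, map_smul, smul_apply]
    rw [show (Fin.tail fun i => dirac (x i)) = fun i => dirac (Fin.tail x i) from rfl, ih,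
      contr_dirac_apply, Fin.cons_self_tail, Nat.factorial_succ]
    push_cast
    ring

theorem iterD_mono_ne {n k : ℕ} (hn : n ≠ k) (ν : Fin k → Dual X) (f : SymCc X n) :
    iterD ν (mono n f) 0 = 0 := by
  induction k generalizing n with
  | zero =>
    obtain ⟨n, rfl⟩ := Nat.exists_eq_succ_of_ne_zero hn
    simp [iterD_zero, mono_succ_apply_zero]
  | succ k ih =>
    rw [iterD_succ', mul_apply_eq_comp]
    rcases n with _ | n
    · simp
    · rw [D_mono_succ, map_smul, smul_apply, ih (by omega), mul_zero]

/-- Polynomials are defined as functions, with no grading built in. Homogeneous components are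
recovered by Taylor's formula at `0`: the `k`-fold Dirac derivatives at `0` see only degree `k`, and
there they return `k!` times the values of the kernel. This makes the sum over degrees direct. -/
theorem exists_proj (k : ℕ) (p : Poly X) : ∃ g : SymCc X k, ∀ x, (g : C_c(Fin k → X, ℂ)) x =
    (k.factorial : ℂ)⁻¹ * iterD (fun i => dirac (x i)) p 0 := by
  induction p using induction_mono with
  | h n f =>
    rcases eq_or_ne n k with rfl | h
    · refine ⟨f, fun x => ?_⟩
      rw [iterD_mono_self, inv_mul_cancel_left₀ (by exact_mod_cast n.factorial_ne_zero)]
    · exact ⟨0, fun x => by rw [iterD_mono_ne h]; simp⟩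
  | h0 => exact ⟨0, fun x => by simp⟩
  | hadd p q hp hq =>
    obtain ⟨g, hg⟩ := hp
    obtain ⟨h, hh⟩ := hq
    exact ⟨g + h, fun x => by simp [hg, hh, mul_add]⟩

/-- The coefficient of degree `k` of a polynomial. -/
def coeffLin (k : ℕ) : Poly X →ₗ[ℂ] SymCc X k where
  toFun p := (exists_proj k p).choose
  map_add' p q := by
    ext x
    simp only [Submodule.coe_add, CompactlySupportedContinuousMap.add_apply]
    rw [(exists_proj k p).choose_spec, (exists_proj k q).choose_spec,
      (exists_proj k (p + q)).choose_spec, map_add, add_apply, mul_add]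
  map_smul' c p := by
    ext x
    simp only [Submodule.coe_smul, CompactlySupportedContinuousMap.smul_apply, RingHom.id_apply]
    rw [(exists_proj k p).choose_spec, (exists_proj k (c • p)).choose_spec, map_smul, smul_apply,
      smul_eq_mul]
    ring

theorem coeffLin_apply (k : ℕ) (p : Poly X) (x : Fin k → X) :
    (coeffLin k p : C_c(Fin k → X, ℂ)) x =
      (k.factorial : ℂ)⁻¹ * iterD (fun i => dirac (x i)) p 0 := (exists_proj k p).choose_spec x

theorem coeffLin_mono_self (k : ℕ) (f : SymCc X k) : coeffLin k (mono k f) = f := by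
  ext x
  rw [coeffLin_apply, iterD_mono_self,
    inv_mul_cancel_left₀ (by exact_mod_cast k.factorial_ne_zero)]

theorem coeffLin_mono_ne {n k : ℕ} (h : n ≠ k) (f : SymCc X n) : coeffLin k (mono n f) = 0 := by
  ext x
  rw [coeffLin_apply, iterD_mono_ne h]
  simp

/-- The coefficient of degree `k` of a polynomial, as a continuous linear map. -/
def coeff (k : ℕ) : Poly X →L[ℂ] SymCc X k where
  toLinearMap := coeffLin k
  cont := by
    refine continuous_induced_rng.2 (continuous_of_mono
      ((SymCc X k).subtype ∘ₗ coeffLin k) fun n => ?_)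
    rcases eq_or_ne n k with rfl | h
    · simp only [LinearMap.comp_apply, coeffLin_mono_self]
      exact continuous_subtype_val
    · simp only [LinearMap.comp_apply, coeffLin_mono_ne h, map_zero]
      exact continuous_const

theorem coeff_apply (k : ℕ) (p : Poly X) (x : Fin k → X) :
    (coeff k p : C_c(Fin k → X, ℂ)) x =
      (k.factorial : ℂ)⁻¹ * iterD (fun i => dirac (x i)) p 0 := coeffLin_apply k p x

@[simp] theorem coeff_mono_self (k : ℕ) (f : SymCc X k) : coeff k (mono k f) = f :=
  coeffLin_mono_self k f

theorem coeff_mono_ne {n k : ℕ} (h : n ≠ k) (f : SymCc X n) : coeff k (mono n f) = 0 :=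
  coeffLin_mono_ne h f

theorem exists_coeff_eq_zero (p : Poly X) : ∃ N, ∀ k, N ≤ k → coeff k p = 0 := by
  induction p using induction_mono with
  | h n f => exact ⟨n + 1, fun k hk => coeff_mono_ne (by omega) f⟩
  | h0 => exact ⟨0, fun k _ => map_zero _⟩
  | hadd p q hp hq =>
    obtain ⟨N, hN⟩ := hp
    obtain ⟨M, hM⟩ := hq
    exact ⟨max N M, fun k hk => by
      rw [map_add, hN k (le_of_max_le_left hk), hM k (le_of_max_le_right hk), add_zero]⟩

/-- The polynomials of degree less than `n`. -/
def degLT (n : ℕ) : Submodule ℂ (Poly X) := ⨅ (k : ℕ) (_ : n ≤ k), LinearMap.ker (coeffLin k)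

theorem mem_degLT {n : ℕ} {p : Poly X} : p ∈ degLT n ↔ ∀ k, n ≤ k → coeff k p = 0 := by
  simp only [degLT, Submodule.mem_iInf, LinearMap.mem_ker]
  rfl

theorem exists_mem_degLT (p : Poly X) : ∃ n, p ∈ degLT n := by
  simpa only [mem_degLT] using exists_coeff_eq_zero p

theorem degLT_mono {m n : ℕ} (h : m ≤ n) {p : Poly X} (hp : p ∈ degLT m) : p ∈ degLT n :=
  mem_degLT.2 fun k hk => mem_degLT.1 hp k (h.trans hk)

theorem mono_mem_degLT {n k : ℕ} (h : k < n) (f : SymCc X k) : mono k f ∈ degLT n :=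
  mem_degLT.2 fun _ hj => coeff_mono_ne (by omega) f

theorem sum_mono_coeff {n : ℕ} {p : Poly X} (hp : p ∈ degLT n) :
    ∑ k ∈ Finset.range n, mono k (coeff k p) = p := by
  -- Induction over sums of monomials does not control the degree bound `n`, so the identity is
  -- first shown for all large truncations; the surplus terms vanish afterwards.
  have key : ∃ N, ∀ M, N ≤ M → ∑ k ∈ Finset.range M, mono k (coeff k p) = p := by
    clear hp
    induction p using induction_mono with
    | h k f =>
      refine ⟨k + 1, fun M hM => ?_⟩
      rw [Finset.sum_eq_single_of_mem k (Finset.mem_range.2 hM)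
        fun j _ hj => by rw [coeff_mono_ne hj.symm, map_zero], coeff_mono_self]
    | h0 => exact ⟨0, by simp⟩
    | hadd p q hp hq =>
      obtain ⟨N, hN⟩ := hp
      obtain ⟨N', hN'⟩ := hq
      refine ⟨max N N', fun M hM => ?_⟩
      simp only [map_add, Finset.sum_add_distrib]
      rw [hN M (le_of_max_le_left hM), hN' M (le_of_max_le_right hM)]
  obtain ⟨N, hN⟩ := key
  refine (Finset.sum_subset_zero_on_sdiff (Finset.range_mono (le_max_right N n)) (fun k hk => ?_)
    fun _ _ => rfl).trans (hN (max N n) (le_max_left _ _))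
  have : n ≤ k := by simpa using (Finset.mem_sdiff.1 hk).2
  rw [mem_degLT.1 hp k this, map_zero]

theorem degLT_zero {p : Poly X} (hp : p ∈ degLT 0) : p = 0 := by
  rw [← sum_mono_coeff hp]; simp

/-- Continuous linear maps on polynomials can be prescribed on the monomials of each degree. -/
theorem exists_lift {G : Type*} [AddCommGroup G] [Module ℂ G] [Module ℝ G]
    [TopologicalSpace G] [IsTopologicalAddGroup G] [ContinuousSMul ℂ G] [LocallyConvexSpace ℝ G]
    [IsScalarTower ℝ ℂ G] (T : ∀ k, SymCc X k →L[ℂ] G) :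
    ∃ L : Poly X →L[ℂ] G, ∀ k f, L (mono k f) = T k f := by
  have hfin : ∀ p : Poly X, (Function.support fun k => T k (coeff k p)).Finite := fun p => by
    obtain ⟨N, hN⟩ := exists_coeff_eq_zero p
    refine (Finset.range N).finite_toSet.subset fun k hk => ?_
    by_contra h
    exact hk (by simp only [Finset.coe_range, Set.mem_Iio, not_lt] at h; simp [hN k h])
  let L : Poly X →ₗ[ℂ] G :=
    { toFun := fun p => ∑ᶠ k, T k (coeff k p)
      map_add' := fun p q => by
        rw [← finsum_add_distrib (hfin p) (hfin q)]
        simp only [map_add]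
      map_smul' := fun c p => by
        rw [RingHom.id_apply, smul_finsum' c (hfin p)]
        simp only [map_smul] }
  have hL : ∀ k f, L (mono k f) = T k f := fun k f => by
    change ∑ᶠ j, T j (coeff j (mono k f)) = _
    rw [finsum_eq_single _ k fun j hj => by rw [coeff_mono_ne hj.symm, map_zero], coeff_mono_self]
  refine ⟨⟨L, continuous_of_mono L fun k => ?_⟩, hL⟩
  simp only [hL]
  exact (T k).continuous

end Poly

end PolyOperators

/-! ### Operators lowering the degree and their functional calculus -/

/-- The Cauchy product rearrangement for truncated double sums whose terms vanish on and above the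
diagonal `i + j = n`. Degree lowering provides this vanishing in the operator applications. -/
theorem sum_range_prod_eq_sum_antidiagonal {M : Type*} [AddCommMonoid M] (n : ℕ) (g : ℕ → ℕ → M)
    (hg : ∀ i j, n ≤ i + j → g i j = 0) :
    ∑ i ∈ Finset.range n, ∑ j ∈ Finset.range n, g i j =
      ∑ m ∈ Finset.range n, ∑ x ∈ Finset.HasAntidiagonal.antidiagonal m, g x.1 x.2 := by
  rw [← Finset.sum_product' (f := g),
    ← Finset.sum_filter_of_ne (p := fun x : ℕ × ℕ => x.1 + x.2 < n) fun x _ hx => by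
      by_contra h
      exact hx (hg _ _ (not_lt.1 h)),
    ← Finset.sum_fiberwise_of_maps_to (t := Finset.range n) (g := fun x : ℕ × ℕ => x.1 + x.2)
      fun x hx => Finset.mem_range.2 (Finset.mem_filter.1 hx).2]
  refine Finset.sum_congr rfl fun m hm => Finset.sum_congr ?_ fun _ _ => rfl
  ext ⟨i, j⟩
  simp only [Finset.mem_filter, Finset.mem_product, Finset.mem_range,
    Finset.HasAntidiagonal.mem_antidiagonal] at hm ⊢
  omega

section Lowering

variable {X : Type*} [TopologicalSpace X] [T2Space X] [LocallyCompactSpace X]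

namespace Poly

/-- The operator `T` lowers the degree of polynomials by at least `r`. -/
def LowersBy (r : ℕ) (T : Poly X →L[ℂ] Poly X) : Prop :=
  ∀ (n : ℕ) (p : Poly X), p ∈ degLT (n + r) → T p ∈ degLT n

theorem lowersBy_of_mono {r : ℕ} {T : Poly X →L[ℂ] Poly X}
    (h : ∀ k f, T (mono k f) ∈ degLT (k + 1 - r)) : LowersBy r T := fun n p hp => by
  rw [← sum_mono_coeff hp, map_sum]
  exact Submodule.sum_mem _ fun k hk => degLT_mono (by
    have := Finset.mem_range.1 hk
    omega) (h k _)

theorem LowersBy.mul {r s : ℕ} {T S : Poly X →L[ℂ] Poly X} (hT : LowersBy r T)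
    (hS : LowersBy s S) : LowersBy (r + s) (T * S) := fun n p hp =>
  hT n _ (hS (n + r) p (by rwa [add_assoc]))

theorem lowersBy_one : LowersBy 0 (1 : Poly X →L[ℂ] Poly X) := fun _ _ hp => hp

theorem LowersBy.mono {r s : ℕ} {T : Poly X →L[ℂ] Poly X} (hT : LowersBy r T) (h : s ≤ r) :
    LowersBy s T := fun n p hp => hT n p (degLT_mono (by omega) hp)

theorem LowersBy.sub {r : ℕ} {T S : Poly X →L[ℂ] Poly X} (hT : LowersBy r T)
    (hS : LowersBy r S) : LowersBy r (T - S) := fun n p hp =>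
  Submodule.sub_mem _ (hT n p hp) (hS n p hp)

theorem LowersBy.pow {r : ℕ} {T : Poly X →L[ℂ] Poly X} (hT : LowersBy r T) (i : ℕ) :
    LowersBy (i * r) (T ^ i) := by
  induction i with
  | zero => simpa using lowersBy_one
  | succ i ih => rw [pow_succ, add_mul, one_mul]; exact ih.mul hT

theorem LowersBy.pow_one {T : Poly X →L[ℂ] Poly X} (hT : LowersBy 1 T) (i : ℕ) :
    LowersBy i (T ^ i) := by simpa using hT.pow i

theorem LowersBy.apply_eq_zero {r n : ℕ} {T : Poly X →L[ℂ] Poly X} (hT : LowersBy r T)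
    {p : Poly X} (hp : p ∈ degLT n) (h : n ≤ r) : T p = 0 :=
  degLT_zero (hT 0 p (degLT_mono (by omega) hp))

theorem lowersBy_D (ν : Dual X) : LowersBy 1 (D ν) := lowersBy_of_mono fun k f => by
  rcases k with _ | k
  · simp
  · rw [D_mono_succ]
    exact Submodule.smul_mem _ _ (mono_mem_degLT (by omega) _)

/-- The operator `φ(N)`, for a formal power series `φ` and an operator `N` lowering the degree. -/
def fc (φ : PowerSeries ℂ) (N : Poly X →L[ℂ] Poly X) : Poly X →L[ℂ] Poly X :=
  (exists_lift fun k => ∑ i ∈ Finset.range (k + 1),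
    PowerSeries.coeff i φ • (N ^ i).comp (monoCLM k)).choose

theorem fc_mono (φ : PowerSeries ℂ) (N : Poly X →L[ℂ] Poly X) (k : ℕ) (f : SymCc X k) :
    fc φ N (ShefferLie.mono k f) = ∑ i ∈ Finset.range (k + 1),
      PowerSeries.coeff i φ • (N ^ i) (ShefferLie.mono k f) := by
  refine ((exists_lift fun k => ∑ i ∈ Finset.range (k + 1),
    PowerSeries.coeff i φ • (N ^ i).comp (monoCLM k)).choose_spec k f).trans ?_
  simp [sum_apply]

section

variable {N : Poly X →L[ℂ] Poly X} (hN : LowersBy 1 N)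

include hN

/-- `N ^ i` kills every polynomial of degree less than `n` once `i ≥ n`, so a single truncation
serves all homogeneous components at once. -/
theorem fc_apply (φ : PowerSeries ℂ) {n : ℕ} {p : Poly X} (hp : p ∈ degLT n) :
    fc φ N p = ∑ i ∈ Finset.range n, PowerSeries.coeff i φ • (N ^ i) p := by
  have h : ∀ k ∈ Finset.range n, fc φ N (ShefferLie.mono k (coeff k p)) =
      ∑ i ∈ Finset.range n, PowerSeries.coeff i φ • (N ^ i) (ShefferLie.mono k (coeff k p)) := by
    intro k hk
    rw [fc_mono]
    refine Finset.sum_subset (Finset.range_mono (Finset.mem_range.1 hk)) fun i _ hi => ?_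
    rw [(hN.pow_one i).apply_eq_zero (mono_mem_degLT (Nat.lt_succ_self k) _)
      (by simpa using hi), smul_zero]
  conv_lhs => rw [← sum_mono_coeff hp, map_sum, Finset.sum_congr rfl h, Finset.sum_comm]
  refine Finset.sum_congr rfl fun i _ => ?_
  rw [← Finset.smul_sum, ← map_sum, sum_mono_coeff hp]

theorem lowersBy_fc (φ : PowerSeries ℂ) : LowersBy 0 (fc φ N) := fun n p hp => by
  rw [fc_apply hN φ hp]
  exact Submodule.sum_mem _ fun i _ => Submodule.smul_mem _ _
    (((hN.pow_one i).mono (Nat.zero_le i)) n p hp)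

theorem lowersBy_fc_sub_one {φ : PowerSeries ℂ} (hφ : PowerSeries.coeff 0 φ = 1) :
    LowersBy 1 (fc φ N - 1) := fun n p hp => by
  rw [_root_.sub_apply, fc_apply hN φ hp, Finset.sum_range_succ', hφ]
  simp only [pow_zero, one_apply_eq_self, one_smul, add_sub_cancel_right]
  exact Submodule.sum_mem _ fun i _ => Submodule.smul_mem _ _
    (((hN.pow_one (i + 1)).mono (by omega)) n p hp)

/-- Multiplicativity of the functional calculus is the Cauchy product; the terms discarded by
truncation contain `N ^ (i + j)` with `i + j ≥ n`. Inverses of unipotent operators are obtained from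
inverses of power series in this way. -/
theorem fc_mul (φ ψ : PowerSeries ℂ) : fc (φ * ψ) N = fc φ N * fc ψ N := by
  ext p
  obtain ⟨n, hp⟩ := exists_mem_degLT p
  rw [mul_apply_eq_comp, fc_apply hN φ (lowersBy_fc hN ψ n p hp), fc_apply hN ψ hp,
    fc_apply hN _ hp]
  simp only [map_sum, map_smul, Finset.smul_sum, smul_smul, PowerSeries.coeff_mul,
    Finset.sum_smul]
  rw [sum_range_prod_eq_sum_antidiagonal]
  · refine Finset.sum_congr rfl fun m _ => Finset.sum_congr rfl fun x hx => ?_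
    rw [← mul_apply_eq_comp, ← pow_add, Finset.HasAntidiagonal.mem_antidiagonal.1 hx]
  · intro i j hij
    rw [← mul_apply_eq_comp, ← pow_add, (hN.pow_one _).apply_eq_zero hp hij, smul_zero]

omit hN in
theorem fc_one : fc 1 N = 1 := by
  refine hom_ext fun k f => ?_
  rw [fc_mono, Finset.sum_range_succ']
  simp [PowerSeries.coeff_one]

theorem fc_pow (φ : PowerSeries ℂ) (n : ℕ) : fc (φ ^ n) N = fc φ N ^ n := by
  induction n with
  | zero => rw [pow_zero, pow_zero, fc_one]
  | succ n ih => rw [pow_succ, pow_succ, fc_mul hN, ih]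

theorem fc_one_add_X : fc (1 + PowerSeries.X) N = 1 + N := by
  refine hom_ext fun k f => ?_
  -- The bound `k + 2`, rather than `k + 1`, keeps the term `i = 1` in the sum even for `k = 0`.
  rw [fc_apply hN _ (mono_mem_degLT (show k < k + 2 by omega) f), Finset.sum_range_succ',
    Finset.sum_range_succ']
  simp [PowerSeries.coeff_one, PowerSeries.coeff_X, add_comm]

theorem fc_mul_fc_inv {φ : PowerSeries ℂ} (hφ : PowerSeries.constantCoeff φ ≠ 0) :
    fc φ N * fc φ⁻¹ N = 1 := by
  rw [← fc_mul hN, PowerSeries.mul_inv_cancel _ hφ, fc_one]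

theorem fc_inv_mul_fc {φ : PowerSeries ℂ} (hφ : PowerSeries.constantCoeff φ ≠ 0) :
    fc φ⁻¹ N * fc φ N = 1 := by
  rw [← fc_mul hN, PowerSeries.inv_mul_cancel _ hφ, fc_one]

end

/-! ### Translations and translation invariant operators -/

/-- The translation `(E_ν p)(ω) = p(ω + ν)`. -/
def E (ν : Dual X) : Poly X →L[ℂ] Poly X := fc (PowerSeries.exp ℂ) (D ν)

theorem D_pow_apply_pow (ν : Dual X) (ξ : C_c(X, ℂ)) (i k : ℕ) :
    (D ν ^ i) (Poly.pow k ξ) = ((k.descFactorial i : ℂ) * ν ξ ^ i) • Poly.pow (k - i) ξ := by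
  induction i generalizing k with
  | zero => simp
  | succ i ih =>
    rw [pow_succ, mul_apply_eq_comp]
    rcases k with _ | k
    · simp [D_pow_zero]
    · rw [D_pow_succ, map_smul, ih, smul_smul, Nat.succ_descFactorial_succ,
        Nat.succ_sub_succ_eq_sub]
      congr 1
      push_cast
      ring

theorem pow_mem_degLT (ξ : C_c(X, ℂ)) (k : ℕ) : Poly.pow k ξ ∈ degLT (k + 1) :=
  mono_mem_degLT (Nat.lt_succ_self k) _

/-- Taylor's formula for `exp (D ν)`; on powers `⟨·, ξ⟩ ^ k` it is the binomial theorem. -/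
theorem E_apply_apply (ν : Dual X) (p : Poly X) (ω : Dual X) : E ν p ω = p (ω + ν) := by
  have : (eval ω).comp (E ν) = eval (ω + ν) := functional_ext fun k ξ => by
    simp only [ContinuousLinearMap.comp_apply, eval_apply, pow_apply]
    rw [E, fc_apply (lowersBy_D ν) _ (pow_mem_degLT ξ k), ← eval_apply, map_sum, _root_.add_apply, add_comm (ω ξ) (ν ξ), add_pow]
    refine Finset.sum_congr rfl fun i hi => ?_
    have hi' : i ≤ k := Nat.lt_succ_iff.1 (Finset.mem_range.1 hi)
    rw [D_pow_apply_pow, map_smul, map_smul, eval_apply, pow_apply, PowerSeries.coeff_exp,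
      Nat.descFactorial_eq_factorial_mul_choose]
    have : (i.factorial : ℂ) ≠ 0 := by exact_mod_cast i.factorial_ne_zero
    simp
    field_simp
  exact congrArg (fun T : Poly X →L[ℂ] ℂ => T p) this

theorem E_apply_zero (ω : Dual X) (p : Poly X) : E ω p 0 = p ω := by
  rw [E_apply_apply, zero_add]

theorem E_mul_E (μ ν : Dual X) : E μ * E ν = E (μ + ν) := by
  ext p
  refine Poly.ext fun ω => ?_
  rw [mul_apply_eq_comp, E_apply_apply, E_apply_apply, E_apply_apply, add_assoc]

theorem E_comm (μ ν : Dual X) : E μ * E ν = E ν * E μ := by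
  rw [E_mul_E, E_mul_E, add_comm]

theorem lowersBy_E (ν : Dual X) : LowersBy 0 (E ν) := lowersBy_fc (lowersBy_D ν) _

/-- The operator `T` commutes with all translations. -/
def ShiftInvariant (T : Poly X →L[ℂ] Poly X) : Prop := ∀ ν, T * E ν = E ν * T

/-- The `n`-th term `⟨·, ξ⟩ ^ n / n!` of the formal exponential `exp ⟨·, ξ⟩`. -/
def expTerm (ξ : C_c(X, ℂ)) (n : ℕ) : Poly X := (n.factorial : ℂ)⁻¹ • Poly.pow n ξ

omit [LocallyCompactSpace X] in
theorem pow_eq_smul_expTerm (ξ : C_c(X, ℂ)) (n : ℕ) :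
    Poly.pow n ξ = (n.factorial : ℂ) • expTerm ξ n := by
  rw [expTerm, smul_inv_smul₀ (by exact_mod_cast n.factorial_ne_zero)]

theorem operator_ext_expTerm {T S : Poly X →L[ℂ] Poly X}
    (h : ∀ ξ k, T (expTerm ξ k) = S (expTerm ξ k)) : T = S :=
  operator_ext fun k ξ => by rw [pow_eq_smul_expTerm, map_smul, map_smul, h]

omit [LocallyCompactSpace X] in
theorem expTerm_apply (ξ : C_c(X, ℂ)) (n : ℕ) (ω : Dual X) :
    expTerm ξ n ω = (n.factorial : ℂ)⁻¹ * ω ξ ^ n := by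
  rw [expTerm, smul_apply, pow_apply]

theorem expTerm_mem_degLT (ξ : C_c(X, ℂ)) (n : ℕ) : expTerm ξ n ∈ degLT (n + 1) :=
  Submodule.smul_mem _ _ (pow_mem_degLT ξ n)

/-- The product of a formal power series with scalar coefficients and one with polynomial
coefficients. -/
def conv (τ : PowerSeries ℂ) (v : ℕ → Poly X) (n : ℕ) : Poly X :=
  ∑ x ∈ Finset.HasAntidiagonal.antidiagonal n, PowerSeries.coeff x.1 τ • v x.2

omit [LocallyCompactSpace X] in
theorem conv_apply (τ : PowerSeries ℂ) (v : ℕ → Poly X) (n : ℕ) (ω : Dual X) :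
    conv τ v n ω = PowerSeries.coeff n (τ * PowerSeries.mk fun k => v k ω) := by
  rw [conv, PowerSeries.coeff_mul, ← eval_apply, map_sum]
  simp

omit [LocallyCompactSpace X] in
theorem conv_conv (σ τ : PowerSeries ℂ) (v : ℕ → Poly X) (n : ℕ) :
    conv σ (conv τ v) n = conv (σ * τ) v n := by
  refine ext fun ω => ?_
  rw [conv_apply, conv_apply, mul_assoc]
  congr 2
  ext k
  rw [PowerSeries.coeff_mk, conv_apply]

omit [LocallyCompactSpace X] in
theorem map_conv (T : Poly X →L[ℂ] Poly X) (τ : PowerSeries ℂ) (v : ℕ → Poly X) (n : ℕ) :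
    T (conv τ v n) = conv τ (fun k => T (v k)) n := by
  simp [conv]

/-- Degree `n` part of `exp ⟨ω + ν, ξ⟩ = exp ⟨ν, ξ⟩ exp ⟨ω, ξ⟩`. -/
theorem E_expTerm (ν : Dual X) (ξ : C_c(X, ℂ)) (n : ℕ) :
    E ν (expTerm ξ n) =
      conv (PowerSeries.mk fun k => (k.factorial : ℂ)⁻¹ * ν ξ ^ k) (expTerm ξ) n := by
  refine ext fun ω => ?_
  rw [E_apply_apply, conv_apply, PowerSeries.coeff_mul, expTerm_apply,
    _root_.add_apply, add_comm (ω ξ), Commute.add_pow' (Commute.all _ _),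
    Finset.mul_sum]
  refine Finset.sum_congr rfl fun x hx => ?_
  have hx' := Finset.HasAntidiagonal.mem_antidiagonal.1 hx
  simp only [PowerSeries.coeff_mk, expTerm_apply, nsmul_eq_mul]
  have h1 : (x.1.factorial : ℂ) ≠ 0 := by exact_mod_cast Nat.factorial_ne_zero _
  have h2 : (x.2.factorial : ℂ) ≠ 0 := by exact_mod_cast Nat.factorial_ne_zero _
  have h3 : (n.factorial : ℂ) ≠ 0 := by exact_mod_cast Nat.factorial_ne_zero _
  have h4 : (n.choose x.1 : ℂ) * x.1.factorial * x.2.factorial = n.factorial := by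
    rw [← hx', Nat.choose_symm_add]
    exact_mod_cast Nat.add_choose_mul_factorial_mul_factorial x.1 x.2
  rw [← h4] at h3 ⊢
  have h5 : (n.choose x.1 : ℂ) ≠ 0 := fun h => h3 (by rw [h]; ring)
  field_simp

/-- Shift invariant operators are diagonal on the formal exponentials. -/
theorem ShiftInvariant.apply_expTerm {T : Poly X →L[ℂ] Poly X} (hT : ShiftInvariant T)
    (ξ : C_c(X, ℂ)) (n : ℕ) :
    T (expTerm ξ n) = conv (PowerSeries.mk fun k => T (expTerm ξ k) 0) (expTerm ξ) n := by
  refine ext fun ω => ?_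
  -- The value at `ω` is the value at `0` after translation by `ω`. Moving that translation through
  -- `T` makes the translated exponential supply the factor depending on `ω`.
  rw [← E_apply_zero, ← mul_apply_eq_comp, ← hT ω, mul_apply_eq_comp, E_expTerm, map_conv,
    conv_apply, conv_apply, mul_comm]
  simp only [expTerm_apply]

/-- Both operators are multiplication by scalar power series on the formal exponentials, and these
series commute. -/
theorem ShiftInvariant.comm {T S : Poly X →L[ℂ] Poly X} (hT : ShiftInvariant T)
    (hS : ShiftInvariant S) : T * S = S * T := operator_ext_expTerm fun ξ n => by
  rw [mul_apply_eq_comp, mul_apply_eq_comp, hS.apply_expTerm, map_conv, hT.apply_expTerm ξ n,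
    map_conv]
  simp_rw [funext (hT.apply_expTerm ξ), funext (hS.apply_expTerm ξ)]
  rw [conv_conv, conv_conv, mul_comm]

theorem shiftInvariant_D (μ : Dual X) : ShiftInvariant (D μ) := fun ν => by
  ext p
  obtain ⟨n, hp⟩ := exists_mem_degLT p
  rw [mul_apply_eq_comp, mul_apply_eq_comp, E, fc_apply (lowersBy_D ν) _ hp,
    fc_apply (lowersBy_D ν) _ ((lowersBy_D μ).mono (Nat.zero_le 1) n p hp), map_sum]
  refine Finset.sum_congr rfl fun i _ => ?_
  rw [map_smul, ← mul_apply_eq_comp, ← mul_apply_eq_comp, (show Commute (D μ) (D ν) from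
    D_comm μ ν).pow_right i]

/-- On powers the convolution formula involves no higher degree. The vanishing of the higher
coefficients passes to all symmetric functions by density, applied to each value of each coefficient
as a continuous functional. -/
theorem ShiftInvariant.lowersBy_zero {T : Poly X →L[ℂ] Poly X} (hT : ShiftInvariant T) :
    LowersBy 0 T := lowersBy_of_mono fun k f => mem_degLT.2 fun i hi => by
  ext x
  have : (((dirac x).comp (SymCc X i).subtypeL).comp (coeff i)).comp (T.comp (monoCLM k)) = 0 := by
    have h0 : (0 : SymCc X k →L[ℂ] ℂ) = (0 : Poly X →L[ℂ] ℂ).comp (monoCLM k) := by ext; simp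
    rw [h0]
    refine symCc_ext fun ξ => ?_
    have h1 : T (Poly.pow k ξ) ∈ degLT (k + 1) := by
      rw [pow_eq_smul_expTerm, map_smul, hT.apply_expTerm, conv]
      refine Submodule.smul_mem _ _ (Submodule.sum_mem _ fun x hx => Submodule.smul_mem _ _
        (degLT_mono ?_ (expTerm_mem_degLT ξ _)))
      have := Finset.HasAntidiagonal.mem_antidiagonal.1 hx
      omega
    have h2 := mem_degLT.1 h1 i hi
    simp only [ContinuousLinearMap.comp_apply, monoCLM_apply]
    rw [← Poly.pow, h2]
    simp
  exact congrArg (fun T : SymCc X k →L[ℂ] ℂ => T f) this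

end Poly

end Lowering

/-! ### Logarithms of unipotent operators -/

section BinomialPolynomials

/-- The polynomial `t ↦ t (t - 1) ⋯ (t - i + 1) / i!`. -/
def binomPoly (i : ℕ) : Polynomial ℂ :=
  Polynomial.C (i.factorial : ℂ)⁻¹ * descPochhammer ℂ i

theorem binomPoly_eval (i n : ℕ) : (binomPoly i).eval (n : ℂ) = n.choose i := by
  rw [binomPoly, Polynomial.eval_mul, Polynomial.eval_C, descPochhammer_eval_eq_descFactorial,
    Nat.descFactorial_eq_factorial_mul_choose]
  push_cast
  rw [inv_mul_cancel_left₀ (by exact_mod_cast i.factorial_ne_zero)]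

theorem binomPoly_succ (i : ℕ) : binomPoly (i + 1) =
    Polynomial.C ((i + 1 : ℂ)⁻¹) * (binomPoly i * (Polynomial.X - Polynomial.C (i : ℂ))) := by
  rw [binomPoly, binomPoly, descPochhammer_succ_right, Nat.factorial_succ]
  push_cast
  rw [mul_inv, Polynomial.C_mul, Polynomial.C_eq_natCast]
  ring

theorem binomPoly_coeff_zero (i : ℕ) : (binomPoly i).coeff 0 = if i = 0 then 1 else 0 := by
  rw [Polynomial.coeff_zero_eq_eval_zero]
  have := binomPoly_eval i 0
  rw [Nat.cast_zero] at this
  rw [this]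
  rcases i with _ | i <;> simp

/-- The coefficients of `log (1 + t)`. -/
def logCoeff (i : ℕ) : ℂ := (-1) ^ (i + 1) / (i : ℂ)

@[simp] theorem logCoeff_zero : logCoeff 0 = 0 := by simp [logCoeff]

/-- The derivative at `t = 0` of `(1 + N) ^ t = ∑ binom(t, i) N ^ i` is `log (1 + N)`. Logarithms
can therefore be read off as linear coefficients of polynomials known only at natural numbers. -/
theorem binomPoly_coeff_one (i : ℕ) : (binomPoly i).coeff 1 = logCoeff i := by
  induction i with
  | zero => simp [binomPoly, Polynomial.coeff_one]
  | succ i ih =>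
    rw [binomPoly_succ, Polynomial.coeff_C_mul, mul_sub, Polynomial.coeff_sub,
      Polynomial.coeff_mul_X, Polynomial.coeff_mul_C, binomPoly_coeff_zero, ih, logCoeff, logCoeff]
    have h : (i + 1 : ℂ) ≠ 0 := by exact_mod_cast i.succ_ne_zero
    rcases i with _ | i
    · simp
    · have h' : (i + 1 : ℂ) ≠ 0 := by exact_mod_cast i.succ_ne_zero
      simp only [Nat.add_eq_zero_iff, one_ne_zero, and_false, if_false]
      push_cast
      field_simp
      ring

theorem coeff_one_eq_zero_of_eval {p : Polynomial ℂ} {c : ℂ} (h : ∀ n : ℕ, p.eval (n : ℂ) = c) :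
    p.coeff 1 = 0 := by
  have : p = Polynomial.C c := Polynomial.eq_of_infinite_eval_eq _ _
    ((Set.infinite_range_of_injective (Nat.cast_injective (R := ℂ))).mono (by
      rintro _ ⟨n, rfl⟩
      simp [h]))
  rw [this, Polynomial.coeff_C_of_ne_zero one_ne_zero]

end BinomialPolynomials

section Log

variable {X : Type*} [TopologicalSpace X] [T2Space X] [LocallyCompactSpace X]

namespace Poly

/-- On polynomials of degree less than `n` the logarithmic series stops before `i = n`, and
`logCoeff 0 = 0` allows the sum to start at `0`. -/
theorem isLog_iff {P Q : Poly X →L[ℂ] Poly X} (hP : LowersBy 1 (P - 1)) :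
    IsLog P Q ↔ ∀ (n : ℕ) (p : Poly X), p ∈ degLT n →
      Q p = ∑ i ∈ Finset.range n, logCoeff i • ((P - 1) ^ i) p := by
  have key : ∀ (n : ℕ) (p : Poly X), p ∈ degLT n → ∀ N, n ≤ N →
      ∑ i ∈ Finset.Icc 1 N, ((-1 : ℂ) ^ (i + 1) / (i : ℂ)) • ((P - 1) ^ i) p =
        ∑ i ∈ Finset.range n, logCoeff i • ((P - 1) ^ i) p := by
    intro n p hp N hN
    have h1 : Finset.Icc 1 N ⊆ Finset.range (N + 1) := fun i hi => by
      simp at hi ⊢; omega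
    refine (Finset.sum_subset h1 fun i hi hi' => ?_).trans
      (Finset.sum_subset (Finset.range_mono (by omega)) fun i _ hi => ?_).symm
    · have : i = 0 := by simp at hi hi'; omega
      simp [this]
    · rw [(hP.pow_one i).apply_eq_zero hp (by simpa using hi), smul_zero]
  constructor
  · intro h n p hp
    obtain ⟨N, hN⟩ := Filter.eventually_atTop.1 (h p)
    rw [hN (max N n) (le_max_left _ _), key n p hp _ (le_max_right _ _)]
  · intro h p
    obtain ⟨n, hp⟩ := exists_mem_degLT p
    filter_upwards [Filter.eventually_ge_atTop n] with N hN
    rw [key n p hp N hN, h n p hp]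

omit [LocallyCompactSpace X] in
theorem one_add_pow (N : Poly X →L[ℂ] Poly X) (n : ℕ) :
    (1 + N) ^ n = ∑ i ∈ Finset.range (n + 1), (n.choose i : ℂ) • N ^ i := by
  rw [add_comm, (Commute.one_right N).add_pow]
  refine Finset.sum_congr rfl fun i _ => ?_
  rw [one_pow, mul_one, Nat.cast_smul_eq_nsmul, nsmul_eq_mul, Nat.cast_comm]

omit [LocallyCompactSpace X] in
/-- If `F ((1 + N)^n T (1 + N')^n)` does not depend on `n`, then `F (log (1 + N) T + T log (1 + N'))`
vanishes. -/
theorem sum_logCoeff_eq_zero {N N' T : Poly X →L[ℂ] Poly X}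
    (F : (Poly X →L[ℂ] Poly X) →ₗ[ℂ] ℂ) {M : ℕ} {c : ℂ} (hM : 0 < M)
    (h0 : ∀ i j, M ≤ i ∨ M ≤ j → F (N ^ i * T * N' ^ j) = 0)
    (hc : ∀ n : ℕ, F ((1 + N) ^ n * T * (1 + N') ^ n) = c) :
    ∑ i ∈ Finset.range M, logCoeff i * F (N ^ i * T) +
      ∑ j ∈ Finset.range M, logCoeff j * F (T * N' ^ j) = 0 := by
  -- This polynomial interpolates `n ↦ F ((1 + N) ^ n T (1 + N') ^ n)`. It is constant on the
  -- natural numbers, so its linear coefficient vanishes; by the product rule that coefficient has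
  -- one part for each outer factor.
  let p : Polynomial ℂ := ∑ i ∈ Finset.range M, ∑ j ∈ Finset.range M,
    binomPoly i * binomPoly j * Polynomial.C (F (N ^ i * T * N' ^ j))
  have hp : ∀ n : ℕ, p.eval (n : ℂ) = c := by
    intro n
    rw [← hc n, one_add_pow, one_add_pow]
    simp only [p, Polynomial.eval_finsetSum, Polynomial.eval_mul, binomPoly_eval,
      Polynomial.eval_C, Finset.sum_mul, Finset.mul_sum, map_sum, smul_mul_assoc, mul_smul_comm,
      map_smul, smul_eq_mul]
    rw [Finset.sum_comm]
    have h1 : ∀ (G : ℕ → ℂ), (∀ i, M ≤ i → G i = 0) → (∀ i, n < i → G i = 0) →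
        ∑ i ∈ Finset.range M, G i = ∑ i ∈ Finset.range (n + 1), G i := by
      intro G hG hG'
      rcases le_total M (n + 1) with h | h
      · exact Finset.sum_subset (Finset.range_mono h) fun i _ hi => hG i (by simpa using hi)
      · exact (Finset.sum_subset (Finset.range_mono h) fun i _ hi =>
          hG' i (by simpa using hi)).symm
    rw [h1]
    · refine Finset.sum_congr rfl fun j _ => ?_
      rw [h1]
      · exact Finset.sum_congr rfl fun i _ => by ring
      · intro i hi
        rw [h0 i j (Or.inl hi), mul_zero]
      · intro i hi
        rw [Nat.choose_eq_zero_of_lt hi]; simp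
    · intro j hj
      exact Finset.sum_eq_zero fun i _ => by rw [h0 i j (Or.inr hj), mul_zero]
    · intro j hj
      exact Finset.sum_eq_zero fun i _ => by rw [Nat.choose_eq_zero_of_lt hj]; simp
  have h1 := coeff_one_eq_zero_of_eval hp
  simp only [p, Polynomial.finsetSum_coeff, Polynomial.coeff_mul_C] at h1
  simp only [Polynomial.mul_coeff_one, binomPoly_coeff_zero, binomPoly_coeff_one, add_mul, Finset.sum_add_distrib] at h1
  have h2 : ∀ i ∈ Finset.range M, ∑ j ∈ Finset.range M, logCoeff i * (if j = 0 then 1 else 0) *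
      F (N ^ i * T * N' ^ j) = logCoeff i * F (N ^ i * T) := by
    intro i _
    rw [Finset.sum_eq_single_of_mem 0 (Finset.mem_range.2 hM) fun j _ hj => by simp [hj]]
    simp
  have h3 : ∑ i ∈ Finset.range M, ∑ j ∈ Finset.range M, (if i = 0 then 1 else 0) * logCoeff j *
      F (N ^ i * T * N' ^ j) = ∑ j ∈ Finset.range M, logCoeff j * F (T * N' ^ j) := by
    rw [Finset.sum_eq_single_of_mem 0 (Finset.mem_range.2 hM) fun i _ hi => by simp [hi]]
    simp
  rw [Finset.sum_congr rfl h2, h3] at h1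
  linear_combination h1

theorem IsLog.lowersBy_one {P Q : Poly X →L[ℂ] Poly X} (hP : LowersBy 1 (P - 1))
    (hQ : IsLog P Q) : LowersBy 1 Q := fun n p hp => by
  rw [(isLog_iff hP).1 hQ _ p hp]
  refine Submodule.sum_mem _ fun i _ => ?_
  rcases i with _ | i
  · simp
  · exact Submodule.smul_mem _ _ (((hP.pow_one (i + 1)).mono (by omega)) n p hp)

/-- `log P⁻¹ = - log P`. -/
theorem IsLog.inv {P P' Q : Poly X →L[ℂ] Poly X} (hP : LowersBy 1 (P - 1))
    (hP' : LowersBy 1 (P' - 1)) (h : P * P' = 1) (h' : P' * P = 1) (hQ : IsLog P Q) :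
    IsLog P' (-Q) := by
  refine (isLog_iff hP').2 fun n p hp => ext fun ω => ?_
  rcases n with _ | n
  · simp [degLT_zero hp]
  have hcomm : Commute P P' := by rw [Commute, SemiconjBy, h, h']
  let F : (Poly X →L[ℂ] Poly X) →ₗ[ℂ] ℂ :=
    { toFun := fun R => R p ω
      map_add' := fun _ _ => rfl
      map_smul' := fun _ _ => rfl }
  -- With `T = 1` the product `P ^ m P' ^ m` is the identity, hence constant in `m`.
  have h1 := sum_logCoeff_eq_zero (N := P - 1) (N' := P' - 1) (T := 1) F (M := n + 1) (c := p ω)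
    n.succ_pos (by
      intro i j hij
      have : LowersBy (i + j) ((P - 1) ^ i * 1 * (P' - 1) ^ j) := by
        rw [mul_one]
        exact (hP.pow_one i).mul (hP'.pow_one j)
      change (((P - 1) ^ i * 1 * (P' - 1) ^ j) p) ω = 0
      rw [this.apply_eq_zero hp (by omega)]; rfl) (by
      intro m
      rw [add_sub_cancel, add_sub_cancel, mul_one, ← hcomm.mul_pow, h, one_pow]
      rfl)
  have h2 : Q p ω = ∑ i ∈ Finset.range (n + 1), logCoeff i * F ((P - 1) ^ i * 1) := by
    rw [(isLog_iff hP).1 hQ _ p hp, ← eval_apply, map_sum]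
    refine Finset.sum_congr rfl fun i _ => ?_
    rw [map_smul, mul_one]
    rfl
  have h3 : (∑ i ∈ Finset.range (n + 1), logCoeff i • ((P' - 1) ^ i) p) ω =
      ∑ i ∈ Finset.range (n + 1), logCoeff i * F (1 * (P' - 1) ^ i) := by
    rw [← eval_apply, map_sum]
    refine Finset.sum_congr rfl fun i _ => ?_
    rw [map_smul, one_mul]
    rfl
  rw [h3, ← sub_eq_zero]
  change - (Q p ω) - _ = 0
  rw [h2]
  linear_combination -h1

/-- If conjugation by all powers of `P` preserves shift invariance of `T`, then the commutator of
`log P` with `T` is shift invariant. -/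
theorem IsLog.shiftInvariant_commutator {P P' Q T : Poly X →L[ℂ] Poly X}
    (hP : LowersBy 1 (P - 1)) (hP' : LowersBy 1 (P' - 1)) (h : P * P' = 1) (h' : P' * P = 1)
    (hQ : IsLog P Q) (hT : LowersBy 0 T) (hc : ∀ n : ℕ, ShiftInvariant (P ^ n * T * P' ^ n)) :
    ShiftInvariant (Q * T - T * Q) := fun μ => by
  ext p
  refine ext fun ω => ?_
  obtain ⟨n, hp⟩ := exists_mem_degLT p
  replace hp := degLT_mono n.le_succ hp
  -- `F` measures the failure of `R` to commute with `E μ` at `p` and `ω`; it vanishes on all `P ^ m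
  -- T P' ^ m`.
  let F : (Poly X →L[ℂ] Poly X) →ₗ[ℂ] ℂ :=
    { toFun := fun R => R (E μ p) ω - E μ (R p) ω
      map_add' := fun R S => by simp; ring
      map_smul' := fun c R => by simp; ring }
  have hE := lowersBy_E μ
  have hEp : E μ p ∈ degLT n.succ := hE _ p hp
  have h1 := sum_logCoeff_eq_zero (N := P - 1) (N' := P' - 1) (T := T) F (M := n + 1) (c := 0)
    n.succ_pos (by
      intro i j hij
      have : LowersBy (i + j) ((P - 1) ^ i * T * (P' - 1) ^ j) := by
        simpa using ((hP.pow_one i).mul hT).mul (hP'.pow_one j)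
      change (((P - 1) ^ i * T * (P' - 1) ^ j) (E μ p)) ω -
        E μ (((P - 1) ^ i * T * (P' - 1) ^ j) p) ω = 0
      rw [this.apply_eq_zero hp (by omega), this.apply_eq_zero hEp (by omega)]
      simp) (by
      intro m
      rw [add_sub_cancel, add_sub_cancel]
      change (P ^ m * T * P' ^ m) (E μ p) ω - E μ ((P ^ m * T * P' ^ m) p) ω = 0
      rw [← mul_apply_eq_comp, ← mul_apply_eq_comp, hc m μ, sub_self])
  have hQ' := (isLog_iff hP').1 (IsLog.inv hP hP' h h' hQ)
  have hQ1 := (isLog_iff hP).1 hQ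
  have h2 : F (Q * T) = ∑ i ∈ Finset.range (n + 1), logCoeff i * F ((P - 1) ^ i * T) := by
    change (Q (T (E μ p))) ω - E μ (Q (T p)) ω = _
    rw [hQ1 _ _ (hT _ _ hEp), hQ1 _ _ (hT _ _ hp), E_apply_apply, ← eval_apply, ← eval_apply,
      map_sum, map_sum, ← Finset.sum_sub_distrib]
    refine Finset.sum_congr rfl fun i _ => ?_
    simp [F, E_apply_apply, mul_sub]
  have h3 : F (T * Q) = - ∑ i ∈ Finset.range (n + 1), logCoeff i * F (T * (P' - 1) ^ i) := by
    rw [show T * Q = -(T * (-Q)) by rw [mul_neg, neg_neg], map_neg]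
    congr 1
    change T ((-Q) (E μ p)) ω - E μ (T ((-Q) p)) ω = _
    rw [hQ' _ _ hEp, hQ' _ _ hp, E_apply_apply, ← eval_apply, ← eval_apply, map_sum, map_sum,
      map_sum, map_sum, ← Finset.sum_sub_distrib]
    refine Finset.sum_congr rfl fun i _ => ?_
    simp [F, E_apply_apply, mul_sub]
  have h4 : F (Q * T - T * Q) = 0 := by
    rw [map_sub, h2, h3]
    linear_combination h1
  exact sub_eq_zero.1 h4

/-- `P ^ m p` has two expansions polynomial in `m`: the binomial one in powers of `P - 1`, and `exp
(m Q) p`. Comparing their linear coefficients gives `log P = Q`. -/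
theorem exists_log {Q : Poly X →L[ℂ] Poly X} (hQ : LowersBy 1 Q) :
    IsLog (fc (PowerSeries.exp ℂ) Q) Q := by
  set P := fc (PowerSeries.exp ℂ) Q with hPdef
  have hP : LowersBy 1 (P - 1) := lowersBy_fc_sub_one hQ (by simp)
  refine (isLog_iff hP).2 fun n p hp => ext fun ω => ?_
  -- Enlarging the bound to `n + 2` ensures that the term `j = 1` of the exponential expansion is
  -- present for every `n`.
  replace hp' := degLT_mono (show n ≤ n + 2 by omega) hp
  let q : Polynomial ℂ := ∑ i ∈ Finset.range n, binomPoly i * Polynomial.C (((P - 1) ^ i) p ω)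
    - ∑ j ∈ Finset.range (n + 2), Polynomial.C ((j.factorial : ℂ)⁻¹ * (Q ^ j) p ω) *
      Polynomial.X ^ j
  have hq : ∀ m : ℕ, q.eval (m : ℂ) = 0 := by
    intro m
    simp only [q, Polynomial.eval_sub, Polynomial.eval_finsetSum, Polynomial.eval_mul,
      binomPoly_eval, Polynomial.eval_C, Polynomial.eval_pow, Polynomial.eval_X]
    have h1 : (P ^ m) p = ∑ j ∈ Finset.range (n + 2),
        ((j.factorial : ℂ)⁻¹ * (m : ℂ) ^ j) • (Q ^ j) p := by
      rw [hPdef, ← fc_pow hQ, PowerSeries.exp_pow_eq_rescale_exp, fc_apply hQ _ hp']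
      refine Finset.sum_congr rfl fun j _ => ?_
      simp [PowerSeries.coeff_rescale, mul_comm]
    have h2 : (P ^ m) p = ∑ i ∈ Finset.range n, (m.choose i : ℂ) • ((P - 1) ^ i) p := by
      have h3 : P ^ m = (1 + (P - 1)) ^ m := by rw [add_sub_cancel]
      rw [h3, one_add_pow, sum_apply]
      simp only [_root_.smul_apply]
      rcases le_total n (m + 1) with h | h
      · exact (Finset.sum_subset (Finset.range_mono h) fun i _ hi => by
          rw [(hP.pow_one i).apply_eq_zero hp (by simpa using hi), smul_zero]).symm
      · exact Finset.sum_subset (Finset.range_mono h) fun i _ hi => by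
          rw [Nat.choose_eq_zero_of_lt (by simpa using hi)]; simp
    have h4 := congrArg (eval ω) (h1.symm.trans h2)
    simp only [map_sum, map_smul, eval_apply, smul_eq_mul] at h4
    rw [← h4, sub_eq_zero]
    exact Finset.sum_congr rfl fun j _ => by ring
  have h1 := coeff_one_eq_zero_of_eval hq
  simp only [q, Polynomial.coeff_sub, Polynomial.finsetSum_coeff, Polynomial.coeff_mul_C,
    binomPoly_coeff_one, Polynomial.coeff_C_mul, Polynomial.coeff_X_pow] at h1
  rw [Finset.sum_eq_single_of_mem 1 (s := Finset.range (n + 2)) (by simp)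
    fun j _ hj => by simp [hj.symm]] at h1
  rw [← eval_apply _ (∑ i ∈ _, _), map_sum]
  simp only [map_smul, eval_apply, smul_eq_mul]
  rw [sub_eq_zero.1 h1]
  simp

end Poly

end Log

/-! ### The exponential of a formal power series without constant term -/

section ExpSubst

theorem coeff_pow_eq_zero_of_lt {a : PowerSeries ℂ} (ha : PowerSeries.constantCoeff a = 0)
    {n d : ℕ} (h : n < d) : PowerSeries.coeff n (a ^ d) = 0 :=
  PowerSeries.X_pow_dvd_iff.1 (pow_dvd_pow_of_dvd (PowerSeries.X_dvd_iff.2 ha) d) n h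

/-- `a ^ d` starts in order `d`, so only finitely many powers contribute to a given coefficient. -/
theorem coeff_exp_subst {a : PowerSeries ℂ} (ha : PowerSeries.constantCoeff a = 0) {n M : ℕ}
    (h : n < M) : PowerSeries.coeff n ((PowerSeries.exp ℂ).subst a) =
      ∑ d ∈ Finset.range M, (d.factorial : ℂ)⁻¹ * PowerSeries.coeff n (a ^ d) := by
  rw [PowerSeries.coeff_subst' (PowerSeries.HasSubst.of_constantCoeff_zero' ha),
    finsum_eq_sum_of_support_subset (s := Finset.range M)]
  · simp [PowerSeries.coeff_exp]
  · intro d hd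
    by_contra hd'
    refine hd ?_
    simp only [Finset.coe_range, Set.mem_Iio, not_lt] at hd'
    simp only [coeff_pow_eq_zero_of_lt ha (h.trans_le hd'), smul_zero]

theorem exp_subst_add {a b : PowerSeries ℂ} (ha : PowerSeries.constantCoeff a = 0)
    (hb : PowerSeries.constantCoeff b = 0) :
    (PowerSeries.exp ℂ).subst (a + b) =
      (PowerSeries.exp ℂ).subst a * (PowerSeries.exp ℂ).subst b := by
  ext n
  have h1 : PowerSeries.coeff n ((PowerSeries.exp ℂ).subst a * (PowerSeries.exp ℂ).subst b) =
      ∑ i ∈ Finset.range (n + 1), ∑ j ∈ Finset.range (n + 1),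
        ((i.factorial : ℂ)⁻¹ * (j.factorial : ℂ)⁻¹) * PowerSeries.coeff n (a ^ i * b ^ j) := by
    simp only [PowerSeries.coeff_mul, Finset.mul_sum]
    have : ∀ x ∈ Finset.HasAntidiagonal.antidiagonal n,
        PowerSeries.coeff x.1 ((PowerSeries.exp ℂ).subst a) *
          PowerSeries.coeff x.2 ((PowerSeries.exp ℂ).subst b) =
        ∑ i ∈ Finset.range (n + 1), ∑ j ∈ Finset.range (n + 1),
          ((i.factorial : ℂ)⁻¹ * (j.factorial : ℂ)⁻¹) *
            (PowerSeries.coeff x.1 (a ^ i) * PowerSeries.coeff x.2 (b ^ j)) := by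
      intro x hx
      have hx' := Finset.HasAntidiagonal.mem_antidiagonal.1 hx
      rw [coeff_exp_subst ha (show x.1 < n + 1 by omega),
        coeff_exp_subst hb (show x.2 < n + 1 by omega), Finset.sum_mul_sum]
      exact Finset.sum_congr rfl fun i _ => Finset.sum_congr rfl fun j _ => by ring
    rw [Finset.sum_congr rfl this, Finset.sum_comm]
    exact Finset.sum_congr rfl fun i _ => Finset.sum_comm
  have hab : PowerSeries.constantCoeff (a + b) = 0 := by rw [map_add, ha, hb, add_zero]
  rw [h1, coeff_exp_subst hab (Nat.lt_succ_self n), sum_range_prod_eq_sum_antidiagonal]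
  · refine Finset.sum_congr rfl fun m _ => ?_
    rw [(Commute.all a b).add_pow', map_sum, Finset.mul_sum]
    refine Finset.sum_congr rfl fun x hx => ?_
    have hx' := Finset.HasAntidiagonal.mem_antidiagonal.1 hx
    rw [map_nsmul, nsmul_eq_mul, ← mul_assoc]
    congr 1
    have h1 : (x.1.factorial : ℂ) ≠ 0 := by exact_mod_cast Nat.factorial_ne_zero _
    have h2 : (x.2.factorial : ℂ) ≠ 0 := by exact_mod_cast Nat.factorial_ne_zero _
    have h3 : (m.factorial : ℂ) ≠ 0 := by exact_mod_cast Nat.factorial_ne_zero _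
    have h4 : (m.choose x.1 : ℂ) * x.1.factorial * x.2.factorial = m.factorial := by
      rw [← hx', Nat.choose_symm_add]
      exact_mod_cast Nat.add_choose_mul_factorial_mul_factorial x.1 x.2
    field_simp
    rw [← h4]
  · intro i j hij
    have : PowerSeries.coeff n (a ^ i * b ^ j) = 0 := by
      have h : PowerSeries.X ^ (i + j) ∣ a ^ i * b ^ j := by
        rw [pow_add]
        exact mul_dvd_mul (pow_dvd_pow_of_dvd (PowerSeries.X_dvd_iff.2 ha) i)
          (pow_dvd_pow_of_dvd (PowerSeries.X_dvd_iff.2 hb) j)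
      exact PowerSeries.X_pow_dvd_iff.1 h n hij
    rw [this, mul_zero]

end ExpSubst

/-! ### Commutators with translations and the form of the Sheffer Lie algebra -/

section Representation

variable {X : Type*} [TopologicalSpace X] [T2Space X] [LocallyCompactSpace X]

namespace Poly

/-- Every continuous functional of the derivative of `q` in the direction `ν` is given by pairing
`ν` with a compactly supported function depending continuously on `q`. -/
theorem exists_pairing_D (l : Poly X →L[ℂ] ℂ) :
    ∃ b : Poly X →L[ℂ] C_c(X, ℂ), ∀ ν q, l (D ν q) = ν (b q) := by
  -- On a power, `D ν` produces `(k + 1) ν ξ`; partial pairing leaves `ξ` itself for `ν` to act on.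
  -- The functional is extended by symmetrization to all functions before it is paired.
  obtain ⟨b, hb⟩ := exists_lift (X := X) (G := C_c(X, ℂ)) fun k => match k with
    | 0 => 0
    | k + 1 => (k + 1 : ℂ) • (partialPairing ((l.comp (monoCLM k)).comp (symCLM k))).comp
        (SymCc X (k + 1)).subtypeL
  refine ⟨b, fun ν q => ?_⟩
  have : l.comp (D ν) = ν.comp b := functional_ext fun k ξ => by
    rcases k with _ | k
    · rw [ContinuousLinearMap.comp_apply, D_pow_zero, ContinuousLinearMap.comp_apply, Poly.pow, hb]
      simp
    · simp only [ContinuousLinearMap.comp_apply, D_pow_succ, map_smul]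
      simp only [Poly.pow, hb]
      simp only [_root_.smul_apply, ContinuousLinearMap.comp_apply, Submodule.subtypeL_apply,
        partialPairing_powTensor, symCLM_coe, map_smul, monoCLM_apply, smul_eq_mul]
      ring
  exact congrArg (fun T : Poly X →L[ℂ] ℂ => T q) this

/-- Conjugation by an operator `P` for which `P exp ⟨·, ξ⟩` is, up to factors, invariant under
translations, preserves shift invariance. -/
theorem shiftInvariant_conj {P P' T : Poly X →L[ℂ] Poly X} (h : P * P' = 1) (h' : P' * P = 1)
    (hP : ∀ ν ξ, ∃ σ, ∀ n, E ν (P (expTerm ξ n)) = conv σ (fun k => P (expTerm ξ k)) n)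
    (hT : ShiftInvariant T) : ShiftInvariant (P * T * P') := fun ν => by
  -- On `P exp ⟨·, ξ⟩` the translation acts by a scalar series `σ`, and on `exp ⟨·, ξ⟩` the operator
  -- `T` acts by a scalar series `τ`. Both sides are `σ τ` times `P exp ⟨·, ξ⟩`.
  have key : P * T * P' * E ν * P = E ν * P * T := operator_ext_expTerm fun ξ n => by
    obtain ⟨σ, hσ⟩ := hP ν ξ
    obtain ⟨τ, hτ⟩ : ∃ τ, ∀ n, T (expTerm ξ n) = conv τ (expTerm ξ) n := ⟨_, hT.apply_expTerm ξ⟩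
    simp only [mul_apply_eq_comp]
    rw [hσ, map_conv, map_conv, map_conv, hτ n, map_conv, map_conv]
    simp only [hσ]
    have h1 : ∀ k, P' (P (expTerm ξ k)) = expTerm ξ k := fun k => by
      rw [← mul_apply_eq_comp, h']; rfl
    simp only [h1, hτ, map_conv]
    rw [conv_conv, conv_conv, mul_comm]
  calc P * T * P' * E ν = P * T * P' * E ν * P * P' := by rw [mul_assoc _ P, h, mul_one]
    _ = E ν * (P * T * P') := by rw [key]; simp only [mul_assoc]

theorem IsSheffer.lowersBy {P : Poly X →L[ℂ] Poly X} (hP : IsSheffer P) : LowersBy 1 (P - 1) := by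
  obtain ⟨⟨M, hM⟩, -⟩ := hP
  refine lowersBy_of_mono fun k f => ?_
  rw [_root_.sub_apply, one_apply_eq_self, hM, add_sub_cancel_left]
  exact Submodule.sum_mem _ fun i hi => mono_mem_degLT (by
    have := Finset.mem_range.1 hi
    omega) _

omit [LocallyCompactSpace X] in
theorem coeff_genFun (P : Poly X →L[ℂ] Poly X) (ω : Dual X) (ξ : C_c(X, ℂ)) (n : ℕ) :
    PowerSeries.coeff n (genFun P ω ξ) = P (expTerm ξ n) ω := by
  rw [genFun, PowerSeries.coeff_mk, expTerm, map_smul, smul_apply, Poly.pow]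

/-- The generating function depends on `ω` only through `exp ⟨ω, B(ξ)⟩`, so translation by `ν`
contributes the factor `exp ⟨ν, B(ξ)⟩`, which is free of `ω`. -/
theorem IsSheffer.E_apply {P : Poly X →L[ℂ] Poly X} (hP : IsSheffer P) (ν : Dual X)
    (ξ : C_c(X, ℂ)) :
    ∃ σ, ∀ n, E ν (P (expTerm ξ n)) = conv σ (fun k => P (expTerm ξ k)) n := by
  obtain ⟨-, A, B, -, hB0, -, hG⟩ := hP
  have hc : ∀ ω : Dual X, PowerSeries.constantCoeff
      (PowerSeries.mk fun k => ω (B k (powTensor ξ k))) = 0 := fun ω => by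
    rw [← PowerSeries.coeff_zero_eq_constantCoeff_apply, PowerSeries.coeff_mk, hB0, map_zero]
  refine ⟨(PowerSeries.exp ℂ).subst (PowerSeries.mk fun k => ν (B k (powTensor ξ k))), fun n =>
    ext fun ω => ?_⟩
  rw [E_apply_apply, conv_apply, ← coeff_genFun, hG]
  have h1 : (PowerSeries.mk fun k => (ω + ν) (B k (powTensor ξ k))) =
      (PowerSeries.mk fun k => ν (B k (powTensor ξ k))) +
        PowerSeries.mk fun k => ω (B k (powTensor ξ k)) := by
    ext k
    simp [add_comm]
  have h2 : (PowerSeries.mk fun k => P (expTerm ξ k) ω) = genFun P ω ξ := by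
    ext k
    rw [coeff_genFun, PowerSeries.coeff_mk]
  rw [h1, exp_subst_add (hc ν) (hc ω), h2, hG, mul_assoc]

/-- The logarithm of a Sheffer operator normalizes the shift invariant operators. -/
theorem IsSheffer.commutator_log {P Q T : Poly X →L[ℂ] Poly X} (hP : IsSheffer P)
    (hQ : IsLog P Q) (hT : ShiftInvariant T) : ShiftInvariant (Q * T - T * Q) := by
  have hN := IsSheffer.lowersBy hP
  have hφ : PowerSeries.constantCoeff (1 + PowerSeries.X : PowerSeries ℂ) ≠ 0 := by simp
  have hP1 : fc (1 + PowerSeries.X) (P - 1) = P := by rw [fc_one_add_X hN, add_sub_cancel]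
  have h1 := fc_mul_fc_inv hN hφ
  have h2 := fc_inv_mul_fc hN hφ
  rw [hP1] at h1 h2
  refine IsLog.shiftInvariant_commutator hN (lowersBy_fc_sub_one hN ?_) h1 h2 hQ
    hT.lowersBy_zero fun n => ?_
  · rw [PowerSeries.coeff_zero_eq_constantCoeff_apply, PowerSeries.constantCoeff_inv]
    simp
  · induction n with
    | zero => simpa using hT
    | succ n ih =>
      rw [pow_succ', pow_succ]
      have := shiftInvariant_conj h1 h2 (IsSheffer.E_apply hP) ih
      simpa only [mul_assoc] using this

/-- An operator of the form `λ(E_ω p) + ⟨ω, b(E_ω p)⟩`. -/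
def IsRep (Q : Poly X →L[ℂ] Poly X) (l : Poly X →L[ℂ] ℂ) (b : Poly X →L[ℂ] C_c(X, ℂ)) : Prop :=
  (∀ p ∈ degLT 1, l p = 0) ∧ (∀ p ∈ degLT 2, b p = 0) ∧
    ∀ p ω, Q p ω = l (E ω p) + ω (b (E ω p))

omit [LocallyCompactSpace X] in
theorem eq_zero_of_dual {f : C_c(X, ℂ)} (h : ∀ ν : Dual X, ν f = 0) : f = 0 := by
  ext x
  exact h (dirac x)

/-- The commutator `R` of `D ω` with `Q` is shift invariant, hence commutes with `D ω`. Passing `exp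
(D ω)` through `Q` then costs exactly `exp (D ω) R`, and evaluation at `0` gives the formula.
Degrees drop by one under `Q` and by two under `R`, whence the vanishing of `l` and `b` in low
degrees. -/
theorem exists_isRep {Q : Poly X →L[ℂ] Poly X} (hQ : LowersBy 1 Q)
    (hc : ∀ T, ShiftInvariant T → ShiftInvariant (Q * T - T * Q)) : ∃ l b, IsRep Q l b := by
  obtain ⟨b₁, hb₁⟩ := exists_pairing_D (X := X) (eval 0)
  obtain ⟨b₂, hb₂⟩ := exists_pairing_D ((eval 0).comp Q)
  have hR : ∀ ν q, ((D ν * Q - Q * D ν : Poly X →L[ℂ] Poly X) q) 0 = ν ((b₁.comp Q - b₂) q) := by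
    intro ν q
    rw [_root_.sub_apply, _root_.sub_apply, map_sub, ContinuousLinearMap.comp_apply, ← hb₁, ← hb₂]
    rfl
  have hRlow : ∀ ν, LowersBy 2 (D ν * Q - Q * D ν) := fun ν =>
    ((lowersBy_D ν).mul hQ).sub (hQ.mul (lowersBy_D ν))
  have hRinv : ∀ ν, ShiftInvariant (D ν * Q - Q * D ν) := fun ν => by
    have h := hc _ (shiftInvariant_D ν)
    intro μ
    have h' := h μ
    rw [← neg_sub, neg_mul, mul_neg, h']
  refine ⟨(eval 0).comp Q, b₁.comp Q - b₂, ?_, ?_, ?_⟩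
  · intro p hp
    rw [ContinuousLinearMap.comp_apply, hQ.apply_eq_zero hp le_rfl, map_zero]
  · intro p hp
    refine eq_zero_of_dual fun ν => ?_
    rw [← hR, (hRlow ν).apply_eq_zero hp le_rfl, zero_apply]
  · intro p ω
    rw [← hR, ← mul_apply_eq_comp _ (E ω), hRinv, mul_apply_eq_comp]
    set R := D ω * Q - Q * D ω with hRdef
    have hDR : Commute (D ω) R := (shiftInvariant_D ω).comm (hRinv ω)
    -- The Leibniz rule for a derivation whose value `R` commutes with `D ω`. Division by `(j + 1)!`
    -- turns the factor `j + 1` into the coefficient `1 / j!` of `E ω R`.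
    have hpow : ∀ j : ℕ, D ω ^ (j + 1) * Q = Q * D ω ^ (j + 1) + ((j + 1 : ℕ) : ℂ) •
        (D ω ^ j * R) := by
      have hDQ : D ω * Q = Q * D ω + R := by rw [hRdef]; abel
      intro j
      induction j with
      | zero => simp [hDQ]
      | succ j ih =>
        rw [pow_succ' (D ω) (j + 1), mul_assoc, ih, mul_add, ← mul_assoc, hDQ, add_mul,
          mul_smul_comm, ← mul_assoc (D ω) (D ω ^ j), ← pow_succ', mul_assoc Q, ← pow_succ',
          (hDR.pow_left (j + 1)).eq, add_assoc, Nat.cast_succ (j + 1), add_smul, one_smul]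
        congr 1
        rw [add_comm]
    obtain ⟨n, hp⟩ := exists_mem_degLT p
    replace hp : p ∈ degLT (n + 1) := degLT_mono n.le_succ hp
    have hRlow1 : LowersBy 1 R := (hRlow ω).mono one_le_two
    have hRp : R p ∈ degLT n := hRlow1 n p hp
    have hQp : Q p ∈ degLT (n + 1) := hQ.mono (Nat.zero_le 1) _ p hp
    have key : E ω (Q p) = Q (E ω p) + E ω (R p) := by
      rw [E, fc_apply (lowersBy_D ω) _ hp, fc_apply (lowersBy_D ω) _ hQp,
        fc_apply (lowersBy_D ω) _ hRp, map_sum, Finset.sum_range_succ', Finset.sum_range_succ',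
        add_right_comm, ← Finset.sum_add_distrib]
      congr 1
      · refine Finset.sum_congr rfl fun j _ => ?_
        rw [← mul_apply_eq_comp, hpow, _root_.add_apply, smul_add, map_smul]
        congr 1
        rw [_root_.smul_apply, smul_smul, mul_apply_eq_comp]
        congr 1
        have h1 : (j.factorial : ℂ) ≠ 0 := by exact_mod_cast Nat.factorial_ne_zero _
        have h2 : (j + 1 : ℂ) ≠ 0 := by exact_mod_cast j.succ_ne_zero
        simp only [PowerSeries.coeff_exp, Nat.factorial_succ]
        push_cast
        field_simp
      · simp
    rw [← E_apply_zero, key]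
    rfl

theorem D_smul (t : ℂ) (ν : Dual X) : D (t • ν) = t • D ν := operator_ext fun k ξ => by
  rcases k with _ | k
  · simp [D_pow_zero]
  · simp only [D_pow_succ, _root_.smul_apply, smul_smul, smul_eq_mul]
    congr 1
    ring

theorem apply_smul {n : ℕ} {p : Poly X} (hp : p ∈ degLT n) (t : ℂ) (ω : Dual X) :
    p (t • ω) = ∑ i ∈ Finset.range n, t ^ i * ShefferLie.mono i (coeff i p) ω := by
  conv_lhs => rw [← sum_mono_coeff hp, ← eval_apply, map_sum]
  exact Finset.sum_congr rfl fun i _ => tensorPow_smul t ω _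

section

variable {Q : Poly X →L[ℂ] Poly X} {l : Poly X →L[ℂ] ℂ} {b : Poly X →L[ℂ] C_c(X, ℂ)}

/-- Replace `ω` by `t ω` and count powers of `t` for a monomial of degree `n`. Before `l` at most `n
- 1` derivatives survive; before `b` at most `n - 2`, and the pairing with `ω` adds one. Thus the
degree in `t` is below `n`. -/
theorem IsRep.lowersBy (h : IsRep Q l b) : LowersBy 1 Q := lowersBy_of_mono fun n f => by
  rw [Nat.add_sub_cancel]
  obtain ⟨hl, hb, hQ⟩ := h
  obtain ⟨N, hN⟩ := exists_mem_degLT (Q (ShefferLie.mono n f))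
  refine mem_degLT.2 fun i hi => ?_
  rw [← coeff_mono_self i (coeff i _)]
  have hfn := mono_mem_degLT (Nat.lt_succ_self n) f
  suffices h : ShefferLie.mono i (coeff i (Q (ShefferLie.mono n f))) = 0 by rw [h, map_zero]
  refine ext fun ω => ?_
  let u : Polynomial ℂ := ∑ i ∈ Finset.range N, Polynomial.monomial i
      (ShefferLie.mono i (coeff i (Q (ShefferLie.mono n f))) ω)
  let d : ℕ → Poly X := fun j => (j.factorial : ℂ)⁻¹ • (D ω ^ j) (ShefferLie.mono n f)
  let v : Polynomial ℂ := ∑ j ∈ Finset.range (n + 1), (Polynomial.monomial j (l (d j)) +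
    Polynomial.monomial (j + 1) (ω (b (d j))))
  have hd : ∀ j m, n < m + j → d j ∈ degLT m := fun j m hj =>
    Submodule.smul_mem _ _ ((lowersBy_D ω).pow_one j m _ (mono_mem_degLT hj f))
  have huv : u = v := Polynomial.funext fun t => by
    have h1 : u.eval t = Q (ShefferLie.mono n f) (t • ω) := by
      rw [apply_smul hN]
      simp only [u, Polynomial.eval_finsetSum, Polynomial.eval_monomial, mul_comm]
    have h2 : E (t • ω) (ShefferLie.mono n f) = ∑ j ∈ Finset.range (n + 1), t ^ j • d j := by
      rw [E, fc_apply (lowersBy_D _) _ hfn]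
      refine Finset.sum_congr rfl fun j _ => ?_
      rw [D_smul, smul_pow, _root_.smul_apply, smul_comm]
      simp [d, PowerSeries.coeff_exp]
    rw [h1, hQ, h2]
    simp only [v, Polynomial.eval_finsetSum, Polynomial.eval_monomial, Polynomial.eval_add,
      map_sum, map_smul, Finset.sum_add_distrib, _root_.smul_apply, smul_eq_mul]
    congr 1
    · exact Finset.sum_congr rfl fun j _ => by ring
    · exact Finset.sum_congr rfl fun j _ => by ring
  have hu : u.coeff i = ShefferLie.mono i (coeff i (Q (ShefferLie.mono n f))) ω := by
    simp only [u, Polynomial.finsetSum_coeff, Polynomial.coeff_monomial]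
    rw [Finset.sum_ite_eq']
    split_ifs with h
    · rfl
    · rw [mem_degLT.1 hN i (by simpa using h), map_zero, zero_apply]
  have hv : v.coeff i = 0 := by
    simp only [v, Polynomial.finsetSum_coeff, Polynomial.coeff_add, Polynomial.coeff_monomial]
    refine Finset.sum_eq_zero fun j hj => ?_
    have hj' := Finset.mem_range.1 hj
    have h1 : (if j = i then l (d j) else 0) = 0 := by
      split_ifs with h
      · exact hl _ (hd j 1 (by omega))
      · rfl
    have h2 : (if j + 1 = i then ω (b (d j)) else 0) = 0 := by
      split_ifs with h
      · rw [hb _ (hd j 2 (by omega)), map_zero]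
      · rfl
    rw [h1, h2, add_zero]
  rw [← hu, huv, hv, zero_apply]

/-- In `E ν Q - Q E ν` the `l` terms and the terms paired with `ω` cancel. What remains is `ν (b (E
ω (E ν p)))`, which depends on `ω` only through the translate of `p`. -/
theorem IsRep.commutator_E (h : IsRep Q l b) (ν : Dual X) :
    ShiftInvariant (E ν * Q - Q * E ν) := by
  have key : ∀ p ω, ((E ν * Q - Q * E ν) p) ω = ν (b (E ω (E ν p))) := by
    intro p ω
    rw [_root_.sub_apply, sub_apply, mul_apply_eq_comp, mul_apply_eq_comp, E_apply_apply, h.2.2,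
      h.2.2, ← E_mul_E, mul_apply_eq_comp, _root_.add_apply]
    ring
  intro μ
  ext p
  refine ext fun ω => ?_
  rw [mul_apply_eq_comp, mul_apply_eq_comp, E_apply_apply, key, key, ← E_mul_E,
    ← mul_apply_eq_comp (E ν), E_comm ν μ]
  rfl

theorem IsRep.commutator (h : IsRep Q l b) {T : Poly X →L[ℂ] Poly X} (hT : ShiftInvariant T) :
    ShiftInvariant (T * Q - Q * T) := fun ν => by
  have h1 := hT.comm (h.commutator_E ν)
  have h2 := hT ν
  -- The Jacobi identity: `[E, [T, Q]] = [[E, T], Q] + [T, [E, Q]]`, and both inner terms on the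
  -- right vanish.
  have h3 : E ν * (T * Q - Q * T) - (T * Q - Q * T) * E ν =
      (E ν * T - T * E ν) * Q - Q * (E ν * T - T * E ν) +
        (T * (E ν * Q - Q * E ν) - (E ν * Q - Q * E ν) * T) := by noncomm_ring
  rw [h1, h2, sub_self, sub_self, zero_mul, mul_zero, sub_self, add_zero] at h3
  exact (sub_eq_zero.1 h3).symm

/-- Uses `exp(-Q) T exp(Q) = ∑ ad ^ j T / j!` with `ad T = T Q - Q T`. Each term is shift invariant,
and `ad ^ j T` lowers the degree by `j`, so the sum is finite on each polynomial. -/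
theorem IsRep.conj_exp (h : IsRep Q l b) {T P' : Poly X →L[ℂ] Poly X} (hT : ShiftInvariant T)
    (hP' : P' * fc (PowerSeries.exp ℂ) Q = 1) :
    ShiftInvariant (P' * T * fc (PowerSeries.exp ℂ) Q) := by
  have hQ := h.lowersBy
  let ad : Module.End ℂ (Poly X →L[ℂ] Poly X) := LinearMap.mulRight ℂ Q - LinearMap.mulLeft ℂ Q
  let A : ℕ → Poly X →L[ℂ] Poly X := fun j => (ad ^ j) T
  have hA : ∀ j, A (j + 1) = A j * Q - Q * A j := fun j => by
    simp only [A, pow_succ', Module.End.mul_apply]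
    rfl
  have hAinv : ∀ j, ShiftInvariant (A j) := fun j => by
    induction j with
    | zero => simpa [A] using hT
    | succ j ih => rw [hA]; exact h.commutator ih
  have hAlow : ∀ j, LowersBy j (A j) := fun j => by
    induction j with
    | zero => simpa [A] using hT.lowersBy_zero
    | succ j ih =>
      rw [hA]
      exact (ih.mul hQ).sub ((hQ.mul ih).mono (by omega))
  have hTQ : ∀ m, T * Q ^ m = ∑ x ∈ Finset.HasAntidiagonal.antidiagonal m,
      (m.choose x.1 : ℂ) • (Q ^ x.1 * A x.2) := by
    intro m
    -- Right multiplication by `Q` is left multiplication plus `ad`, two commuting maps, so its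
    -- powers follow from the binomial theorem.
    have h1 : LinearMap.mulRight ℂ Q = LinearMap.mulLeft ℂ Q + ad := by simp [ad]
    have h2 : Commute (LinearMap.mulLeft ℂ Q) ad :=
      (LinearMap.commute_mulLeft_right Q Q).sub_right (Commute.refl _)
    have h3 : T * Q ^ m = (LinearMap.mulRight ℂ Q ^ m) T := by
      rw [LinearMap.pow_mulRight]; rfl
    rw [h3, h1, h2.add_pow', LinearMap.sum_apply]
    refine Finset.sum_congr rfl fun x _ => ?_
    rw [LinearMap.smul_apply, Nat.cast_smul_eq_nsmul, Module.End.mul_apply, LinearMap.pow_mulLeft]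
    rfl
  have key : ∀ n p, p ∈ degLT n → (P' * T * fc (PowerSeries.exp ℂ) Q) p =
      ∑ j ∈ Finset.range n, (j.factorial : ℂ)⁻¹ • A j p := by
    intro n p hp
    set P := fc (PowerSeries.exp ℂ) Q with hPdef
    have h1 : T (P p) = P (∑ j ∈ Finset.range n, (j.factorial : ℂ)⁻¹ • A j p) := by
      have h2 : ∀ j, P (A j p) = ∑ i ∈ Finset.range n, (i.factorial : ℂ)⁻¹ • (Q ^ i) (A j p) :=
        fun j => by
          rw [hPdef, fc_apply hQ _ ((hAlow j).mono (Nat.zero_le j) n p hp)]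
          simp [PowerSeries.coeff_exp]
      rw [map_sum]
      simp only [map_smul, h2, Finset.smul_sum]
      rw [Finset.sum_comm, sum_range_prod_eq_sum_antidiagonal, hPdef, fc_apply hQ _ hp, map_sum]
      · refine Finset.sum_congr rfl fun m _ => ?_
        rw [map_smul, ← mul_apply_eq_comp, hTQ, sum_apply, Finset.smul_sum]
        refine Finset.sum_congr rfl fun x hx => ?_
        have hx' := Finset.HasAntidiagonal.mem_antidiagonal.1 hx
        rw [_root_.smul_apply, smul_smul, smul_smul, mul_apply_eq_comp]
        congr 1
        have h1 : (x.1.factorial : ℂ) ≠ 0 := by exact_mod_cast Nat.factorial_ne_zero _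
        have h2 : (x.2.factorial : ℂ) ≠ 0 := by exact_mod_cast Nat.factorial_ne_zero _
        have h3 : (m.factorial : ℂ) ≠ 0 := by exact_mod_cast Nat.factorial_ne_zero _
        have h4 : (m.choose x.1 : ℂ) * x.1.factorial * x.2.factorial = m.factorial := by
          rw [← hx', Nat.choose_symm_add]
          exact_mod_cast Nat.add_choose_mul_factorial_mul_factorial x.1 x.2
        simp only [PowerSeries.coeff_exp]
        simp only [one_div, map_inv₀, map_natCast]
        field_simp
        rw [← h4]
        ring
      · intro i j hij
        rw [← mul_apply_eq_comp, ((hQ.pow_one i).mul (hAlow j)).apply_eq_zero hp hij, smul_zero,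
          smul_zero]
    rw [mul_apply_eq_comp, mul_apply_eq_comp, h1, ← mul_apply_eq_comp, hP']
    rfl
  intro μ
  ext p
  obtain ⟨n, hp⟩ := exists_mem_degLT p
  rw [mul_apply_eq_comp _ (E μ), mul_apply_eq_comp (E μ), key n p hp, key n _ (lowersBy_E μ n p hp),
    map_sum]
  refine Finset.sum_congr rfl fun j _ => ?_
  rw [map_smul, ← mul_apply_eq_comp, ← mul_apply_eq_comp, hAinv j μ]

theorem isMonic_of_lowersBy {P : Poly X →L[ℂ] Poly X} (hP : LowersBy 1 (P - 1)) : IsMonic P := by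
  refine ⟨fun i k => ((coeff i).comp P).comp (monoCLM k), fun k f => ?_⟩
  have h1 : (P - 1) (ShefferLie.mono k f) ∈ degLT k :=
    hP k _ (mono_mem_degLT (Nat.lt_succ_self k) f)
  have h2 := sum_mono_coeff h1
  rw [_root_.sub_apply, one_apply_eq_self] at h2
  rw [← sub_eq_iff_eq_add', ← h2]
  refine Finset.sum_congr rfl fun i hi => ?_
  refine (((monoCLM i).comp (coeff i)).map_sub _ _).trans ?_
  have h3 : ((monoCLM i).comp (coeff i)) (ShefferLie.mono k f) = 0 := by
    rw [ContinuousLinearMap.comp_apply, coeff_mono_ne (by have := Finset.mem_range.1 hi; omega),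
      map_zero]
  rw [h3, sub_zero]
  rfl

/-- The exponential of `λ(D) + ⟨·, b(D)⟩` is a Sheffer operator. -/
theorem IsRep.isSheffer_exp (h : IsRep Q l b) : IsSheffer (fc (PowerSeries.exp ℂ) Q) := by
  have hQ := h.lowersBy
  set P := fc (PowerSeries.exp ℂ) Q with hPdef
  set P' := fc (PowerSeries.exp ℂ)⁻¹ Q with hPdef'
  have hexp : PowerSeries.constantCoeff (PowerSeries.exp ℂ) ≠ 0 := by simp
  have h1 : P * P' = 1 := fc_mul_fc_inv hQ hexp
  have h2 : P' * P = 1 := fc_inv_mul_fc hQ hexp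
  have hP : LowersBy 1 (P - 1) := lowersBy_fc_sub_one hQ (by simp)
  have hP0 : LowersBy 0 P := lowersBy_fc hQ _
  have hP' : LowersBy 1 (P' - 1) := lowersBy_fc_sub_one hQ (by
    rw [PowerSeries.coeff_zero_eq_constantCoeff_apply, PowerSeries.constantCoeff_inv]; simp)
  obtain ⟨b', hb'⟩ := exists_pairing_D ((eval 0).comp P')
  have hinv : ∀ ν, ShiftInvariant (P' * D ν * P) := fun ν => h.conj_exp (shiftInvariant_D ν) h2
  -- `B` is chosen so that `⟨ν, B(ξ)⟩` is the scalar series of the shift invariant operator `P' D ν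
  -- P`, and `A(ξ)` below is the value of `P exp ⟨·, ξ⟩` at `0`.
  let B : ∀ k : ℕ, SymCc X k →L[ℂ] C_c(X, ℂ) := fun k =>
    (k.factorial : ℂ)⁻¹ • (b'.comp P).comp (monoCLM k)
  let A : ∀ k : ℕ, SymCc X k →L[ℂ] ℂ := fun k =>
    (k.factorial : ℂ)⁻¹ • ((eval 0).comp P).comp (monoCLM k)
  have hA : ∀ k ξ, A k (powTensor ξ k) = P (expTerm ξ k) 0 := fun k ξ => by
    rw [expTerm, map_smul]; rfl
  have hB : ∀ k ξ (ν : Dual X), ν (B k (powTensor ξ k)) = ((P' * D ν * P) (expTerm ξ k)) 0 := by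
    intro k ξ ν
    have : B k (powTensor ξ k) = b' (P (expTerm ξ k)) := by
      rw [expTerm, map_smul, map_smul]; rfl
    rw [this, ← hb']
    rfl
  have hB0 : ∀ ξ, B 0 (powTensor ξ 0) = 0 := fun ξ => eq_zero_of_dual fun ν => by
    rw [hB, mul_apply_eq_comp, mul_apply_eq_comp,
      (lowersBy_D ν).apply_eq_zero (hP0 _ _ (expTerm_mem_degLT ξ 0)) le_rfl, map_zero, zero_apply]
  have hone : ∀ {R : Poly X →L[ℂ] Poly X}, LowersBy 1 (R - 1) → ∀ ξ,
      R (expTerm ξ 0) = expTerm ξ 0 := fun {R} hR ξ => by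
    have := hR.apply_eq_zero (expTerm_mem_degLT ξ 0) le_rfl
    rw [_root_.sub_apply, sub_eq_zero] at this
    exact this
  have hzero : ∀ ξ : C_c(X, ℂ), expTerm ξ 0 0 = 1 := fun ξ => by simp [expTerm_apply]
  refine ⟨isMonic_of_lowersBy hP, A, B, fun ξ => ?_, hB0, fun ξ => ?_, fun ν ξ => ?_⟩
  · rw [hA, hone hP, hzero]
  · rw [← sub_eq_zero]
    refine eq_zero_of_dual fun ν => ?_
    rw [map_sub, hB, mul_apply_eq_comp, mul_apply_eq_comp]
    have h3 : D ν (P (expTerm ξ 1)) = ν ξ • expTerm ξ 0 := by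
      have h4 : D ν ((P - 1) (expTerm ξ 1)) = 0 :=
        (lowersBy_D ν).apply_eq_zero (hP 1 _ (expTerm_mem_degLT ξ 1)) le_rfl
      rw [_root_.sub_apply, map_sub, sub_eq_zero] at h4
      rw [h4, one_apply_eq_self]
      simp [expTerm, D_pow_succ]
    rw [h3, map_smul, smul_apply, hone hP', hzero, mul_one, sub_self]
  · set β : PowerSeries ℂ := PowerSeries.mk fun k => ν (B k (powTensor ξ k)) with hβ
    have hβ0 : PowerSeries.constantCoeff β = 0 := by
      rw [← PowerSeries.coeff_zero_eq_constantCoeff_apply, hβ, PowerSeries.coeff_mk, hB0, map_zero]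
    -- Since `D ν P = P (P' D ν P)`, the derivative multiplies `P exp ⟨·, ξ⟩` by `β`.
    have hD : ∀ n, D ν (P (expTerm ξ n)) = conv β (fun k => P (expTerm ξ k)) n := fun n => by
      have h3 := (hinv ν).apply_expTerm ξ n
      have h4 : P * (P' * D ν * P) = D ν * P := by rw [← mul_assoc, ← mul_assoc, h1, one_mul]
      rw [← mul_apply_eq_comp (D ν), ← h4, mul_apply_eq_comp, h3, map_conv, hβ]
      simp only [hB]
    have hDj : ∀ j n, (D ν ^ j) (P (expTerm ξ n)) =
        conv (β ^ j) (fun k => P (expTerm ξ k)) n := fun j => by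
      induction j with
      | zero =>
        intro n
        refine ext fun ω => ?_
        rw [conv_apply]
        simp
      | succ j ih =>
        intro n
        rw [pow_succ', mul_apply_eq_comp, ih, map_conv]
        simp only [hD]
        rw [conv_conv, pow_succ]
    -- The value at `ν` is that of `exp (D ν)` at `0`. As `D ν` acts by `β`, this gives `exp β`
    -- times the value at `0`, which is `A(ξ)`.
    ext n
    rw [coeff_genFun, ← E_apply_zero, E, fc_apply (lowersBy_D ν) _
      (hP0 _ _ (expTerm_mem_degLT ξ n)), ← eval_apply, map_sum, PowerSeries.coeff_mul]
    simp only [hDj, map_smul, eval_apply, conv_apply, PowerSeries.coeff_mul, PowerSeries.coeff_mk,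
      hA, smul_eq_mul, Finset.mul_sum]
    rw [Finset.sum_comm]
    refine Finset.sum_congr rfl fun x hx => ?_
    have hx' := Finset.HasAntidiagonal.mem_antidiagonal.1 hx
    rw [coeff_exp_subst hβ0 (show x.1 < n + 1 by omega), Finset.sum_mul]
    refine Finset.sum_congr rfl fun j _ => ?_
    simp only [PowerSeries.coeff_exp, one_div, map_inv₀, map_natCast, mul_assoc]

end

/-- The logarithms of Sheffer operators are the operators of the form
`λ(D) + ⟨·, b(D)⟩`. -/
theorem mem_shefferLieAlgebra_iff (Q : Poly X →L[ℂ] Poly X) :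
    Q ∈ shefferLieAlgebra X ↔ ∃ l b, IsRep Q l b := by
  constructor
  · rintro ⟨P, hP, hQ⟩
    exact exists_isRep (IsLog.lowersBy_one (IsSheffer.lowersBy hP) hQ) fun T hT =>
      IsSheffer.commutator_log hP hQ hT
  · rintro ⟨l, b, h⟩
    exact ⟨_, h.isSheffer_exp, exists_log h.lowersBy⟩

end Poly

end Representation

/-! ### Riesz representation of functionals on compactly supported functions -/

section Jordan

variable {Y : Type*} [TopologicalSpace Y]

open CompactlySupportedContinuousMap

/-- The supremum of `L g` over all `0 ≤ g ≤ f`. -/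
def upperVal (L : C_c(Y, ℝ) →ₗ[ℝ] ℝ) (f : C_c(Y, NNReal)) : ℝ :=
  sSup ((fun g : C_c(Y, NNReal) => L g.toReal) '' {g | g ≤ f})

variable {L : C_c(Y, ℝ) →ₗ[ℝ] ℝ}
  (hb : ∀ f : C_c(Y, NNReal), BddAbove ((fun g : C_c(Y, NNReal) => L g.toReal) '' {g | g ≤ f}))

include hb

theorem le_upperVal {f g : C_c(Y, NNReal)} (h : g ≤ f) : L g.toReal ≤ upperVal L f :=
  le_csSup (hb f) ⟨g, h, rfl⟩

omit hb in
theorem upperVal_le {f : C_c(Y, NNReal)} {c : ℝ} (h : ∀ g ≤ f, L g.toReal ≤ c) :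
    upperVal L f ≤ c :=
  csSup_le ⟨_, f, le_refl f, rfl⟩ (by rintro _ ⟨g, hg, rfl⟩; exact h g hg)

omit hb in
theorem toReal_zero' : (0 : C_c(Y, NNReal)).toReal = 0 := by ext; simp

theorem upperVal_nonneg (f : C_c(Y, NNReal)) : 0 ≤ upperVal L f := by
  have := le_upperVal hb (f := f) (g := 0) fun x => zero_le
  rwa [toReal_zero', map_zero] at this

/-- Riesz decomposition: a function `g ≤ f₁ + f₂` splits as `g ⊓ f₁` plus a remainder that is at
most `f₂`. -/
theorem upperVal_add (f₁ f₂ : C_c(Y, NNReal)) :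
    upperVal L (f₁ + f₂) = upperVal L f₁ + upperVal L f₂ := by
  refine le_antisymm (upperVal_le fun g hg => ?_) ?_
  · obtain ⟨h, hh⟩ := CompactlySupportedContinuousMap.exists_add_of_le
      (inf_le_left : g ⊓ f₁ ≤ g)
    have h2 : h ≤ f₂ := fun x => by
      have h3 := DFunLike.congr_fun hh x
      have h4 := hg x
      simp only [coe_add, Pi.add_apply, inf_apply] at h3 h4
      change h x ≤ f₂ x
      rw [← NNReal.coe_le_coe] at h4 ⊢
      have h5 := congrArg NNReal.toReal h3
      push_cast at h4 h5
      rcases le_total (g x : ℝ) (f₁ x) with h6 | h6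
      · rw [min_eq_left h6] at h5
        have := (f₂ x).coe_nonneg
        linarith
      · rw [min_eq_right h6] at h5
        linarith
    rw [← hh, toReal_add, map_add]
    exact add_le_add (le_upperVal hb inf_le_right) (le_upperVal hb h2)
  · rw [← le_sub_iff_add_le]
    refine upperVal_le fun g₁ hg₁ => ?_
    rw [le_sub_comm]
    refine upperVal_le fun g₂ hg₂ => ?_
    rw [le_sub_iff_add_le', ← map_add, ← toReal_add]
    exact le_upperVal hb (add_le_add hg₁ hg₂)

omit hb in
theorem toReal_smul' (c : NNReal) (g : C_c(Y, NNReal)) : (c • g).toReal = (c : ℝ) • g.toReal := by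
  ext; simp [NNReal.smul_def]

theorem upperVal_smul (c : NNReal) (f : C_c(Y, NNReal)) :
    upperVal L (c • f) = c * upperVal L f := by
  have key : ∀ (c : NNReal), 0 < c → ∀ f, (c : ℝ) * upperVal L f ≤ upperVal L (c • f) := by
    intro c hc f
    rw [← le_div_iff₀' (by exact_mod_cast hc)]
    refine upperVal_le fun g hg => ?_
    rw [le_div_iff₀' (by exact_mod_cast hc), ← smul_eq_mul, ← map_smul, ← toReal_smul']
    exact le_upperVal hb fun x => mul_le_mul_right (hg x) c
  rcases eq_zero_or_pos c with rfl | hc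
  · have h0 : upperVal L (0 : C_c(Y, NNReal)) ≤ 0 := upperVal_le fun g hg => by
      have : g = 0 := le_antisymm hg fun x => zero_le
      rw [this, toReal_zero', map_zero]
    rw [zero_smul, NNReal.coe_zero, zero_mul]
    exact le_antisymm h0 (upperVal_nonneg hb 0)
  · refine le_antisymm ?_ (key c hc f)
    -- The reverse inequality is the same one for `c⁻¹`, applied to `c • f`.
    have := key c⁻¹ (inv_pos.2 hc) (c • f)
    rwa [inv_smul_smul₀ hc.ne', NNReal.coe_inv, inv_mul_le_iff₀ (by exact_mod_cast hc)] at this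

/-- The Jordan decomposition of an order bounded linear functional. -/
theorem exists_positive_sub_positive :
    ∃ P₁ P₂ : C_c(Y, ℝ) →ₚ[ℝ] ℝ, ∀ f, L f = P₁ f - P₂ f := by
  let U : C_c(Y, NNReal) →ₗ[NNReal] NNReal :=
    { toFun := fun f => ⟨upperVal L f, upperVal_nonneg hb f⟩
      map_add' := fun f g => NNReal.eq (upperVal_add hb f g)
      map_smul' := fun c f => NNReal.eq (upperVal_smul hb c f) }
  let V : C_c(Y, NNReal) →ₗ[NNReal] NNReal :=
    { toFun := fun f => ⟨upperVal L f - L f.toReal, sub_nonneg.2 (le_upperVal hb le_rfl)⟩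
      map_add' := fun f g => NNReal.eq (by
        change upperVal L (f + g) - L (f + g).toReal =
          (upperVal L f - L f.toReal) + (upperVal L g - L g.toReal)
        rw [upperVal_add hb, toReal_add, map_add]
        ring)
      map_smul' := fun c f => NNReal.eq (by
        change upperVal L (c • f) - L (c • f).toReal = (c : ℝ) * (upperVal L f - L f.toReal)
        rw [upperVal_smul hb, toReal_smul', map_smul, smul_eq_mul]
        ring) }
  refine ⟨toRealPositiveLinear U, toRealPositiveLinear V, fun f => ?_⟩
  rw [toRealPositiveLinear_apply, toRealPositiveLinear_apply]
  change L f = (upperVal L f.nnrealPart - upperVal L (-f).nnrealPart) -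
    ((upperVal L f.nnrealPart - L f.nnrealPart.toReal) -
      (upperVal L (-f).nnrealPart - L (-f).nnrealPart.toReal))
  conv_lhs => rw [← nnrealPart_sub_nnrealPart_neg f, map_sub]
  ring

end Jordan

section Riesz

variable {Y : Type*} [TopologicalSpace Y] [T2Space Y]

/-- A real function regarded as a complex one. -/
def ofRealCc : C_c(Y, ℝ) →ₗ[ℝ] C_c(Y, ℂ) where
  toFun f := ⟨⟨fun y => (f y : ℂ), by fun_prop⟩, f.hasCompactSupport.comp_left Complex.ofReal_zero⟩
  map_add' f g := by ext; simp
  map_smul' c f := by ext; simp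

omit [T2Space Y] in
@[simp] theorem ofRealCc_apply (f : C_c(Y, ℝ)) (y : Y) : ofRealCc f y = (f y : ℂ) := rfl

/-- The real part of a complex function. -/
def reCc (f : C_c(Y, ℂ)) : C_c(Y, ℝ) :=
  ⟨⟨fun y => (f y).re, by fun_prop⟩, f.hasCompactSupport.comp_left Complex.zero_re⟩

/-- The imaginary part of a complex function. -/
def imCc (f : C_c(Y, ℂ)) : C_c(Y, ℝ) :=
  ⟨⟨fun y => (f y).im, by fun_prop⟩, f.hasCompactSupport.comp_left Complex.zero_im⟩

omit [T2Space Y] in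
theorem re_add_im_Cc (f : C_c(Y, ℂ)) : ofRealCc (reCc f) + Complex.I • ofRealCc (imCc f) = f := by
  ext y
  change ((f y).re : ℂ) + Complex.I * ((f y).im : ℂ) = f y
  rw [mul_comm, Complex.re_add_im]

/-- All `g` with `0 ≤ g ≤ f` lie in a bounded subset of one Banach space, that of functions
vanishing outside the support of `f`, on which `F` has finite norm. -/
theorem bddAbove_of_norm_le (F : C_c(Y, ℂ) →L[ℂ] ℂ) (L : C_c(Y, ℝ) →ₗ[ℝ] ℝ)
    (h : ∀ f, |L f| ≤ ‖F (ofRealCc f)‖) (f : C_c(Y, NNReal)) :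
    BddAbove ((fun g : C_c(Y, NNReal) => L g.toReal) '' {g | g ≤ f}) := by
  obtain ⟨C, hC⟩ := f.toReal.continuous.bounded_above_of_compact_support f.toReal.hasCompactSupport
  let K : TopologicalSpace.Compacts Y := ⟨tsupport f, f.hasCompactSupport⟩
  let F' : suppIn (K : Set Y) →L[ℂ] ℂ :=
    ⟨F.toLinearMap ∘ₗ suppInToCc K, F.continuous.comp (continuous_suppInToCc K)⟩
  refine ⟨‖F'‖ * max C 0, ?_⟩
  rintro _ ⟨g, hg, rfl⟩
  have hgC : ∀ y, ‖ofRealCc g.toReal y‖ ≤ max C 0 := fun y => by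
    rw [ofRealCc_apply, Complex.norm_real]
    have h1 : ‖f.toReal y‖ ≤ C := hC y
    have h2 : (g y : ℝ) ≤ f y := hg y
    simp only [CompactlySupportedContinuousMap.toReal_apply, Real.norm_eq_abs,
      NNReal.abs_eq] at h1 ⊢
    exact (h2.trans h1).trans (le_max_left _ _)
  let d : suppIn (K : Set Y) := ⟨BoundedContinuousFunction.ofNormedAddCommGroup
    (ofRealCc g.toReal) (ofRealCc g.toReal).continuous _ hgC, fun y hy => by
      have h1 : f y = 0 := image_eq_zero_of_notMem_tsupport hy
      have h2 : g y = 0 := le_antisymm ((hg y).trans h1.le) zero_le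
      change ((g.toReal y : ℝ) : ℂ) = 0
      simp [h2]⟩
  refine (le_abs_self _).trans ((h _).trans ?_)
  change ‖F' d‖ ≤ _
  refine (F'.le_opNorm d).trans (mul_le_mul_of_nonneg_left ?_ (norm_nonneg _))
  exact (BoundedContinuousFunction.norm_le (le_max_right _ _)).2 hgC

/-- A continuous functional on `C_c(Y; ℂ)` is a combination of four positive functionals. -/
theorem exists_positive_decomposition (F : C_c(Y, ℂ) →L[ℂ] ℂ) :
    ∃ P₁ P₂ P₃ P₄ : C_c(Y, ℝ) →ₚ[ℝ] ℝ, ∀ f : C_c(Y, ℝ), F (ofRealCc f) =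
      ((P₁ f - P₂ f : ℝ) : ℂ) + Complex.I * ((P₃ f - P₄ f : ℝ) : ℂ) := by
  let G : C_c(Y, ℝ) →ₗ[ℝ] ℂ :=
    { toFun := fun f => F (ofRealCc f)
      map_add' := fun f g => by rw [map_add, map_add]
      map_smul' := fun c f => by
        have : ofRealCc (c • f) = (c : ℂ) • ofRealCc f := by ext; simp
        rw [this, map_smul]
        simp }
  obtain ⟨P₁, P₂, h₁⟩ := exists_positive_sub_positive
    (bddAbove_of_norm_le F (Complex.reLm ∘ₗ G) fun f => Complex.abs_re_le_norm (G f))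
  obtain ⟨P₃, P₄, h₂⟩ := exists_positive_sub_positive
    (bddAbove_of_norm_le F (Complex.imLm ∘ₗ G) fun f => Complex.abs_im_le_norm (G f))
  refine ⟨P₁, P₂, P₃, P₄, fun f => ?_⟩
  rw [← h₁, ← h₂, mul_comm]
  exact (Complex.re_add_im (G f)).symm

variable [LocallyCompactSpace Y]

/-- The complex Radon measure built from four positive functionals. -/
def radonOfPositive (P₁ P₂ P₃ P₄ : C_c(Y, ℝ) →ₚ[ℝ] ℝ) : ComplexRadonMeasure Y :=
  letI : MeasurableSpace Y := borel Y
  haveI : BorelSpace Y := ⟨rfl⟩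
  { rePos := RealRMK.rieszMeasure P₁
    reNeg := RealRMK.rieszMeasure P₂
    imPos := RealRMK.rieszMeasure P₃
    imNeg := RealRMK.rieszMeasure P₄
    regular_rePos := RealRMK.regular_rieszMeasure P₁
    regular_reNeg := RealRMK.regular_rieszMeasure P₂
    regular_imPos := RealRMK.regular_rieszMeasure P₃
    regular_imNeg := RealRMK.regular_rieszMeasure P₄ }

theorem radonOfPositive_toDual {F : C_c(Y, ℂ) →L[ℂ] ℂ} {P₁ P₂ P₃ P₄ : C_c(Y, ℝ) →ₚ[ℝ] ℝ}
    (h : ∀ f : C_c(Y, ℝ), F (ofRealCc f) =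
      ((P₁ f - P₂ f : ℝ) : ℂ) + Complex.I * ((P₃ f - P₄ f : ℝ) : ℂ)) :
    (radonOfPositive P₁ P₂ P₃ P₄).toDual = F := by
  let : MeasurableSpace Y := borel Y
  have : BorelSpace Y := ⟨rfl⟩
  have hreal : ∀ f : C_c(Y, ℝ), (radonOfPositive P₁ P₂ P₃ P₄).toDual (ofRealCc f) =
      F (ofRealCc f) := by
    intro f
    rw [h, ← RealRMK.integral_rieszMeasure P₁, ← RealRMK.integral_rieszMeasure P₂,
      ← RealRMK.integral_rieszMeasure P₃, ← RealRMK.integral_rieszMeasure P₄]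
    push_cast
    simp only [← integral_complex_ofReal]
    rfl
  ext f
  rw [← re_add_im_Cc f, map_add, map_add, map_smul, map_smul, hreal, hreal]

/-- Every continuous functional on `C_c(Y; ℂ)` is a complex Radon measure. -/
theorem exists_toDual_eq (F : C_c(Y, ℂ) →L[ℂ] ℂ) : ∃ m : ComplexRadonMeasure Y, m.toDual = F := by
  obtain ⟨P₁, P₂, P₃, P₄, h⟩ := exists_positive_decomposition F
  exact ⟨_, radonOfPositive_toDual h⟩

/-- Composition of real functions with a homeomorphism. -/
def compHomeoReal (e : Y ≃ₜ Y) : C_c(Y, ℝ) →ₗ[ℝ] C_c(Y, ℝ) where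
  toFun f := ⟨f.toContinuousMap.comp ⟨e, e.continuous⟩, f.hasCompactSupport.comp_homeomorph e⟩
  map_add' _ _ := rfl
  map_smul' _ _ := rfl

omit [T2Space Y] [LocallyCompactSpace Y] in
@[simp] theorem compHomeoReal_apply (e : Y ≃ₜ Y) (f : C_c(Y, ℝ)) (y : Y) :
    compHomeoReal e f y = f (e y) := rfl

/-- The image measure is regular and has the same integrals, so uniqueness in the Riesz theorem
applies. -/
theorem map_rieszMeasure [MeasurableSpace Y] [BorelSpace Y] {P : C_c(Y, ℝ) →ₚ[ℝ] ℝ} {e : Y ≃ₜ Y}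
    (h : ∀ f, P (compHomeoReal e f) = P f) :
    (RealRMK.rieszMeasure P).map e = RealRMK.rieszMeasure P := by
  have := MeasureTheory.Measure.Regular.map (μ := RealRMK.rieszMeasure P) e
  refine MeasureTheory.Measure.ext_of_integral_eq_on_compactlySupported fun f => ?_
  have h1 : ∫ x, f x ∂(RealRMK.rieszMeasure P).map e = ∫ x, compHomeoReal e f x ∂(RealRMK.rieszMeasure P) :=
    MeasureTheory.integral_map_of_stronglyMeasurable e.continuous.measurable
      (f.continuous.stronglyMeasurable_of_hasCompactSupport f.hasCompactSupport)
  rw [h1, RealRMK.integral_rieszMeasure, RealRMK.integral_rieszMeasure, h f]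

end Riesz

/-! ### Riesz representation by symmetric measures -/

section SymmetricRiesz

variable {X : Type*} [TopologicalSpace X] [T2Space X]

/-- The average of a positive functional over the permutations of the coordinates. -/
def avgPositive {k : ℕ} (P : C_c(Fin k → X, ℝ) →ₚ[ℝ] ℝ) : C_c(Fin k → X, ℝ) →ₚ[ℝ] ℝ :=
  PositiveLinearMap.mk₀ ((k.factorial : ℝ)⁻¹ • ∑ σ : Equiv.Perm (Fin k),
    P.toLinearMap ∘ₗ compHomeoReal (permHomeo σ)) fun f hf => by
      rw [LinearMap.smul_apply, LinearMap.sum_apply]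
      exact smul_nonneg (by positivity) (Finset.sum_nonneg fun σ _ =>
        P.map_nonneg fun x => hf (x ∘ σ))

omit [T2Space X] in
theorem avgPositive_apply {k : ℕ} (P : C_c(Fin k → X, ℝ) →ₚ[ℝ] ℝ) (f : C_c(Fin k → X, ℝ)) :
    avgPositive P f = (k.factorial : ℝ)⁻¹ *
      ∑ σ : Equiv.Perm (Fin k), P (compHomeoReal (permHomeo σ) f) := by
  change ((k.factorial : ℝ)⁻¹ • ∑ σ : Equiv.Perm (Fin k),
    P.toLinearMap ∘ₗ compHomeoReal (permHomeo σ)) f = _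
  rw [LinearMap.smul_apply, LinearMap.sum_apply]
  rfl

omit [T2Space X] in
theorem avgPositive_comp {k : ℕ} (P : C_c(Fin k → X, ℝ) →ₚ[ℝ] ℝ) (τ : Equiv.Perm (Fin k))
    (f : C_c(Fin k → X, ℝ)) :
    avgPositive P (compHomeoReal (permHomeo τ) f) = avgPositive P f := by
  rw [avgPositive_apply, avgPositive_apply]
  congr 1
  exact Fintype.sum_equiv (Equiv.mulRight τ) _ _ fun σ => rfl

variable [LocallyCompactSpace X]

/-- Every continuous functional on the symmetric functions is a symmetric complex Radon
measure. -/
theorem exists_isSymm_integral_eq {k : ℕ} (F : SymCc X k →L[ℂ] ℂ) :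
    ∃ m : ComplexRadonMeasure (Fin k → X), m.IsSymm ∧
      ∀ f : SymCc X k, m.integral (f : C_c(Fin k → X, ℂ)) = F f := by
  -- The positive parts need not be invariant under permutations, so each is averaged. Their
  -- combination is unchanged because `F ∘ symCLM k` is already invariant.
  obtain ⟨P₁, P₂, P₃, P₄, h⟩ := exists_positive_decomposition (F.comp (symCLM k))
  refine ⟨radonOfPositive (avgPositive P₁) (avgPositive P₂) (avgPositive P₃) (avgPositive P₄),
    fun σ A hA _ => ?_, fun f => ?_⟩
  · let : MeasurableSpace (Fin k → X) := borel (Fin k → X)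
    have : BorelSpace (Fin k → X) := ⟨rfl⟩
    have key : ∀ P : C_c(Fin k → X, ℝ) →ₚ[ℝ] ℝ,
        RealRMK.rieszMeasure (avgPositive P) ((fun x => x ∘ σ) ⁻¹' A) =
          RealRMK.rieszMeasure (avgPositive P) A := by
      intro P
      have h1 := map_rieszMeasure (e := permHomeo σ) (avgPositive_comp P σ)
      conv_rhs => rw [← h1, MeasureTheory.Measure.map_apply
        (permHomeo σ).continuous.measurable hA]
      rfl
    have h1 := key P₁
    have h2 := key P₂
    have h3 := key P₃
    have h4 := key P₄
    simp only [ComplexRadonMeasure.value, radonOfPositive]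
    rw [h1, h2, h3, h4]
  · have h1 : (radonOfPositive (avgPositive P₁) (avgPositive P₂) (avgPositive P₃)
        (avgPositive P₄)).toDual = F.comp (symCLM k) := by
      refine radonOfPositive_toDual fun f => ?_
      have h2 : ∀ σ : Equiv.Perm (Fin k), (F.comp (symCLM k)) (ofRealCc f) =
          (F.comp (symCLM k)) (ofRealCc (compHomeoReal (permHomeo σ) f)) := by
        intro σ
        rw [ContinuousLinearMap.comp_apply, ContinuousLinearMap.comp_apply]
        congr 1
        ext x
        rw [coe_symCLM, coe_symCLM, avgCLM_apply, avgCLM_apply]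
        congr 1
        exact Fintype.sum_equiv (Equiv.mulRight σ⁻¹) _ _ fun τ => by
          simp [Function.comp_def]
      have h3 : (F.comp (symCLM k)) (ofRealCc f) = (k.factorial : ℂ)⁻¹ *
          ∑ σ : Equiv.Perm (Fin k),
            (F.comp (symCLM k)) (ofRealCc (compHomeoReal (permHomeo σ) f)) := by
        rw [← Finset.sum_congr rfl fun σ _ => h2 σ]
        simp [Fintype.card_perm, Nat.factorial_ne_zero]
      rw [h3]
      simp only [h, avgPositive_apply, Finset.sum_add_distrib, ← Finset.mul_sum]
      push_cast
      simp only [Finset.sum_sub_distrib]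
      ring
    rw [← ComplexRadonMeasure.toDual_apply, h1, ContinuousLinearMap.comp_apply, symCLM_coe]

end SymmetricRiesz

/-! ### Taylor coefficients as Radon measures and kernels -/

section Kernels

variable {X : Type*} [TopologicalSpace X] [T2Space X] [LocallyCompactSpace X]

namespace Poly

theorem iterD_mul_E {k : ℕ} (μ : Fin k → Dual X) (ω : Dual X) :
    iterD μ * E ω = E ω * iterD μ := by
  induction k with
  | zero => rw [iterD_zero, one_mul, mul_one]
  | succ k ih => rw [iterD_succ, mul_assoc, ih, ← mul_assoc, shiftInvariant_D, mul_assoc]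

/-- Derivatives at `ω` are derivatives at `0` of the translate `E ω p`, that is, its Taylor
coefficients up to `k!`. In particular they are symmetric compactly supported functions of `x`, so
the measures can be applied to them. -/
theorem diracDeriv_eq_coeff {k : ℕ} (p : Poly X) (ω : Dual X) (x : Fin k → X) :
    diracDeriv x p ω =
      (((k.factorial : ℂ) • coeff k (E ω p) : SymCc X k) : C_c(Fin k → X, ℂ)) x := by
  change _ = (k.factorial : ℂ) * (coeff k (E ω p) : C_c(Fin k → X, ℂ)) x
  rw [coeff_apply, ← mul_assoc, mul_inv_cancel₀ (by exact_mod_cast k.factorial_ne_zero), one_mul,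
    ← mul_apply_eq_comp, iterD_mul_E, mul_apply_eq_comp, E_apply_zero, diracDeriv_eq]

theorem eq_sum_Icc_coeff {G : Type*} [AddCommGroup G] [Module ℂ G] [TopologicalSpace G]
    (L : Poly X →L[ℂ] G) {r n N : ℕ} {q : Poly X}
    (hL : ∀ j < r, ∀ f, L (ShefferLie.mono j f) = 0) (hq : q ∈ degLT n) (hN : n ≤ N) :
    L q = ∑ k ∈ Finset.Icc r N, L (ShefferLie.mono k (coeff k q)) := by
  conv_lhs => rw [← sum_mono_coeff (degLT_mono (hN.trans N.le_succ) hq), map_sum]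
  refine (Finset.sum_subset (fun k hk => ?_) fun k hk hk' => ?_).symm
  · rw [Finset.mem_Icc] at hk
    exact Finset.mem_range.2 (Nat.lt_succ_of_le hk.2)
  · rw [Finset.mem_range] at hk
    rw [Finset.mem_Icc] at hk'
    exact hL k (by omega) _

/-- If the measures `α k` and `β k x` are the Taylor coefficients of `l` and `b`, the
differential operator they define is `l(D) + ⟨ω, b(D)⟩`. -/
theorem eventually_sum_integral_eq {l : Poly X →L[ℂ] ℂ} {b : Poly X →L[ℂ] C_c(X, ℂ)}
    {α : ∀ k : ℕ, ComplexRadonMeasure (Fin k → X)}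
    {β : ∀ k : ℕ, X → ComplexRadonMeasure (Fin k → X)}
    (hl : ∀ j < 1, ∀ f, l (ShefferLie.mono j f) = 0)
    (hb : ∀ j < 2, ∀ f, b (ShefferLie.mono j f) = 0)
    (hα : ∀ k, 1 ≤ k → ∀ f : SymCc X k, l (ShefferLie.mono k f) =
      (α k).integral (((k.factorial : ℂ) • f : SymCc X k) : C_c(Fin k → X, ℂ)))
    (hβ : ∀ k, 2 ≤ k → ∀ (f : SymCc X k) (x : X), b (ShefferLie.mono k f) x =
      (β k x).integral (((k.factorial : ℂ) • f : SymCc X k) : C_c(Fin k → X, ℂ)))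
    (p : Poly X) (m : ComplexRadonMeasure X) :
    ∀ᶠ N : ℕ in Filter.atTop,
      ∑ k ∈ Finset.Icc 1 N, (α k).integral (fun x => diracDeriv x p m.toDual) +
        ∑ k ∈ Finset.Icc 2 N,
          m.integral (fun x => (β k x).integral fun y => diracDeriv y p m.toDual) =
      l (E m.toDual p) + m.toDual (b (E m.toDual p)) := by
  obtain ⟨n, hn⟩ := exists_mem_degLT (E m.toDual p)
  filter_upwards [Filter.eventually_ge_atTop n] with N hN
  rw [eq_sum_Icc_coeff l hl hn hN, eq_sum_Icc_coeff b hb hn hN, map_sum]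
  simp only [diracDeriv_eq_coeff]
  congr 1
  · refine Finset.sum_congr rfl fun k hk => ?_
    rw [hα k (Finset.mem_Icc.1 hk).1]
  · refine Finset.sum_congr rfl fun k hk => ?_
    rw [ComplexRadonMeasure.toDual_apply]
    congr 1
    funext x
    rw [hβ k (Finset.mem_Icc.1 hk).1]

theorem eq_zero_of_mem_degLT {G : Type*} [AddCommGroup G] [Module ℂ G] [TopologicalSpace G]
    (L : Poly X →L[ℂ] G) {r : ℕ} (hL : ∀ j < r, ∀ f, L (ShefferLie.mono j f) = 0) :
    ∀ p ∈ degLT r, L p = 0 := fun p hp => by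
  rw [← sum_mono_coeff hp, map_sum]
  exact Finset.sum_eq_zero fun j hj => hL j (Finset.mem_range.1 hj) _

theorem IsRep.exists_kernels {Q : Poly X →L[ℂ] Poly X} {l : Poly X →L[ℂ] ℂ}
    {b : Poly X →L[ℂ] C_c(X, ℂ)} (h : IsRep Q l b) :
    ∃ (α : ∀ k : ℕ, ComplexRadonMeasure (Fin k → X))
      (β : ∀ k : ℕ, X → ComplexRadonMeasure (Fin k → X)),
      (∀ k, 1 ≤ k → (α k).IsSymm) ∧ (∀ k, 2 ≤ k → IsKernel (β k)) ∧
      ∀ (p : Poly X) (m : ComplexRadonMeasure X), ∀ᶠ N : ℕ in Filter.atTop, Q p m.toDual =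
        ∑ k ∈ Finset.Icc 1 N, (α k).integral (fun x => diracDeriv x p m.toDual) +
        ∑ k ∈ Finset.Icc 2 N,
          m.integral (fun x => (β k x).integral fun y => diracDeriv y p m.toDual) := by
  obtain ⟨hl, hb, hQ⟩ := h
  have hk0 : ∀ k : ℕ, (k.factorial : ℂ) ≠ 0 := fun k => by exact_mod_cast k.factorial_ne_zero
  -- The factor `1 / k!` compensates the `k!` relating Dirac derivatives to coefficients.
  choose α hα hα' using fun k : ℕ =>
    exists_isSymm_integral_eq ((k.factorial : ℂ)⁻¹ • l.comp (monoCLM (X := X) k))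
  choose β hβ hβ' using fun (k : ℕ) (x : X) => exists_isSymm_integral_eq
    ((dirac x).comp ((k.factorial : ℂ)⁻¹ • b.comp (monoCLM (X := X) k)))
  refine ⟨α, β, fun k _ => hα k, fun k _ =>
    ⟨hβ k, (k.factorial : ℂ)⁻¹ • b.comp (monoCLM k), fun f x => (hβ' k x f).symm⟩,
    fun p m => ?_⟩
  filter_upwards [eventually_sum_integral_eq (α := α) (β := β)
    (fun j hj f => hl _ (mono_mem_degLT hj f)) (fun j hj f => hb _ (mono_mem_degLT hj f))
    (fun k _ f => by
      rw [hα', map_smul]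
      change _ = (k.factorial : ℂ) * ((k.factorial : ℂ)⁻¹ * l (ShefferLie.mono k f))
      rw [mul_inv_cancel_left₀ (hk0 k)])
    (fun k _ f x => by
      rw [hβ', map_smul]
      change _ = (k.factorial : ℂ) * ((k.factorial : ℂ)⁻¹ * b (ShefferLie.mono k f) x)
      rw [mul_inv_cancel_left₀ (hk0 k)]) p m] with N hN
  rw [hN, hQ]

theorem exists_isRep_of_kernels {Q : Poly X →L[ℂ] Poly X}
    {α : ∀ k : ℕ, ComplexRadonMeasure (Fin k → X)}
    {β : ∀ k : ℕ, X → ComplexRadonMeasure (Fin k → X)} (hβ : ∀ k, 2 ≤ k → IsKernel (β k))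
    (hQ : ∀ (p : Poly X) (m : ComplexRadonMeasure X), ∀ᶠ N : ℕ in Filter.atTop, Q p m.toDual =
      ∑ k ∈ Finset.Icc 1 N, (α k).integral (fun x => diracDeriv x p m.toDual) +
      ∑ k ∈ Finset.Icc 2 N,
        m.integral (fun x => (β k x).integral fun y => diracDeriv y p m.toDual)) :
    ∃ l b, IsRep Q l b := by
  -- The formula involves `β k` only for `k ≥ 2`, so the lower components of `b` are set to zero;
  -- `l` below likewise gets no component of degree `0`.
  have hT : ∀ k, ∃ T : SymCc X k →L[ℂ] C_c(X, ℂ), (k < 2 → T = 0) ∧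
      (2 ≤ k → ∀ (f : SymCc X k) (x : X), T f x =
        (β k x).integral (((k.factorial : ℂ) • f : SymCc X k) : C_c(Fin k → X, ℂ))) := by
    intro k
    rcases lt_or_ge k 2 with hk | hk
    · exact ⟨0, fun _ => rfl, fun h => absurd hk h.not_gt⟩
    · obtain ⟨-, T, hT⟩ := hβ k hk
      exact ⟨(k.factorial : ℂ) • T, fun h => absurd hk h.not_ge, fun _ f x => by
        rw [← hT, map_smul, _root_.smul_apply]⟩
  choose T hT0 hT using hT
  obtain ⟨b, hb⟩ := exists_lift T
  obtain ⟨l, hl⟩ := exists_lift fun k : ℕ => if k = 0 then (0 : SymCc X k →L[ℂ] ℂ) else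
    (k.factorial : ℂ) • (α k).toDual.comp (SymCc X k).subtypeL
  have hl0 : ∀ j < 1, ∀ f : SymCc X j, l (ShefferLie.mono j f) = 0 := fun j hj f => by
    rw [hl, if_pos (Nat.lt_one_iff.1 hj), _root_.zero_apply]
  have hb0 : ∀ j < 2, ∀ f : SymCc X j, b (ShefferLie.mono j f) = 0 := fun j hj f => by
    rw [hb, hT0 j hj, _root_.zero_apply]
  refine ⟨l, b, eq_zero_of_mem_degLT l hl0, eq_zero_of_mem_degLT b hb0, fun p ω => ?_⟩
  -- The formula is given at measures; by the Riesz theorem these exhaust the dual space.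
  obtain ⟨m, rfl⟩ := exists_toDual_eq ω
  obtain ⟨N, hN, hN'⟩ := ((hQ p m).and (eventually_sum_integral_eq (α := α) (β := β) hl0 hb0
    (fun k hk f => by
      rw [hl, if_neg (by omega), ← ComplexRadonMeasure.toDual_apply]
      exact ((α k).toDual.map_smul (k.factorial : ℂ) (f : C_c(Fin k → X, ℂ))).symm)
    (fun k hk f x => by rw [hb, hT k hk]) p m)).exists
  rw [hN, hN']

end Poly

end Kernels

end ShefferLie

end

theorem mainTheorem10 {X : Type*} [TopologicalSpace X] [T2Space X] [LocallyCompactSpace X]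
    [SigmaCompactSpace X] (Q : ShefferLie.Poly X →L[ℂ] ShefferLie.Poly X) :
    Q ∈ ShefferLie.shefferLieAlgebra X ↔
      ∃ (α : ∀ k : ℕ, ShefferLie.ComplexRadonMeasure (Fin k → X))
        (β : ∀ k : ℕ, X → ShefferLie.ComplexRadonMeasure (Fin k → X)),
        (∀ k, 1 ≤ k → (α k).IsSymm) ∧ (∀ k, 2 ≤ k → ShefferLie.IsKernel (β k)) ∧
        ∀ (p : ShefferLie.Poly X) (m : ShefferLie.ComplexRadonMeasure X),
          ∀ᶠ N : ℕ in Filter.atTop,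
            Q p m.toDual =
              ∑ k ∈ Finset.Icc 1 N,
                (α k).integral (fun x => ShefferLie.diracDeriv x p m.toDual) +
              ∑ k ∈ Finset.Icc 2 N,
                m.integral (fun x =>
                  (β k x).integral fun y => ShefferLie.diracDeriv y p m.toDual) := by
  rw [ShefferLie.Poly.mem_shefferLieAlgebra_iff]
  constructor
  · rintro ⟨l, b, h⟩
    exact h.exists_kernels
  · rintro ⟨α, β, -, hβ, hQ⟩
    exact ShefferLie.Poly.exists_isRep_of_kernels hβ hQ
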